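/- **Theorem ($C^1$ Hopf–Rinow).** Let $M$ be a connected smooth manifold (Hausdorff, finite-dimensional, without boundary) and let $g$ be a Riemannian metric on $M$ of regularity $C^1$. Let $d_g$ be the induced distance, i.e. $d_g(x,y)$ is the infimum of the $g$-lengths $\int\sqrt{g(\dot\gamma,\dot\gamma)}\,dt$ of $C^1$ curves from $x$ to $y$. For an open interval $J\subseteq\mathbb R$, a *geodesic* $\gamma:J\to M$ is a $C^2$ curve which in every smooth chart satisfies $$\ddot\gamma^{k}+\sum_{i,j}\Gamma^{k}_{ij}(\gamma)\,\dot\gamma^{i}\dot\gamma^{j}=0\quad\text{for all }k,\qquad \Gamma^k_{ij}=\tfrac12\sum_l g^{kl}\left(\partial_i g_{jl}+\partial_j g_{il}-\partial_l g_{ij}\right),$$ where the Christoffel symbols $\Gamma^k_{ij}$ are merely continuous, so that geodesics need not be determined by their initial data. Then the following are equivalent: 1. $(M,d_g)$ is a complete metric space. 2. $(M,d_g)$ is a proper metric space, i.e. closed bounded sets are compact. 3. $(M,g)$ is geodesically complete, i.e. for all $-\infty\le a<b\le\infty$, every geodesic $\gamma:(a,b)\to M$ can be extended to a geodesic $\bar\gamma:\mathbb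 R\to M$. -/

import Mathlib

open scoped Manifold ContDiff Bundle Topology

noncomputable section

/-- The type of `C^1` Riemannian metrics on an `n`-dimensional manifold `M`: families of inner
products on the tangent spaces which form a `C^1` section of the bundle of `(0,2)`-tensors. -/
abbrev C1RiemannianMetric (n : ℕ) (M : Type*) [TopologicalSpace M]
    [ChartedSpace (EuclideanSpace ℝ (Fin n)) M] [IsManifold (𝓡 n) ∞ M] : Type _ :=
  Bundle.ContMDiffRiemannianMetric (𝓡 n) 1 (EuclideanSpace ℝ (Fin n))
    (fun x : M ↦ TangentSpace (𝓡 n) x)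

namespace C1RiemannianMetric

section Distance

/-- The extended distance `d_g(x, y)`: the infimum over all `C^1` paths `γ` from `x` to `y` of the
length `∫ √(g(γ', γ'))`. -/
def edistance {n : ℕ} {M : Type*} [TopologicalSpace M]
    [ChartedSpace (EuclideanSpace ℝ (Fin n)) M] [IsManifold (𝓡 n) ∞ M]
    (g : C1RiemannianMetric n M) (x y : M) : ENNReal :=
  letI : Bundle.RiemannianBundle (fun x : M ↦ TangentSpace (𝓡 n) x) := ⟨g.toRiemannianMetric⟩
  Manifold.riemannianEDist (𝓡 n) x y

theorem isContinuousRiemannianBundle {n : ℕ} {M : Type*} [TopologicalSpace M]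
    [ChartedSpace (EuclideanSpace ℝ (Fin n)) M] [IsManifold (𝓡 n) ∞ M]
    (g : C1RiemannianMetric n M) :
    letI : Bundle.RiemannianBundle (fun x : M ↦ TangentSpace (𝓡 n) x) := ⟨g.toRiemannianMetric⟩
    IsContinuousRiemannianBundle (EuclideanSpace ℝ (Fin n))
      (fun x : M ↦ TangentSpace (𝓡 n) x) := by
  let : Bundle.RiemannianBundle (fun x : M ↦ TangentSpace (𝓡 n) x) := ⟨g.toRiemannianMetric⟩
  exact ⟨⟨g.inner, g.contMDiff.continuous, fun _ _ _ ↦ rfl⟩⟩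

theorem t3Space (n : ℕ) (M : Type*) [TopologicalSpace M] [T2Space M]
    [ChartedSpace (EuclideanSpace ℝ (Fin n)) M] : T3Space M := by
  have : LocallyCompactSpace M := Manifold.locallyCompact_of_finiteDimensional (𝓡 n)
  infer_instance

/-- On a connected manifold the distance is finite. -/
theorem edistance_ne_top {n : ℕ} {M : Type*} [TopologicalSpace M] [ConnectedSpace M]
    [ChartedSpace (EuclideanSpace ℝ (Fin n)) M] [IsManifold (𝓡 n) ∞ M]
    (g : C1RiemannianMetric n M) (x y : M) : g.edistance x y ≠ ⊤ := by
  let : Bundle.RiemannianBundle (fun x : M ↦ TangentSpace (𝓡 n) x) := ⟨g.toRiemannianMetric⟩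
  have := g.isContinuousRiemannianBundle
  have hloc : ∀ z : M, ∀ᶠ w in 𝓝 z, Manifold.riemannianEDist (𝓡 n) z w < 1 := fun z ↦
    eventually_riemannianEDist_lt (𝓡 n) z one_pos
  have hclopen : IsClopen {w : M | Manifold.riemannianEDist (𝓡 n) x w < ⊤} := by
    constructor
    · rw [← isOpen_compl_iff, isOpen_iff_mem_nhds]
      intro z hz
      filter_upwards [hloc z] with w hw hw'
      refine hz (Manifold.riemannianEDist_triangle.trans_lt (ENNReal.add_lt_top.2 ⟨hw', ?_⟩))
      rw [Manifold.riemannianEDist_comm]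
      exact hw.trans ENNReal.one_lt_top
    · rw [isOpen_iff_mem_nhds]
      intro z hz
      filter_upwards [hloc z] with w hw
      exact Manifold.riemannianEDist_triangle.trans_lt
        (ENNReal.add_lt_top.2 ⟨hz, hw.trans ENNReal.one_lt_top⟩)
  have huniv := hclopen.eq_univ ⟨x, by simp [Manifold.riemannianEDist_self]⟩
  have hy : y ∈ {w : M | Manifold.riemannianEDist (𝓡 n) x w < ⊤} := by
    rw [huniv]; exact Set.mem_univ y
  exact ne_of_lt hy

/-- The metric space `(M, d_g)` of a connected Riemannian manifold. Its topology is the given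
topology of `M`. -/
@[reducible] def metricSpace {n : ℕ} {M : Type*} [TopologicalSpace M] [T2Space M]
    [ConnectedSpace M] [ChartedSpace (EuclideanSpace ℝ (Fin n)) M] [IsManifold (𝓡 n) ∞ M]
    (g : C1RiemannianMetric n M) : MetricSpace M :=
  letI : Bundle.RiemannianBundle (fun x : M ↦ TangentSpace (𝓡 n) x) := ⟨g.toRiemannianMetric⟩
  haveI := g.isContinuousRiemannianBundle
  haveI : T3Space M := t3Space n M
  letI : EMetricSpace M := EMetricSpace.ofRiemannianMetric (𝓡 n) M
  EMetricSpace.toMetricSpace g.edistance_ne_top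

theorem metricSpace_edist {n : ℕ} {M : Type*} [TopologicalSpace M] [T2Space M]
    [ConnectedSpace M] [ChartedSpace (EuclideanSpace ℝ (Fin n)) M] [IsManifold (𝓡 n) ∞ M]
    (g : C1RiemannianMetric n M) (x y : M) :
    g.metricSpace.edist x y = g.edistance x y := rfl

theorem metricSpace_topology {n : ℕ} {M : Type*} [t : TopologicalSpace M] [T2Space M]
    [ConnectedSpace M] [ChartedSpace (EuclideanSpace ℝ (Fin n)) M] [IsManifold (𝓡 n) ∞ M]
    (g : C1RiemannianMetric n M) :
    g.metricSpace.toUniformSpace.toTopologicalSpace = t := rfl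

end Distance

section Geodesics

/-- The coefficient `g_{ij} = g(∂_i, ∂_j)` of the metric in the chart `e`, as a function of the
coordinates `y`. -/
def coeff {n : ℕ} {M : Type*} [TopologicalSpace M]
    [ChartedSpace (EuclideanSpace ℝ (Fin n)) M] [IsManifold (𝓡 n) ∞ M]
    (g : C1RiemannianMetric n M) (e : OpenPartialHomeomorph M (EuclideanSpace ℝ (Fin n)))
    (i j : Fin n) (y : EuclideanSpace ℝ (Fin n)) : ℝ :=
  g.inner (e.symm y)
    (mfderiv (𝓡 n) (𝓡 n) e.symm y (EuclideanSpace.single i (1 : ℝ)))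
    (mfderiv (𝓡 n) (𝓡 n) e.symm y (EuclideanSpace.single j (1 : ℝ)))

/-- The partial derivative `∂_l g_{ij}` in the chart `e`. -/
def partialCoeff {n : ℕ} {M : Type*} [TopologicalSpace M]
    [ChartedSpace (EuclideanSpace ℝ (Fin n)) M] [IsManifold (𝓡 n) ∞ M]
    (g : C1RiemannianMetric n M) (e : OpenPartialHomeomorph M (EuclideanSpace ℝ (Fin n)))
    (l i j : Fin n) (y : EuclideanSpace ℝ (Fin n)) : ℝ :=
  fderiv ℝ (g.coeff e i j) y (EuclideanSpace.single l (1 : ℝ))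

/-- The Christoffel symbol `Γ^k_{ij} = ½ ∑_l g^{kl} (∂_i g_{jl} + ∂_j g_{il} - ∂_l g_{ij})` in the
chart `e`. -/
def christoffel {n : ℕ} {M : Type*} [TopologicalSpace M]
    [ChartedSpace (EuclideanSpace ℝ (Fin n)) M] [IsManifold (𝓡 n) ∞ M]
    (g : C1RiemannianMetric n M) (e : OpenPartialHomeomorph M (EuclideanSpace ℝ (Fin n)))
    (k i j : Fin n) (y : EuclideanSpace ℝ (Fin n)) : ℝ :=
  (1 / 2 : ℝ) * ∑ l : Fin n, (Matrix.of fun a b ↦ g.coeff e a b y)⁻¹ k l *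
    (g.partialCoeff e i j l y + g.partialCoeff e j i l y - g.partialCoeff e l i j y)

/-- The curve `γ` is a geodesic on the open set `J ⊆ ℝ`: it is `C^2` there and solves the geodesic
equation in every chart of the smooth structure. Only the values of `γ` on `J` matter. -/
def IsGeodesicOn {n : ℕ} {M : Type*} [TopologicalSpace M]
    [ChartedSpace (EuclideanSpace ℝ (Fin n)) M] [IsManifold (𝓡 n) ∞ M]
    (g : C1RiemannianMetric n M) (γ : ℝ → M) (J : Set ℝ) : Prop :=
  ContMDiffOn 𝓘(ℝ, ℝ) (𝓡 n) 2 γ J ∧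
  ∀ e ∈ IsManifold.maximalAtlas (𝓡 n) ∞ M, ∀ t ∈ J, γ t ∈ e.source → ∀ k : Fin n,
    deriv (deriv (e ∘ γ)) t k +
      ∑ i : Fin n, ∑ j : Fin n,
        g.christoffel e k i j (e (γ t)) * deriv (e ∘ γ) t i * deriv (e ∘ γ) t j = 0

/-- Every geodesic defined on an open interval `(a, b)`, with `-∞ ≤ a < b ≤ ∞`, extends to a
geodesic defined on `ℝ`. -/
def GeodesicallyComplete {n : ℕ} {M : Type*} [TopologicalSpace M]
    [ChartedSpace (EuclideanSpace ℝ (Fin n)) M] [IsManifold (𝓡 n) ∞ M]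
    (g : C1RiemannianMetric n M) : Prop :=
  ∀ (a b : EReal), a < b → ∀ γ : ℝ → M,
    g.IsGeodesicOn γ {t : ℝ | a < (t : EReal) ∧ (t : EReal) < b} →
    ∃ γ' : ℝ → M, g.IsGeodesicOn γ' Set.univ ∧
      ∀ t : ℝ, a < (t : EReal) → (t : EReal) < b → γ' t = γ t

end Geodesics

end C1RiemannianMetric

end

/-! With merely continuous Christoffel symbols there is no exponential map and geodesics may branch,
so the classical argument through the exponential map is unavailable. The proof combines metric
geometry, the direct study of minimizers and Peano's existence theorem.

Geodesic completeness implies properness. By the Hopf–Rinow–Cohn-Vossen criterion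
`properSpace_of_length_of_tendsto`, a locally compact length space is proper once every half-open
minimizing unit speed curve on `[0, R)` has an end point. If minimizing curves are geodesics, such a
curve extends to a geodesic on `ℝ`, and continuity at `R` supplies the end point.

That minimizing curves are geodesics (`isGeodesicAt_of_isometric`) is the analytic core. In a chart
such a curve is Lipschitz, and its speed is at most one almost everywhere, so on `[a, b]` its energy
is at most `b - a`. A competitor with the same end points has length at least `b - a`, because `d_g`
is also bounded by the length of Lipschitz curves (`rdist_le_integral`), and then its energy is at
least `b - a` by `√q ≤ (1 + q) / 2`. The curve therefore minimizes energy among Lipschitz curves in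
the chart. The Lagrangian `g_x(v, v)` is `C^1` and nondegenerate in `v`, so the du Bois-Reymond
lemma makes the momentum an integral, and inverting the metric makes the velocity `C^1`
(`exists_contDiffOn_of_isMinimizer`). The Euler–Lagrange equation is then the geodesic equation.

Completeness implies geodesic completeness. A geodesic has constant speed, so it is Lipschitz and
converges at a finite end of its interval. In a chart around the limit its velocity is bounded,
hence so is its acceleration, and the velocity converges too. Peano's theorem gives a solution
issuing from these limit data, and the two pieces fit together to second order
(`exists_extension_of_tendsto`). Since extensions are not unique, Zorn's lemma is used to reach
`+∞`, and time reversal handles the other end. Properness implies completeness in every metric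
space. -/

open scoped Manifold ContDiff Bundle Topology RealInnerProductSpace NNReal
open Set Filter Metric MeasureTheory

/-! ### Metric geometry: properness of locally compact length spaces. -/

/-- **Hopf–Rinow–Cohn-Vossen.** A locally compact length space in which every half-open minimizing
curve has an end point is proper. -/
theorem properSpace_of_length_of_tendsto {X : Type*} [MetricSpace X] [LocallyCompactSpace X]
    (hlen : ∀ (x y : X) (L : ℝ), dist x y < L → ∃ σ : ℝ → X, σ 0 = x ∧ σ L = y ∧
      ∀ s ∈ Icc 0 L, ∀ t ∈ Icc 0 L, dist (σ s) (σ t) ≤ |s - t|)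
    (hray : ∀ R : ℝ, 0 < R → ∀ σ : ℝ → X,
      (∀ s ∈ Ico 0 R, ∀ t ∈ Ico 0 R, dist (σ s) (σ t) = |s - t|) →
      ∃ x, Tendsto σ (𝓝[<] R) (𝓝 x)) : ProperSpace X := by
  -- the closed ball at the supremum of the compact radii is compact
  have key : ∀ (p : X) (R : ℝ), 0 < R → (∀ r < R, IsCompact (closedBall p r)) →
      IsCompact (closedBall p R) := by
    intro p R hR hc
    rw [isCompact_iff_isSeqCompact]
    refine IsSeqCompact.isCompact ?_ |>.isSeqCompact
    intro q hq
    -- A nonprincipal ultrafilter replaces every extraction of subsequences, including the diagonal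
    -- one needed to get a limit curve at all times at once.
    set U : Ultrafilter ℕ := hyperfilter ℕ with hU
    have hUtop : (U : Filter ℕ) ≤ atTop := by
      rw [← Nat.cofinite_eq_atTop]; exact hyperfilter_le_cofinite
    suffices h : ∃ x, Tendsto q U (𝓝 x) by
      obtain ⟨x, hx⟩ := h
      have hcl : MapClusterPt x atTop q := (hx.mapClusterPt).mono hUtop
      obtain ⟨φ, hφ, hφx⟩ := hcl.tendsto_subseq
      exact ⟨x, isClosed_closedBall.mem_of_tendsto hφx (Eventually.of_forall fun n ↦ hq _),
        φ, hφ, hφx⟩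
    have hcompact_lim : ∀ (f : ℕ → X) (K : Set X), IsCompact K → (∀ᶠ n in (U : Filter ℕ), f n ∈ K) →
        ∃ x ∈ K, Tendsto f U (𝓝 x) := by
      intro f K hK hf
      obtain ⟨x, hxK, hx⟩ := hK.ultrafilter_le_nhds (U.map f) (by simpa using! Ultrafilter.mem_coe.1 hf)
      exact ⟨x, hxK, hx⟩
    by_cases hcase : ∃ r < R, ∀ᶠ n in (U : Filter ℕ), dist p (q n) ≤ r
    · obtain ⟨r, hr, hev⟩ := hcase
      obtain ⟨x, -, hx⟩ := hcompact_lim q _ (hc r hr) (by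
        filter_upwards [hev] with n hn
        rwa [mem_closedBall, dist_comm])
      exact ⟨x, hx⟩
    push Not at hcase
    have hfar : ∀ r < R, ∀ᶠ n in (U : Filter ℕ), r < dist p (q n) := hcase
    -- Almost minimizing curves from `p` to `q n`, with slack `1 / (n + 1)`; their limit `τ` on `[0,
    -- R)` will be exactly minimizing.
    choose! σ hσ0 hσL hσ using fun n : ℕ ↦ hlen p (q n) (dist p (q n) + 1 / (n + 1))
      (by have : (0 : ℝ) < 1 / ((n : ℝ) + 1) := by positivity
          linarith)
    have hqR : ∀ n, dist p (q n) ≤ R := fun n ↦ by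
      have := hq n; rwa [mem_closedBall, dist_comm] at this
    have hpos : ∀ n : ℕ, (0 : ℝ) < 1 / ((n : ℝ) + 1) := fun n ↦ by positivity
    have hlim : ∀ t ∈ Ico 0 R, ∃ x, Tendsto (fun n ↦ σ n t) U (𝓝 x) := by
      intro t ht
      obtain ⟨x, -, hx⟩ := hcompact_lim (fun n ↦ σ n t) _ (hc t ht.2) (by
        filter_upwards [hfar t ht.2] with n hn
        have := hσ n t ⟨ht.1, by linarith [hpos n]⟩ 0 ⟨le_rfl, by linarith [hpos n, ht.1]⟩
        rw [hσ0, sub_zero, abs_of_nonneg ht.1] at this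
        exact this)
      exact ⟨x, hx⟩
    have hne : Nonempty X := ⟨p⟩
    choose! τ hτ using hlim
    have hle : ∀ s ∈ Ico 0 R, ∀ t ∈ Ico 0 R, dist (τ s) (τ t) ≤ |s - t| := by
      intro s hs t ht
      refine le_of_tendsto ((hτ s hs).dist (hτ t ht)) ?_
      filter_upwards [hfar s hs.2, hfar t ht.2] with n hns hnt
      exact hσ n s ⟨hs.1, by linarith [hpos n]⟩ t ⟨ht.1, by linarith [hpos n]⟩
    have hinv : Tendsto (fun n : ℕ ↦ 1 / ((n : ℝ) + 1)) U (𝓝 0) :=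
      tendsto_one_div_add_atTop_nhds_zero_nat.mono_left hUtop
    -- What remains of `σ n` after time `t` has length at most `dist p (q n) + 1 / (n + 1) - t`, so
    -- `σ n t` cannot be much closer to `p` than `t`.
    have hrad : ∀ t ∈ Ico 0 R, t ≤ dist p (τ t) := by
      intro t ht
      refine le_of_forall_pos_le_add fun ε hε ↦ ?_
      have h1 := (tendsto_const_nhds (x := p)).dist (hτ t ht)
      refine ge_of_tendsto (h1.add_const ε) ?_
      filter_upwards [hfar t ht.2, hfar (R - ε / 2) (by linarith),
        hinv.eventually (gt_mem_nhds (half_pos hε))] with n hn hn2 hn3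
      have := hσ n t ⟨ht.1, by linarith [hpos n]⟩ _ ⟨by linarith [hpos n, ht.1], le_rfl⟩
      rw [hσL, abs_sub_comm, abs_of_nonneg (by linarith [hpos n])] at this
      linarith [dist_triangle p (σ n t) (q n), hqR n]
    have hp0 : dist p (τ 0) ≤ 0 := by
      refine le_of_tendsto ((tendsto_const_nhds (x := p)).dist (hτ 0 ⟨le_rfl, hR⟩)) ?_
      filter_upwards with n
      rw [hσ0, dist_self]
    have hτ0 : p = τ 0 := dist_le_zero.1 hp0
    -- Since `τ` is 1-Lipschitz and lies at distance exactly `s` from `p` at time `s`, the triangle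
    -- inequality through `p` gives the lower bound.
    have hiso : ∀ s ∈ Ico 0 R, ∀ t ∈ Ico 0 R, dist (τ s) (τ t) = |s - t| := by
      intro s hs t ht
      refine le_antisymm (hle s hs t ht) ?_
      have h1 := hrad s hs
      have h2 := hrad t ht
      have h3 := hle 0 ⟨le_rfl, hR⟩ s hs
      have h4 := hle 0 ⟨le_rfl, hR⟩ t ht
      rw [zero_sub, abs_neg, abs_of_nonneg hs.1, ← hτ0] at h3
      rw [zero_sub, abs_neg, abs_of_nonneg ht.1, ← hτ0] at h4
      have h5 := dist_triangle p (τ s) (τ t)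
      have h6 := dist_triangle p (τ t) (τ s)
      rw [dist_comm (τ t)] at h6
      exact abs_le.2 ⟨by linarith, by linarith⟩
    obtain ⟨x, hx⟩ := hray R hR τ hiso
    refine ⟨x, ?_⟩
    rw [tendsto_iff_dist_tendsto_zero, Metric.tendsto_nhds]
    intro ε hε
    have hx' : ∀ᶠ t in 𝓝[<] R, dist (τ t) x < ε / 4 := hx.eventually (ball_mem_nhds x (by linarith))
    -- Compare `q n` with `x` through `σ n t` and `τ t` for a time `t` close to `R`. The remaining
    -- length of `σ n` accounts for two quarters of `ε`, one of them being its slack.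
    obtain ⟨t, htx, htR, ht⟩ : ∃ t, dist (τ t) x < ε / 4 ∧ t ∈ Ico 0 R ∧ R - ε / 4 < t := by
      have h1 : ∀ᶠ t in 𝓝[<] R, t ∈ Ioo (max 0 (R - ε / 4)) R :=
        Ioo_mem_nhdsLT (max_lt hR (by linarith))
      obtain ⟨t, h2, h3⟩ := (hx'.and h1).exists
      exact ⟨t, h2, ⟨(le_max_left _ _).trans h3.1.le, h3.2⟩, (le_max_right _ _).trans_lt h3.1⟩
    filter_upwards [hfar t htR.2, hinv.eventually (gt_mem_nhds (show (0:ℝ) < ε / 4 by linarith)),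
      (hτ t htR).eventually (ball_mem_nhds _ (show (0:ℝ) < ε / 4 by linarith))] with n hn hn2 hn3
    have h1 := hσ n t ⟨htR.1, by linarith [hpos n]⟩ _ ⟨by linarith [hpos n, htR.1], le_rfl⟩
    rw [hσL, abs_sub_comm, abs_of_nonneg (by linarith [hpos n])] at h1
    rw [Real.dist_eq, sub_zero, abs_of_nonneg dist_nonneg]
    have h2 := dist_triangle4 (q n) (σ n t) (τ t) x
    rw [dist_comm (q n) (σ n t)] at h2
    linarith [hqR n]
  -- compact balls can be enlarged
  have step : ∀ (p : X) (R : ℝ), 0 ≤ R → IsCompact (closedBall p R) →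
      ∃ ε > 0, IsCompact (closedBall p (R + ε)) := by
    intro p R hR hc
    obtain ⟨δ, hδ, hK⟩ := hc.exists_isCompact_cthickening
    refine ⟨δ / 2, half_pos hδ, hK.of_isClosed_subset isClosed_closedBall fun q hq ↦ ?_⟩
    rw [mem_closedBall, dist_comm] at hq
    -- As `dist p q ≤ R + δ / 2`, there is a curve of parameter length `R + δ`; its point at time
    -- `R` is in the compact ball and within `δ` of `q`.
    obtain ⟨σ, h0, hL, hσ⟩ := hlen p q (R + δ) (by linarith)
    have h1 := hσ 0 ⟨le_rfl, by linarith⟩ R ⟨hR, by linarith⟩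
    have h2 := hσ R ⟨hR, by linarith⟩ (R + δ) ⟨by linarith, le_rfl⟩
    rw [h0, zero_sub, abs_neg, abs_of_nonneg hR] at h1
    rw [hL, sub_add_cancel_left, abs_neg, abs_of_pos hδ] at h2
    refine mem_cthickening_of_dist_le q (σ R) δ _ ?_ (by rwa [dist_comm])
    rwa [mem_closedBall, dist_comm]
  refine ⟨fun p ↦ ?_⟩
  by_contra! hnot
  obtain ⟨r₀, hr₀⟩ := hnot
  set A : Set ℝ := {r | 0 ≤ r ∧ IsCompact (closedBall p r)} with hA
  have hdown : ∀ r r', r ≤ r' → IsCompact (closedBall p r') → IsCompact (closedBall p r) :=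
    fun r r' h hc ↦ hc.of_isClosed_subset isClosed_closedBall (closedBall_subset_closedBall h)
  have h0A : (0 : ℝ) ∈ A := ⟨le_rfl, by simp⟩
  have hbdd : BddAbove A := ⟨r₀, fun r hr ↦ le_of_not_gt fun h ↦ hr₀ (hdown _ _ h.le hr.2)⟩
  have hlt : ∀ r < sSup A, IsCompact (closedBall p r) := fun r hr ↦ by
    obtain ⟨r', hr', h⟩ := exists_lt_of_lt_csSup ⟨0, h0A⟩ hr
    exact hdown _ _ h.le hr'.2
  have h0 : 0 ≤ sSup A := le_csSup hbdd h0A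
  have hc : IsCompact (closedBall p (sSup A)) := by
    rcases h0.eq_or_lt with h | h
    · rw [← h]; exact h0A.2
    · exact key p _ h hlt
  obtain ⟨ε, hε, hcε⟩ := step p _ h0 hc
  have := le_csSup hbdd (show sSup A + ε ∈ A from ⟨by linarith, hcε⟩)
  linarith

/-! ### The metric, speeds and lengths in charts. -/

namespace C1RiemannianMetric

variable {n : ℕ} {M : Type*} [TopologicalSpace M] [ChartedSpace (EuclideanSpace ℝ (Fin n)) M]

local notation "𝔼" => EuclideanSpace ℝ (Fin n)

theorem mdifferentiableAt_symm_of_mem {e : OpenPartialHomeomorph M 𝔼}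
    (he : e ∈ IsManifold.maximalAtlas (𝓡 n) ∞ M) {y : 𝔼} (hy : y ∈ e.target) :
    MDifferentiableAt (𝓡 n) (𝓡 n) e.symm y :=
  ((contMDiffOn_symm_of_mem_maximalAtlas he).contMDiffAt
    (e.open_target.mem_nhds hy)).mdifferentiableAt (by simp)

theorem mdifferentiableAt_of_mem {e : OpenPartialHomeomorph M 𝔼}
    (he : e ∈ IsManifold.maximalAtlas (𝓡 n) ∞ M) {x : M} (hx : x ∈ e.source) :
    MDifferentiableAt (𝓡 n) (𝓡 n) e x :=
  ((contMDiffOn_of_mem_maximalAtlas he).contMDiffAt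
    (e.open_source.mem_nhds hx)).mdifferentiableAt (by simp)

theorem contDiffAt_transition {e e' : OpenPartialHomeomorph M 𝔼}
    (he : e ∈ IsManifold.maximalAtlas (𝓡 n) ∞ M) (he' : e' ∈ IsManifold.maximalAtlas (𝓡 n) ∞ M)
    {p : 𝔼} (hp : p ∈ e.target) (hp' : e.symm p ∈ e'.source) : ContDiffAt ℝ ∞ (e' ∘ e.symm) p := by
  rw [← contMDiffAt_iff_contDiffAt]
  exact ((contMDiffOn_of_mem_maximalAtlas he').contMDiffAt (e'.open_source.mem_nhds hp')).comp p
    ((contMDiffOn_symm_of_mem_maximalAtlas he).contMDiffAt (e.open_target.mem_nhds hp))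

variable [IsManifold (𝓡 n) ∞ M]

/-- The metric read in the chart `e`. -/
noncomputable def chartForm (g : C1RiemannianMetric n M) (e : OpenPartialHomeomorph M 𝔼)
    (y v w : 𝔼) : ℝ :=
  g.inner (e.symm y) (mfderiv (𝓡 n) (𝓡 n) e.symm y v) (mfderiv (𝓡 n) (𝓡 n) e.symm y w)

theorem coeff_eq_chartForm (g : C1RiemannianMetric n M) (e : OpenPartialHomeomorph M 𝔼)
    (i j : Fin n) (y : 𝔼) : g.coeff e i j y =
      g.chartForm e y (EuclideanSpace.single i (1 : ℝ)) (EuclideanSpace.single j (1 : ℝ)) := rfl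

theorem chartForm_symm (g : C1RiemannianMetric n M) (e : OpenPartialHomeomorph M 𝔼) (y v w : 𝔼) :
    g.chartForm e y v w = g.chartForm e y w v := g.symm _ _ _

theorem chartForm_add_left (g : C1RiemannianMetric n M) (e : OpenPartialHomeomorph M 𝔼)
    (y v v' w : 𝔼) : g.chartForm e y (v + v') w = g.chartForm e y v w + g.chartForm e y v' w := by
  have := (mfderiv (𝓡 n) (𝓡 n) e.symm y).map_add v v'
  unfold chartForm
  erw [this, map_add]
  rfl

theorem chartForm_smul_left (g : C1RiemannianMetric n M) (e : OpenPartialHomeomorph M 𝔼)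
    (c : ℝ) (y v w : 𝔼) : g.chartForm e y (c • v) w = c * g.chartForm e y v w := by
  have := (mfderiv (𝓡 n) (𝓡 n) e.symm y).map_smul c v
  unfold chartForm
  erw [this, map_smul]
  rfl

/-- The Gram operator of the metric in the chart `e`. -/
noncomputable def gram (g : C1RiemannianMetric n M) (e : OpenPartialHomeomorph M 𝔼) (y : 𝔼) :
    𝔼 →L[ℝ] 𝔼 :=
  LinearMap.toContinuousLinearMap
    { toFun := fun v ↦ ∑ i, g.chartForm e y v (EuclideanSpace.single i (1 : ℝ)) •
        EuclideanSpace.single i (1 : ℝ)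
      map_add' := fun v v' ↦ by
        simp only [chartForm_add_left, add_smul, Finset.sum_add_distrib]
      map_smul' := fun c v ↦ by
        simp only [chartForm_smul_left, mul_smul, Finset.smul_sum, RingHom.id_apply] }

theorem gram_apply (g : C1RiemannianMetric n M) (e : OpenPartialHomeomorph M 𝔼) (y v : 𝔼) :
    g.gram e y v = ∑ i, g.chartForm e y v (EuclideanSpace.single i (1 : ℝ)) •
        EuclideanSpace.single i (1 : ℝ) := rfl

theorem chartForm_eq_inner (g : C1RiemannianMetric n M) (e : OpenPartialHomeomorph M 𝔼)
    (y v w : 𝔼) : g.chartForm e y v w = ⟪g.gram e y v, w⟫ := by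
  let f : 𝔼 →ₗ[ℝ] ℝ :=
    { toFun := fun w ↦ g.chartForm e y v w
      map_add' := fun w w' ↦ by
        simp only [g.chartForm_symm e y v, chartForm_add_left]
      map_smul' := fun c w ↦ by
        simp only [g.chartForm_symm e y v, chartForm_smul_left, smul_eq_mul, RingHom.id_apply] }
  change f w = _
  conv_lhs => rw [← (EuclideanSpace.basisFun (Fin n) ℝ).sum_repr w, map_sum]
  rw [gram_apply, sum_inner]
  refine Finset.sum_congr rfl fun i _ ↦ ?_
  rw [map_smul, real_inner_smul_left, EuclideanSpace.inner_single_left]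
  simp [f, mul_comm]

/-- The differential of `e.symm` is injective, because `e ∘ e.symm` is the identity near `y`. -/
theorem chartForm_pos (g : C1RiemannianMetric n M) {e : OpenPartialHomeomorph M 𝔼}
    (he : e ∈ IsManifold.maximalAtlas (𝓡 n) ∞ M) {y : 𝔼} (hy : y ∈ e.target) {v : 𝔼} (hv : v ≠ 0) :
    0 < g.chartForm e y v v := by
  refine g.pos _ _ fun h ↦ hv ?_
  have h1 := mdifferentiableAt_symm_of_mem he hy
  have h2 := mdifferentiableAt_of_mem he (e.map_target hy)
  have h3 := mfderiv_comp y h2 h1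
  have h4 : (e ∘ e.symm) =ᶠ[𝓝 y] id := by
    filter_upwards [e.open_target.mem_nhds hy] with z hz using e.right_inv hz
  have h5 : mfderiv (𝓡 n) (𝓡 n) (e ∘ e.symm) y v = v := by
    rw [h4.mfderiv_eq, mfderiv_id]; rfl
  rw [h3] at h5
  rw [← h5]
  exact (congrArg (mfderiv (𝓡 n) (𝓡 n) e (e.symm y)) h).trans (map_zero _)

/-- A constant field on the model space is pushed forward by the smooth tangent map of `e.symm`.
This is what makes the chart coefficients of a `C^1` metric `C^1`. -/
theorem contMDiffOn_mfderiv_symm {e : OpenPartialHomeomorph M 𝔼}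
    (he : e ∈ IsManifold.maximalAtlas (𝓡 n) ∞ M) (v : 𝔼) :
    ContMDiffOn (𝓡 n) ((𝓡 n).prod (𝓡 n)) 1
      (fun y ↦ (⟨e.symm y, mfderiv (𝓡 n) (𝓡 n) e.symm y v⟩ : TangentBundle (𝓡 n) M)) e.target := by
  have h1 := (contMDiffOn_symm_of_mem_maximalAtlas he).contMDiffOn_tangentMapWithin (m := 1)
    (by norm_cast) e.open_target.uniqueMDiffOn
  have h2 : ContMDiff (𝓡 n) ((𝓡 n).prod (𝓡 n)) 1
    (fun y : 𝔼 ↦ (⟨y, v⟩ : TangentBundle (𝓡 n) 𝔼)) := by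
    exact contMDiff_vectorSpace_iff_contDiff (V := fun _ : 𝔼 ↦ v) |>.2 contDiff_const
  refine (h1.comp h2.contMDiffOn (s := e.target) fun y hy ↦ hy).congr fun y hy ↦ ?_
  simp only [tangentMapWithin, Function.comp]
  rw [mfderivWithin_of_isOpen e.open_target hy]

theorem contDiffOn_chartForm (g : C1RiemannianMetric n M) {e : OpenPartialHomeomorph M 𝔼}
    (he : e ∈ IsManifold.maximalAtlas (𝓡 n) ∞ M) (v w : 𝔼) :
    ContDiffOn ℝ 1 (fun y ↦ g.chartForm e y v w) e.target := by
  let : Bundle.RiemannianBundle (fun x : M ↦ TangentSpace (𝓡 n) x) := ⟨g.toRiemannianMetric⟩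
  have := ContMDiffOn.inner_bundle (contMDiffOn_mfderiv_symm he v) (contMDiffOn_mfderiv_symm he w)
  rw [contMDiffOn_iff_contDiffOn] at this
  exact this

theorem contDiffOn_gram (g : C1RiemannianMetric n M) {e : OpenPartialHomeomorph M 𝔼}
    (he : e ∈ IsManifold.maximalAtlas (𝓡 n) ∞ M) : ContDiffOn ℝ 1 (g.gram e) e.target := by
  rw [contDiffOn_clm_apply]
  intro v
  simp only [gram_apply]
  exact ContDiffOn.sum fun i _ ↦ (g.contDiffOn_chartForm he v _).smul contDiffOn_const

/-- The metric at `x`, evaluated at tangent vectors given in the model space. -/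
noncomputable def pair (g : C1RiemannianMetric n M) (x : M) (u w : 𝔼) : ℝ := g.inner x u w

/-- The squared speed of a curve. -/
noncomputable def speedSq (g : C1RiemannianMetric n M) (γ : ℝ → M) (t : ℝ) : ℝ :=
  g.pair (γ t) (mfderiv 𝓘(ℝ, ℝ) (𝓡 n) γ t (1 : ℝ)) (mfderiv 𝓘(ℝ, ℝ) (𝓡 n) γ t (1 : ℝ))

theorem speedSq_congr (g : C1RiemannianMetric n M) {γ γ' : ℝ → M} {t : ℝ} (h : γ =ᶠ[𝓝 t] γ') :
    g.speedSq γ t = g.speedSq γ' t := by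
  have h1 : (mfderiv 𝓘(ℝ, ℝ) (𝓡 n) γ t (1 : ℝ) : 𝔼) = mfderiv 𝓘(ℝ, ℝ) (𝓡 n) γ' t (1 : ℝ) :=
    congrArg (fun L : ℝ →L[ℝ] 𝔼 ↦ L 1) h.mfderiv_eq
  unfold speedSq
  exact congr (congr (congrArg g.pair h.eq_of_nhds) h1) h1

theorem speedSq_symm_comp (g : C1RiemannianMetric n M) {e : OpenPartialHomeomorph M 𝔼}
    (he : e ∈ IsManifold.maximalAtlas (𝓡 n) ∞ M) {η : ℝ → 𝔼} {t : ℝ} {v : 𝔼}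
    (hη : HasDerivAt η v t) (ht : η t ∈ e.target) :
    g.speedSq (e.symm ∘ η) t = g.chartForm e (η t) v v := by
  have h1 : (mfderiv 𝓘(ℝ, ℝ) (𝓡 n) (e.symm ∘ η) t (1 : ℝ) : 𝔼) =
      mfderiv (𝓡 n) (𝓡 n) e.symm (η t) v := by
    have h3 := mfderiv_comp t (mdifferentiableAt_symm_of_mem he ht)
      hη.differentiableAt.mdifferentiableAt
    have h2 : fderiv ℝ η t 1 = v := by rw [fderiv_apply_one_eq_deriv, hη.deriv]
    rw [mfderiv_eq_fderiv] at h3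
    exact (congrArg (fun L : ℝ →L[ℝ] 𝔼 ↦ L 1) h3).trans
      (congrArg (mfderiv (𝓡 n) (𝓡 n) e.symm (η t)) h2)
  exact congr (congrArg (g.pair (e.symm (η t))) h1) h1

theorem speedSq_eq_chartForm (g : C1RiemannianMetric n M) {e : OpenPartialHomeomorph M 𝔼}
    (he : e ∈ IsManifold.maximalAtlas (𝓡 n) ∞ M) {γ : ℝ → M} {t : ℝ}
    (hγ : MDifferentiableAt 𝓘(ℝ, ℝ) (𝓡 n) γ t) (ht : γ t ∈ e.source) :
    g.speedSq γ t = g.chartForm e (e (γ t)) (deriv (e ∘ γ) t) (deriv (e ∘ γ) t) := by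
  have h1 : γ =ᶠ[𝓝 t] (e.symm ∘ e ∘ γ) := by
    filter_upwards [hγ.continuousAt.preimage_mem_nhds (e.open_source.mem_nhds ht)] with s hs
    exact (e.left_inv hs).symm
  have h2 : DifferentiableAt ℝ (e ∘ γ) t :=
    ((mdifferentiableAt_of_mem he ht).comp t hγ).differentiableAt
  exact (g.speedSq_congr h1).trans (g.speedSq_symm_comp he h2.hasDerivAt (e.map_source ht))

/-- The length of a curve for the metric `g`. -/
noncomputable def length (g : C1RiemannianMetric n M) (γ : ℝ → M) (a b : ℝ) : ENNReal :=
  ∫⁻ t in Icc a b, ENNReal.ofReal √(g.speedSq γ t)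

theorem length_eq_pathELength (g : C1RiemannianMetric n M) (γ : ℝ → M) (a b : ℝ) :
    letI : Bundle.RiemannianBundle (fun x : M ↦ TangentSpace (𝓡 n) x) := ⟨g.toRiemannianMetric⟩
    g.length γ a b = Manifold.pathELength (𝓡 n) γ a b := by
  let : Bundle.RiemannianBundle (fun x : M ↦ TangentSpace (𝓡 n) x) := ⟨g.toRiemannianMetric⟩
  rw [Manifold.pathELength_eq_lintegral_mfderiv_Icc]
  refine MeasureTheory.lintegral_congr fun t ↦ ?_
  rw [← ofReal_norm, norm_eq_sqrt_real_inner]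
  rfl

theorem edistance_le_length (g : C1RiemannianMetric n M) {γ : ℝ → M} {a b : ℝ} (hab : a ≤ b)
    (hγ : ContMDiffOn 𝓘(ℝ, ℝ) (𝓡 n) 1 γ (Icc a b)) :
    g.edistance (γ a) (γ b) ≤ g.length γ a b := by
  let : Bundle.RiemannianBundle (fun x : M ↦ TangentSpace (𝓡 n) x) := ⟨g.toRiemannianMetric⟩
  rw [g.length_eq_pathELength]
  exact Manifold.riemannianEDist_le_pathELength hγ rfl rfl hab

theorem exists_length_lt (g : C1RiemannianMetric n M) {x y : M} {r : ENNReal}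
    (h : g.edistance x y < r) : ∃ γ : ℝ → M, γ 0 = x ∧ γ 1 = y ∧
      ContMDiffOn 𝓘(ℝ, ℝ) (𝓡 n) 1 γ (Icc 0 1) ∧ g.length γ 0 1 < r := by
  let : Bundle.RiemannianBundle (fun x : M ↦ TangentSpace (𝓡 n) x) := ⟨g.toRiemannianMetric⟩
  obtain ⟨γ, h0, h1, h2, h3⟩ := Manifold.exists_lt_of_riemannianEDist_lt h
  exact ⟨γ, h0, h1, h2, by rwa [g.length_eq_pathELength]⟩

theorem length_add (g : C1RiemannianMetric n M) (γ : ℝ → M) {a b c : ℝ} (h : a ≤ b) (h' : b ≤ c) :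
    g.length γ a b + g.length γ b c = g.length γ a c := by
  let : Bundle.RiemannianBundle (fun x : M ↦ TangentSpace (𝓡 n) x) := ⟨g.toRiemannianMetric⟩
  simp only [g.length_eq_pathELength]
  exact Manifold.pathELength_add h h'

theorem length_mono (g : C1RiemannianMetric n M) (γ : ℝ → M) {a b a' b' : ℝ} (h : a' ≤ a)
    (h' : b ≤ b') : g.length γ a b ≤ g.length γ a' b' :=
  MeasureTheory.lintegral_mono_set (Icc_subset_Icc h h')

theorem chartForm_transition (g : C1RiemannianMetric n M) {e e' : OpenPartialHomeomorph M 𝔼}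
    (he : e ∈ IsManifold.maximalAtlas (𝓡 n) ∞ M) (he' : e' ∈ IsManifold.maximalAtlas (𝓡 n) ∞ M)
    {p : 𝔼} (hp : p ∈ e.target) (hp' : e.symm p ∈ e'.source) (v w : 𝔼) :
    g.chartForm e p v w = g.chartForm e' (e' (e.symm p)) (fderiv ℝ (e' ∘ e.symm) p v)
      (fderiv ℝ (e' ∘ e.symm) p w) := by
  have h1 : (e'.symm ∘ e' ∘ e.symm) =ᶠ[𝓝 p] e.symm := by
    filter_upwards [(e.continuousAt_symm hp).preimage_mem_nhds (e'.open_source.mem_nhds hp')]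
      with s hs
    exact e'.left_inv hs
  have h2 : DifferentiableAt ℝ (e' ∘ e.symm) p :=
    (contDiffAt_transition he he' hp hp').differentiableAt (by simp)
  have h3 : ∀ u : 𝔼, mfderiv (𝓡 n) (𝓡 n) e.symm p u =
      mfderiv (𝓡 n) (𝓡 n) e'.symm (e' (e.symm p)) (fderiv ℝ (e' ∘ e.symm) p u) := by
    intro u
    have := mfderiv_comp p (mdifferentiableAt_symm_of_mem he' (e'.map_source hp'))
      h2.mdifferentiableAt
    rw [mfderiv_eq_fderiv] at this
    exact congrArg (fun L : 𝔼 →L[ℝ] 𝔼 ↦ L u) (h1.mfderiv_eq.symm.trans this)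
  show g.pair _ _ _ = g.pair _ _ _
  exact congr (congr (congrArg g.pair (e'.left_inv hp').symm) (h3 v)) (h3 w)

end C1RiemannianMetric

/-! ### Comparison of nearby positive definite forms. -/

section Forms

variable {E : Type*} [NormedAddCommGroup E] [InnerProductSpace ℝ E]

theorem exists_pos_mul_norm_sq_le [FiniteDimensional ℝ E] {A : E →L[ℝ] E}
    (hpos : ∀ v, v ≠ 0 → 0 < ⟪A v, v⟫) : ∃ c > 0, ∀ v, c * ‖v‖ ^ 2 ≤ ⟪A v, v⟫ := by
  have hproper : ProperSpace E := FiniteDimensional.proper ℝ E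
  rcases (sphere (0 : E) 1).eq_empty_or_nonempty with h | h
  -- An empty unit sphere is the zero-dimensional case, where any constant works.
  · refine ⟨1, one_pos, fun v ↦ ?_⟩
    by_cases hv : v = 0
    · simp [hv]
    · have : ‖v‖⁻¹ • v ∈ sphere (0 : E) 1 := by
        simp [norm_smul, norm_ne_zero_iff.2 hv]
      simp [h] at this
  · obtain ⟨u, hu, hmin⟩ := (isCompact_sphere (0 : E) 1).exists_isMinOn h
      (f := fun v ↦ ⟪A v, v⟫) (by fun_prop)
    have hu0 : u ≠ 0 := by rintro rfl; simp at hu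
    refine ⟨⟪A u, u⟫, hpos u hu0, fun v ↦ ?_⟩
    by_cases hv : v = 0
    · simp [hv]
    · have h1 : ‖v‖⁻¹ • v ∈ sphere (0 : E) 1 := by
        simp [norm_smul, norm_ne_zero_iff.2 hv]
      have h2 : ⟪A u, u⟫ ≤ ⟪A (‖v‖⁻¹ • v), ‖v‖⁻¹ • v⟫ := hmin h1
      simp only [map_smul, real_inner_smul_left, real_inner_smul_right] at h2
      have h3 : 0 < ‖v‖ := norm_pos_iff.2 hv
      calc ⟪A u, u⟫ * ‖v‖ ^ 2 ≤ (‖v‖⁻¹ * (‖v‖⁻¹ * ⟪A v, v⟫)) * ‖v‖ ^ 2 := by gcongr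
        _ = ⟪A v, v⟫ := by field_simp

theorem abs_inner_le_sqrt_mul_sqrt {A : E →L[ℝ] E} (hsymm : ∀ v w, ⟪A v, w⟫ = ⟪A w, v⟫)
    (hpos : ∀ v, 0 ≤ ⟪A v, v⟫) (v w : E) : |⟪A v, w⟫| ≤ √⟪A v, v⟫ * √⟪A w, w⟫ := by
  let b : LinearMap.BilinForm ℝ E := LinearMap.mk₂ ℝ (fun v w ↦ ⟪A v, w⟫)
    (by simp [inner_add_left]) (by simp [real_inner_smul_left])
    (by simp [inner_add_right]) (by simp [real_inner_smul_right])
  have h := b.apply_sq_le_of_symm hpos ⟨hsymm⟩ v w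
  rw [← Real.sqrt_mul (hpos v), ← Real.sqrt_sq_eq_abs]
  exact Real.sqrt_le_sqrt h

/-- Coercivity of `A y₀` turns a small operator norm of `A y - A y₀` into a small relative error,
uniformly in `w`. The tolerance `c * (1 - δ⁻¹)` gives `A y ≥ δ⁻¹ A y₀` directly and `A y ≤ (2 - δ⁻¹)
A y₀ ≤ δ A y₀` because `δ + δ⁻¹ ≥ 2`. -/
theorem eventually_forall_inner_le_mul [FiniteDimensional ℝ E] {A : E → E →L[ℝ] E} {y₀ : E}
    (hA : ContinuousAt A y₀) (hpos : ∀ v, v ≠ 0 → 0 < ⟪A y₀ v, v⟫) {δ : ℝ} (hδ : 1 < δ) :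
    ∀ᶠ y in 𝓝 y₀, ∀ w, ⟪A y w, w⟫ ≤ δ * ⟪A y₀ w, w⟫ ∧ ⟪A y₀ w, w⟫ ≤ δ * ⟪A y w, w⟫ := by
  obtain ⟨c, hc, hcoer⟩ := exists_pos_mul_norm_sq_le hpos
  have hδ0 : 0 < δ := one_pos.trans hδ
  have hκ : 0 < c * (1 - δ⁻¹) := mul_pos hc (by linarith [inv_lt_one_of_one_lt₀ hδ])
  have hlim : Tendsto (fun y ↦ ‖A y - A y₀‖) (𝓝 y₀) (𝓝 0) :=
    tendsto_iff_norm_sub_tendsto_zero.1 hA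
  filter_upwards [hlim.eventually (gt_mem_nhds hκ)] with y h1 w
  have h2 : |⟪A y w, w⟫ - ⟪A y₀ w, w⟫| ≤ (1 - δ⁻¹) * ⟪A y₀ w, w⟫ := by
    calc |⟪A y w, w⟫ - ⟪A y₀ w, w⟫| = |⟪(A y - A y₀) w, w⟫| := by
          rw [sub_apply, inner_sub_left]
      _ ≤ ‖(A y - A y₀) w‖ * ‖w‖ := abs_real_inner_le_norm _ _
      _ ≤ ‖A y - A y₀‖ * ‖w‖ * ‖w‖ := by gcongr; exact ContinuousLinearMap.le_opNorm _ _
      _ ≤ c * (1 - δ⁻¹) * ‖w‖ * ‖w‖ := by gcongr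
      _ = (1 - δ⁻¹) * (c * ‖w‖ ^ 2) := by ring
      _ ≤ _ := mul_le_mul_of_nonneg_left (hcoer w) (by linarith [inv_lt_one_of_one_lt₀ hδ])
  have h3 : 0 ≤ ⟪A y₀ w, w⟫ := (by positivity : (0 : ℝ) ≤ c * ‖w‖ ^ 2).trans (hcoer w)
  obtain ⟨h4, h5⟩ := abs_le.1 h2
  have h6 : 2 - δ⁻¹ ≤ δ := by
    have : 0 ≤ (δ - 1) ^ 2 * δ⁻¹ := by positivity
    have h7 : (δ - 1) ^ 2 * δ⁻¹ = δ - 2 + δ⁻¹ := by field_simp; ring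
    linarith
  constructor
  · have := mul_le_mul_of_nonneg_right h6 h3
    linarith
  · have h8 : δ⁻¹ * ⟪A y₀ w, w⟫ ≤ ⟪A y w, w⟫ := by linarith
    calc ⟪A y₀ w, w⟫ = δ * (δ⁻¹ * ⟪A y₀ w, w⟫) := by field_simp
      _ ≤ _ := by gcongr

end Forms

/-! ### The distance is infinitesimally the norm given by the metric. -/

namespace C1RiemannianMetric

variable {n : ℕ} {M : Type*} [TopologicalSpace M] [ChartedSpace (EuclideanSpace ℝ (Fin n)) M]
  [IsManifold (𝓡 n) ∞ M]

local notation "𝔼" => EuclideanSpace ℝ (Fin n)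

theorem edistance_comm (g : C1RiemannianMetric n M) (x y : M) :
    g.edistance x y = g.edistance y x := by
  let : Bundle.RiemannianBundle (fun x : M ↦ TangentSpace (𝓡 n) x) := ⟨g.toRiemannianMetric⟩
  exact Manifold.riemannianEDist_comm

theorem edistance_triangle (g : C1RiemannianMetric n M) (x y z : M) :
    g.edistance x z ≤ g.edistance x y + g.edistance y z := by
  let : Bundle.RiemannianBundle (fun x : M ↦ TangentSpace (𝓡 n) x) := ⟨g.toRiemannianMetric⟩
  exact Manifold.riemannianEDist_triangle

theorem eventually_edistance_lt (g : C1RiemannianMetric n M) (x : M) {c : ENNReal} (hc : 0 < c) :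
    ∀ᶠ y in 𝓝 x, g.edistance x y < c := by
  let : Bundle.RiemannianBundle (fun x : M ↦ TangentSpace (𝓡 n) x) := ⟨g.toRiemannianMetric⟩
  have := g.isContinuousRiemannianBundle
  exact eventually_riemannianEDist_lt (𝓡 n) x hc

theorem exists_edistance_lt_subset [T2Space M] (g : C1RiemannianMetric n M) {x : M} {s : Set M}
    (hs : s ∈ 𝓝 x) : ∃ c > 0, ∀ y, g.edistance x y < c → y ∈ s := by
  let : Bundle.RiemannianBundle (fun x : M ↦ TangentSpace (𝓡 n) x) := ⟨g.toRiemannianMetric⟩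
  have := g.isContinuousRiemannianBundle
  have : T3Space M := t3Space n M
  exact setOfPred_riemannianEDist_lt_subset_nhds' (𝓡 n) hs

theorem chartForm_nonneg (g : C1RiemannianMetric n M) {e : OpenPartialHomeomorph M 𝔼}
    (he : e ∈ IsManifold.maximalAtlas (𝓡 n) ∞ M) {y : 𝔼} (hy : y ∈ e.target) (v : 𝔼) :
    0 ≤ g.chartForm e y v v := by
  rcases eq_or_ne v 0 with rfl | hv
  · simp [chartForm_eq_inner]
  · exact (g.chartForm_pos he hy hv).le

theorem continuousAt_gram (g : C1RiemannianMetric n M) {e : OpenPartialHomeomorph M 𝔼}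
    (he : e ∈ IsManifold.maximalAtlas (𝓡 n) ∞ M) {y : 𝔼} (hy : y ∈ e.target) :
    ContinuousAt (g.gram e) y :=
  (g.contDiffOn_gram he).continuousOn.continuousAt (e.open_target.mem_nhds hy)

theorem eventually_chartForm_le_mul (g : C1RiemannianMetric n M) {e : OpenPartialHomeomorph M 𝔼}
    (he : e ∈ IsManifold.maximalAtlas (𝓡 n) ∞ M) {y₀ : 𝔼} (hy₀ : y₀ ∈ e.target) {δ : ℝ}
    (hδ : 1 < δ) : ∀ᶠ y in 𝓝 y₀, ∀ w, g.chartForm e y w w ≤ δ * g.chartForm e y₀ w w ∧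
      g.chartForm e y₀ w w ≤ δ * g.chartForm e y w w := by
  simp only [chartForm_eq_inner]
  refine eventually_forall_inner_le_mul (g.continuousAt_gram he hy₀) (fun v hv ↦ ?_) hδ
  rw [← chartForm_eq_inner]
  exact g.chartForm_pos he hy₀ hv

theorem abs_chartForm_le (g : C1RiemannianMetric n M) {e : OpenPartialHomeomorph M 𝔼}
    (he : e ∈ IsManifold.maximalAtlas (𝓡 n) ∞ M) {y : 𝔼} (hy : y ∈ e.target) (v w : 𝔼) :
    |g.chartForm e y v w| ≤ √(g.chartForm e y v v) * √(g.chartForm e y w w) := by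
  simp only [chartForm_eq_inner]
  refine abs_inner_le_sqrt_mul_sqrt (fun v w ↦ ?_) (fun v ↦ ?_) v w
  · rw [← chartForm_eq_inner, ← chartForm_eq_inner, g.chartForm_symm]
  · rw [← chartForm_eq_inner]
    exact g.chartForm_nonneg he hy v

/-- Near a point, the distance is at most `δ` times the norm of the difference of coordinates. -/
theorem exists_ball_edistance_le (g : C1RiemannianMetric n M) {e : OpenPartialHomeomorph M 𝔼}
    (he : e ∈ IsManifold.maximalAtlas (𝓡 n) ∞ M) {y₀ : 𝔼} (hy₀ : y₀ ∈ e.target) {δ : ℝ}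
    (hδ : 1 < δ) : ∃ r > 0, ∀ y ∈ ball y₀ r, ∀ z ∈ ball y₀ r,
      g.edistance (e.symm y) (e.symm z) ≤
        ENNReal.ofReal (δ * √(g.chartForm e y₀ (z - y) (z - y))) := by
  -- The forms are compared with factor `δ ^ 2`, so that their square roots compare with factor `δ`.
  have hδ2 : 1 < δ ^ 2 := one_lt_pow₀ hδ two_ne_zero
  obtain ⟨r, hr, hball⟩ := Metric.eventually_nhds_iff_ball.1
    ((g.eventually_chartForm_le_mul he hy₀ hδ2).and (e.open_target.mem_nhds hy₀))
  refine ⟨r, hr, fun y hy z hz ↦ ?_⟩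
  set η : ℝ → 𝔼 := fun s ↦ y + s • (z - y) with hη
  have hηd : ∀ s, HasDerivAt η (z - y) s := fun s ↦ by
    have := ((hasDerivAt_id s).smul_const (z - y)).const_add y
    rwa [one_smul] at this
  have hηb : ∀ s ∈ Icc (0 : ℝ) 1, η s ∈ ball y₀ r := fun s hs ↦
    (convex_ball y₀ r).add_smul_sub_mem hy hz hs
  have hsm : ContMDiffOn 𝓘(ℝ, ℝ) (𝓡 n) 1 (e.symm ∘ η) (Icc 0 1) := by
    refine ((contMDiffOn_symm_of_mem_maximalAtlas he).of_le (by norm_cast)).comp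
      (t := e.target) ?_ fun s hs ↦ (hball _ (hηb s hs)).2
    rw [contMDiffOn_iff_contDiffOn]
    fun_prop
  have h1 := g.edistance_le_length zero_le_one hsm
  simp only [Function.comp, hη, zero_smul, add_zero, one_smul, add_sub_cancel] at h1
  refine h1.trans ?_
  calc g.length (e.symm ∘ η) 0 1
      ≤ ∫⁻ t in Icc (0 : ℝ) 1, ENNReal.ofReal (δ * √(g.chartForm e y₀ (z - y) (z - y))) := by
        refine setLIntegral_mono measurable_const fun t ht ↦ ENNReal.ofReal_le_ofReal ?_
        rw [g.speedSq_symm_comp he (hηd t) (hball _ (hηb t ht)).2]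
        refine (Real.sqrt_le_sqrt ((hball _ (hηb t ht)).1 (z - y)).1).trans_eq ?_
        rw [Real.sqrt_mul (by positivity), Real.sqrt_sq (by positivity)]
    _ = _ := by simp

/-- Near a point, the norm of the difference of coordinates is at most `δ` times the distance. -/
theorem exists_ball_le_edistance [T2Space M] (g : C1RiemannianMetric n M)
    {e : OpenPartialHomeomorph M 𝔼}
    (he : e ∈ IsManifold.maximalAtlas (𝓡 n) ∞ M) {y₀ : 𝔼} (hy₀ : y₀ ∈ e.target) {δ : ℝ}
    (hδ : 1 < δ) : ∃ r > 0, ∀ y ∈ ball y₀ r, ∀ z ∈ ball y₀ r,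
      ENNReal.ofReal (√(g.chartForm e y₀ (z - y) (z - y))) ≤
        ENNReal.ofReal δ * g.edistance (e.symm y) (e.symm z) := by
  have hδ2 : 1 < δ ^ 2 := one_lt_pow₀ hδ two_ne_zero
  have hδ0 : 0 < δ := one_pos.trans hδ
  have hev := g.eventually_chartForm_le_mul he hy₀ hδ2
  have hx₀ := e.map_target hy₀
  have hV : {x | x ∈ e.source ∧ ∀ w, g.chartForm e (e x) w w ≤ δ ^ 2 * g.chartForm e y₀ w w ∧
      g.chartForm e y₀ w w ≤ δ ^ 2 * g.chartForm e (e x) w w} ∈ 𝓝 (e.symm y₀) := by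
    have hcont : Tendsto e (𝓝 (e.symm y₀)) (𝓝 y₀) := by
      simpa only [ContinuousAt, e.right_inv hy₀] using e.continuousAt hx₀
    exact inter_mem (e.open_source.mem_nhds hx₀) (hcont.eventually hev)
  -- Competing curves might leave the chart. A curve of length below `ρ / 2` that starts within `ρ /
  -- 4` of the centre stays in the `ρ`-ball, where the chart is defined and the forms are
  -- comparable.
  obtain ⟨ρ, hρ, hρV⟩ := g.exists_edistance_lt_subset hV
  have hρ2 : 0 < ρ / 2 := ENNReal.half_pos hρ.ne'
  have hρ4 : 0 < ρ / 2 / 2 := ENNReal.half_pos hρ2.ne'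
  obtain ⟨r, hr, hball⟩ := Metric.eventually_nhds_iff_ball.1
    (((e.continuousAt_symm hy₀).eventually (g.eventually_edistance_lt (e.symm y₀) hρ4)).and
      (e.open_target.mem_nhds hy₀))
  refine ⟨r, hr, fun y hy z hz ↦ ?_⟩
  by_contra! hlt
  set N := √(g.chartForm e y₀ (z - y) (z - y)) with hN
  have hN2 : g.chartForm e y₀ (z - y) (z - y) = N ^ 2 :=
    (Real.sq_sqrt (g.chartForm_nonneg he hy₀ _)).symm
  have hN0 : 0 < N := ENNReal.ofReal_pos.1 (bot_le.trans_lt hlt)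
  have hd1 : g.edistance (e.symm y) (e.symm z) < ENNReal.ofReal (N / δ) := by
    rw [ENNReal.ofReal_div_of_pos hδ0, ENNReal.lt_div_iff_mul_lt (by simp [hδ0]) (by simp),
      mul_comm]
    exact hlt
  have hd2 : g.edistance (e.symm y) (e.symm z) < ρ / 2 := by
    refine (g.edistance_triangle _ (e.symm y₀) _).trans_lt ?_
    rw [← ENNReal.add_halves (ρ / 2), g.edistance_comm (e.symm y)]
    exact ENNReal.add_lt_add (hball y hy).1 (hball z hz).1
  obtain ⟨γ, h0, h1, hγ, hlen⟩ := g.exists_length_lt (lt_min hd1 hd2)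
  have hmem : ∀ t ∈ Icc (0 : ℝ) 1, γ t ∈ e.source ∧
      ∀ w, g.chartForm e (e (γ t)) w w ≤ δ ^ 2 * g.chartForm e y₀ w w ∧
      g.chartForm e y₀ w w ≤ δ ^ 2 * g.chartForm e (e (γ t)) w w := by
    intro t ht
    refine hρV _ ((g.edistance_triangle _ (e.symm y) _).trans_lt ?_)
    rw [← ENNReal.add_halves ρ]
    refine ENNReal.add_lt_add ((hball y hy).1.trans_le ENNReal.half_le_self) ?_
    rw [← h0]
    exact (g.edistance_le_length ht.1 (hγ.mono (Icc_subset_Icc_right ht.2))).trans_lt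
      ((g.length_mono γ le_rfl ht.2).trans_lt (hlen.trans_le (min_le_right _ _)))
  -- Calibration by the functional `⟨z - y, ·⟩` of the form frozen at `y₀`: it takes the value `N ^
  -- 2` on the chord, while by Cauchy–Schwarz its rate along `γ` is at most `N * δ` times the speed.
  -- A length below `N / δ` is then impossible.
  set ℓ : 𝔼 →L[ℝ] ℝ := innerSL ℝ (g.gram e y₀ (z - y)) with hℓ
  have hℓ' : ∀ w, ℓ w = g.chartForm e y₀ (z - y) w := fun w ↦ by
    rw [chartForm_eq_inner, hℓ, innerSL_apply_apply]
  have hcd : ContDiffOn ℝ 1 (e ∘ γ) (Icc 0 1) := by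
    rw [← contMDiffOn_iff_contDiffOn]
    exact ((contMDiffOn_of_mem_maximalAtlas he).of_le (by norm_cast)).comp hγ
      fun t ht ↦ (hmem t ht).1
  have hcd' : ContDiffOn ℝ 1 (ℓ ∘ e ∘ γ) (Icc 0 1) := ℓ.contDiff.comp_contDiffOn hcd
  have key := enorm_sub_le_lintegral_derivWithin_Icc_of_contDiffOn_Icc hcd' zero_le_one
  have hval : (ℓ ∘ e ∘ γ) 1 - (ℓ ∘ e ∘ γ) 0 = N ^ 2 := by
    simp only [Function.comp, h0, h1, e.right_inv (hball y hy).2, e.right_inv (hball z hz).2]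
    rw [← map_sub, hℓ', ← hN2]
  rw [hval, Real.enorm_of_nonneg (by positivity)] at key
  have hbound : ∫⁻ t in Icc (0 : ℝ) 1, ‖derivWithin (ℓ ∘ e ∘ γ) (Icc 0 1) t‖ₑ ≤
      ENNReal.ofReal (N * δ) * g.length γ 0 1 := by
    rw [length, ← restrict_Ioo_eq_restrict_Icc,
      ← lintegral_const_mul' _ _ ENNReal.ofReal_ne_top]
    refine lintegral_mono_ae ?_
    rw [ae_restrict_iff' measurableSet_Ioo]
    refine Eventually.of_forall fun t ht ↦ ?_
    have htn : Icc (0 : ℝ) 1 ∈ 𝓝 t := Icc_mem_nhds ht.1 ht.2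
    have ht' := Ioo_subset_Icc_self ht
    have hd : DifferentiableAt ℝ (e ∘ γ) t :=
      (hcd.contDiffAt htn).differentiableAt (by simp)
    rw [derivWithin_of_mem_nhds htn, (ℓ.hasFDerivAt.comp_hasDerivAt t hd.hasDerivAt).deriv,
      g.speedSq_eq_chartForm he ((hγ.contMDiffAt htn).mdifferentiableAt (by simp)) (hmem t ht').1,
      ← ENNReal.ofReal_mul (by positivity), ← ofReal_norm]
    refine ENNReal.ofReal_le_ofReal ?_
    rw [hℓ', Real.norm_eq_abs]
    refine (g.abs_chartForm_le he hy₀ (z - y) _).trans ?_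
    rw [mul_assoc]
    refine mul_le_mul_of_nonneg_left ?_ hN0.le
    refine (Real.sqrt_le_sqrt ((hmem t ht').2 _).2).trans_eq ?_
    rw [Real.sqrt_mul (by positivity), Real.sqrt_sq (by positivity)]
  have hfin := key.trans hbound
  have : ENNReal.ofReal (N * δ) * g.length γ 0 1 < ENNReal.ofReal (N ^ 2) := by
    have h3 : N ^ 2 = (N * δ) * (N / δ) := by field_simp
    rw [h3, ENNReal.ofReal_mul (p := N * δ) (by positivity)]
    exact ENNReal.mul_lt_mul_right (by simpa using mul_pos hN0 hδ0) ENNReal.ofReal_ne_top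
      (hlen.trans_le (min_le_left _ _))
  exact absurd this (not_lt.2 hfin)

end C1RiemannianMetric

/-! ### The real-valued distance, Lipschitz curves and the length space property. -/

namespace C1RiemannianMetric

variable {n : ℕ} {M : Type*} [TopologicalSpace M] [ChartedSpace (EuclideanSpace ℝ (Fin n)) M]
  [IsManifold (𝓡 n) ∞ M]

local notation "𝔼" => EuclideanSpace ℝ (Fin n)

/-- The distance `d_g` as a real number. -/
noncomputable def rdist (g : C1RiemannianMetric n M) (x y : M) : ℝ := (g.edistance x y).toReal

theorem rdist_nonneg (g : C1RiemannianMetric n M) (x y : M) : 0 ≤ g.rdist x y :=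
  ENNReal.toReal_nonneg

theorem rdist_comm (g : C1RiemannianMetric n M) (x y : M) : g.rdist x y = g.rdist y x := by
  rw [rdist, edistance_comm, rdist]

theorem rdist_le_of_edistance_le (g : C1RiemannianMetric n M) {x y : M} {r : ℝ} (hr : 0 ≤ r)
    (h : g.edistance x y ≤ ENNReal.ofReal r) : g.rdist x y ≤ r :=
  ENNReal.toReal_le_of_le_ofReal hr h

theorem chartForm_self_le (g : C1RiemannianMetric n M) (e : OpenPartialHomeomorph M 𝔼) (y v : 𝔼) :
    √(g.chartForm e y v v) ≤ √‖g.gram e y‖ * ‖v‖ := by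
  rw [← Real.sqrt_sq (norm_nonneg v), ← Real.sqrt_mul (norm_nonneg _)]
  refine Real.sqrt_le_sqrt ?_
  rw [chartForm_eq_inner]
  calc ⟪g.gram e y v, v⟫ ≤ ‖g.gram e y v‖ * ‖v‖ := real_inner_le_norm _ _
    _ ≤ ‖g.gram e y‖ * ‖v‖ * ‖v‖ := by gcongr; exact ContinuousLinearMap.le_opNorm _ _
    _ = _ := by ring

theorem exists_ball_rdist_le (g : C1RiemannianMetric n M) {e : OpenPartialHomeomorph M 𝔼}
    (he : e ∈ IsManifold.maximalAtlas (𝓡 n) ∞ M) {y₀ : 𝔼} (hy₀ : y₀ ∈ e.target) {δ : ℝ}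
    (hδ : 1 < δ) : ∃ r > 0, ∀ y ∈ ball y₀ r, ∀ z ∈ ball y₀ r,
      g.rdist (e.symm y) (e.symm z) ≤ δ * √(g.chartForm e y₀ (z - y) (z - y)) := by
  obtain ⟨r, hr, h⟩ := g.exists_ball_edistance_le he hy₀ hδ
  exact ⟨r, hr, fun y hy z hz ↦ g.rdist_le_of_edistance_le (by positivity) (h y hy z hz)⟩

section Connected

variable [ConnectedSpace M]

theorem edistance_eq_ofReal_rdist (g : C1RiemannianMetric n M) (x y : M) :
    g.edistance x y = ENNReal.ofReal (g.rdist x y) :=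
  (ENNReal.ofReal_toReal (g.edistance_ne_top x y)).symm

theorem rdist_triangle (g : C1RiemannianMetric n M) (x y z : M) :
    g.rdist x z ≤ g.rdist x y + g.rdist y z := by
  rw [rdist, rdist, rdist, ← ENNReal.toReal_add (g.edistance_ne_top _ _) (g.edistance_ne_top _ _)]
  exact ENNReal.toReal_mono
    (ENNReal.add_ne_top.2 ⟨g.edistance_ne_top _ _, g.edistance_ne_top _ _⟩)
    (g.edistance_triangle x y z)

theorem abs_rdist_sub_le (g : C1RiemannianMetric n M) (p x y : M) :
    |g.rdist p x - g.rdist p y| ≤ g.rdist x y := by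
  have h1 := g.rdist_triangle p x y
  have h2 := g.rdist_triangle p y x
  rw [g.rdist_comm y x] at h2
  exact abs_le.2 ⟨by linarith, by linarith⟩

theorem exists_ball_le_rdist [T2Space M] (g : C1RiemannianMetric n M)
    {e : OpenPartialHomeomorph M 𝔼}
    (he : e ∈ IsManifold.maximalAtlas (𝓡 n) ∞ M) {y₀ : 𝔼} (hy₀ : y₀ ∈ e.target) {δ : ℝ}
    (hδ : 1 < δ) : ∃ r > 0, ∀ y ∈ ball y₀ r, ∀ z ∈ ball y₀ r,
      √(g.chartForm e y₀ (z - y) (z - y)) ≤ δ * g.rdist (e.symm y) (e.symm z) := by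
  obtain ⟨r, hr, h⟩ := g.exists_ball_le_edistance he hy₀ hδ
  refine ⟨r, hr, fun y hy z hz ↦ ?_⟩
  have hδ0 : 0 ≤ δ := by linarith
  have := h y hy z hz
  rwa [edistance_eq_ofReal_rdist, ← ENNReal.ofReal_mul hδ0,
    ENNReal.ofReal_le_ofReal_iff (mul_nonneg hδ0 (g.rdist_nonneg _ _))] at this

/-- The distance is bounded by the length of a Lipschitz curve in a chart. -/
theorem rdist_le_integral (g : C1RiemannianMetric n M) {e : OpenPartialHomeomorph M 𝔼}
    (he : e ∈ IsManifold.maximalAtlas (𝓡 n) ∞ M) {a b : ℝ} (hab : a ≤ b) {y u : ℝ → 𝔼} {K : ℝ≥0}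
    (hy : LipschitzOnWith K y (Icc a b)) (hmem : ∀ t ∈ Icc a b, y t ∈ e.target)
    (hu : ∀ᵐ t, t ∈ Ioo a b → HasDerivAt y (u t) t)
    (hint : IntervalIntegrable (fun t ↦ √(g.chartForm e (y t) (u t) (u t))) volume a b) :
    g.rdist (e.symm (y a)) (e.symm (y b)) ≤ ∫ t in a..b, √(g.chartForm e (y t) (u t) (u t)) := by
  set f : ℝ → ℝ := fun t ↦ g.rdist (e.symm (y a)) (e.symm (y t)) with hf
  have hfd : ∀ s t, |f s - f t| ≤ g.rdist (e.symm (y s)) (e.symm (y t)) := fun s t ↦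
    g.abs_rdist_sub_le _ _ _
  have hloc : ∀ t ∈ Icc a b, ∀ δ : ℝ, 1 < δ → ∃ v ∈ 𝓝[Icc a b] t, ∀ s ∈ v, ∀ s' ∈ v,
      |f s - f s'| ≤ δ * √(g.chartForm e (y t) (y s' - y s) (y s' - y s)) := by
    intro t ht δ hδ
    obtain ⟨r, hr, h⟩ := g.exists_ball_rdist_le he (hmem t ht) hδ
    exact ⟨y ⁻¹' ball (y t) r, (hy.continuousOn t ht) (ball_mem_nhds _ hr), fun s hs s' hs' ↦
      (hfd s s').trans (h _ hs _ hs')⟩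
  -- `f` is Lipschitz on the compact interval, hence absolutely continuous and the integral of its
  -- derivative. It remains to bound that derivative by the speed almost everywhere.
  have hlip : LocallyLipschitzOn (Icc a b) f := by
    intro t ht
    obtain ⟨v, hv, h⟩ := hloc t ht 2 one_lt_two
    refine ⟨2 * (NNReal.sqrt ‖g.gram e (y t)‖₊) * K, v ∩ Icc a b,
      inter_mem hv self_mem_nhdsWithin, LipschitzOnWith.of_dist_le_mul fun s hs s' hs' ↦ ?_⟩
    rw [Real.dist_eq]
    refine (h s hs.1 s' hs'.1).trans ?_
    have h1 := g.chartForm_self_le e (y t) (y s' - y s)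
    have h2 := hy.dist_le_mul s' hs'.2 s hs.2
    rw [dist_eq_norm, dist_comm] at h2
    push_cast
    calc 2 * √(g.chartForm e (y t) (y s' - y s) (y s' - y s))
        ≤ 2 * (√‖g.gram e (y t)‖ * (K * dist s s')) := by gcongr; exact h1.trans (by gcongr)
      _ = _ := by ring
  obtain ⟨K', hK'⟩ := hlip.exists_lipschitzOnWith_of_compact isCompact_Icc
  have hac : AbsolutelyContinuousOnInterval f a b :=
    LipschitzOnWith.absolutelyContinuousOnInterval (by rwa [uIcc_of_le hab])
  have hfa : f a = 0 := by
    have := g.rdist_le_of_edistance_le (x := e.symm (y a)) (y := e.symm (y a)) le_rfl (by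
      let : Bundle.RiemannianBundle (fun x : M ↦ TangentSpace (𝓡 n) x) := ⟨g.toRiemannianMetric⟩
      exact Manifold.riemannianEDist_self.le.trans bot_le)
    exact le_antisymm this (g.rdist_nonneg _ _)
  have hftc := hac.integral_deriv_eq_sub
  rw [hfa, sub_zero] at hftc
  change f b ≤ _
  rw [← hftc]
  refine intervalIntegral.integral_mono_ae_restrict hab hac.intervalIntegrable_deriv hint ?_
  rw [← restrict_Ioo_eq_restrict_Icc, EventuallyLE, ae_restrict_iff' measurableSet_Ioo]
  filter_upwards [hu, hac.ae_differentiableAt] with t hut hft ht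
  have ht' : t ∈ Icc a b := Ioo_subset_Icc_self ht
  have hyd := hut ht
  have hfd := (hft (by rwa [uIcc_of_le hab])).hasDerivAt
  -- Difference quotients of `f` are bounded by `δ` times the norm, frozen at `y t`, of those of
  -- `y`; afterwards `δ` tends to `1`.
  have hδ : ∀ δ : ℝ, 1 < δ → deriv f t ≤ δ * √(g.chartForm e (y t) (u t) (u t)) := by
    intro δ hδ
    obtain ⟨v, hv, h⟩ := hloc t ht' δ hδ
    rw [nhdsWithin_eq_nhds.2 (Icc_mem_nhds ht.1 ht.2)] at hv
    have h1 : Tendsto (fun s ↦ |slope f t s|) (𝓝[≠] t) (𝓝 |deriv f t|) :=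
      hfd.tendsto_slope.abs
    have h2 : Tendsto (fun s ↦ δ * √(g.chartForm e (y t) (slope y t s) (slope y t s)))
        (𝓝[≠] t) (𝓝 (δ * √(g.chartForm e (y t) (u t) (u t)))) := by
      simp only [chartForm_eq_inner]
      have hc : Continuous fun v : 𝔼 ↦ δ * √⟪g.gram e (y t) v, v⟫ := by fun_prop
      exact (hc.tendsto (u t)).comp hyd.tendsto_slope
    refine (le_abs_self _).trans (le_of_tendsto_of_tendsto h1 h2 ?_)
    filter_upwards [nhdsWithin_le_nhds hv, self_mem_nhdsWithin] with s hs hst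
    have h3 := h t (mem_of_mem_nhds hv) s hs
    have h4 : 0 < |s - t| := abs_pos.2 (sub_ne_zero.2 hst)
    rw [slope_def_module, slope_def_module, chartForm_smul_left, chartForm_symm,
      chartForm_smul_left, smul_eq_mul, abs_mul, ← mul_assoc,
      Real.sqrt_mul (mul_self_nonneg _), Real.sqrt_mul_self_eq_abs, abs_sub_comm (f s)]
    calc |(s - t)⁻¹| * |f t - f s| ≤ |(s - t)⁻¹| *
          (δ * √(g.chartForm e (y t) (y s - y t) (y s - y t))) := by gcongr
      _ = _ := by ring
  have hlim : Tendsto (fun δ : ℝ ↦ δ * √(g.chartForm e (y t) (u t) (u t))) (𝓝[>] 1)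
      (𝓝 (1 * √(g.chartForm e (y t) (u t) (u t)))) :=
    ((continuous_id.mul continuous_const).tendsto 1).mono_left nhdsWithin_le_nhds
  rw [one_mul] at hlim
  exact ge_of_tendsto hlim (eventually_nhdsWithin_of_forall hδ)

end Connected

/-- `(M, d_g)` is a length space. -/
theorem exists_unitSpeed_of_edistance_lt (g : C1RiemannianMetric n M) {x y : M} {L : ℝ}
    (h : g.edistance x y < ENNReal.ofReal L) : ∃ σ : ℝ → M, g.edistance x (σ 0) = 0 ∧
      g.edistance (σ L) y = 0 ∧
      ∀ s ∈ Icc 0 L, ∀ t ∈ Icc 0 L, g.edistance (σ s) (σ t) ≤ ENNReal.ofReal |s - t| := by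
  obtain ⟨γ, h0, h1, hγ, hlen⟩ := g.exists_length_lt h
  have hL : 0 < L := ENNReal.ofReal_pos.1 (bot_le.trans_lt h)
  have hself : ∀ z, g.edistance z z = 0 := fun z ↦ by
    let : Bundle.RiemannianBundle (fun x : M ↦ TangentSpace (𝓡 n) x) := ⟨g.toRiemannianMetric⟩
    exact Manifold.riemannianEDist_self
  have hfin : ∀ s t, 0 ≤ s → t ≤ 1 → g.length γ s t ≠ ⊤ := fun s t hs ht ↦
    ((g.length_mono γ hs ht).trans_lt (hlen.trans ENNReal.ofReal_lt_top)).ne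
  set f : ℝ → ℝ := fun t ↦ (g.length γ 0 t).toReal with hf
  have hsub : ∀ s t, 0 ≤ s → s ≤ t → t ≤ 1 → f t - f s = (g.length γ s t).toReal := by
    intro s t hs hst ht
    have := congrArg ENNReal.toReal (g.length_add γ hs hst)
    rw [ENNReal.toReal_add (hfin _ _ le_rfl (hst.trans ht)) (hfin _ _ hs ht)] at this
    simp only [hf]
    linarith
  have hcont : ContinuousOn f (Icc 0 1) := by
    rw [Metric.continuousOn_iff]
    intro t ht ε hε
    obtain ⟨δ, hδ, hδε⟩ := exists_pos_setLIntegral_lt_of_measure_lt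
      (μ := volume.restrict (Icc (0 : ℝ) 1)) (f := fun t ↦ ENNReal.ofReal √(g.speedSq γ t))
      (hfin 0 1 le_rfl le_rfl) (ε := ENNReal.ofReal ε) (by simpa using hε)
    have key : ∀ s t, 0 ≤ s → s ≤ t → t ≤ 1 → ENNReal.ofReal (t - s) < δ → |f t - f s| < ε := by
      intro s t hs hst ht hlt
      have h3 := hδε (Icc s t) ((Measure.restrict_apply_le _ _).trans_lt (by simpa using hlt))
      rw [Measure.restrict_restrict measurableSet_Icc,
        inter_eq_left.2 (Icc_subset_Icc hs ht)] at h3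
      rw [hsub s t hs hst ht, abs_of_nonneg ENNReal.toReal_nonneg]
      exact (ENNReal.lt_ofReal_iff_toReal_lt (hfin _ _ hs ht)).1 h3
    obtain ⟨η, hη, hηδ⟩ : ∃ η > 0, ENNReal.ofReal η ≤ δ := by
      rcases eq_or_ne δ ⊤ with rfl | hδt
      · exact ⟨1, one_pos, le_top⟩
      · exact ⟨δ.toReal, ENNReal.toReal_pos hδ.ne' hδt, by rw [ENNReal.ofReal_toReal hδt]⟩
    refine ⟨η, hη, fun s hs hst ↦ ?_⟩
    rw [Real.dist_eq] at hst ⊢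
    have hlt : ∀ r < η, ENNReal.ofReal r < δ := fun r hr ↦
      ((ENNReal.ofReal_lt_ofReal_iff hη).2 hr).trans_le hηδ
    rcases le_total s t with hle | hle
    · rw [abs_sub_comm]
      exact key s t hs.1 hle ht.2 (hlt _ (by linarith [neg_abs_le (s - t)]))
    · exact key t s ht.1 hle hs.2 (hlt _ (by linarith [le_abs_self (s - t)]))
  have hf0 : f 0 = 0 := by simp [hf, length]
  have hf1 : f 1 < L := (ENNReal.lt_ofReal_iff_toReal_lt (hfin _ _ le_rfl le_rfl)).1 hlen
  have hf1' : 0 ≤ f 1 := ENNReal.toReal_nonneg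
  have hdist : ∀ s t, s ∈ Icc (0 : ℝ) 1 → t ∈ Icc (0 : ℝ) 1 →
      g.edistance (γ s) (γ t) ≤ ENNReal.ofReal |f s - f t| := by
    have key : ∀ s t, 0 ≤ s → s ≤ t → t ≤ 1 →
        g.edistance (γ s) (γ t) ≤ ENNReal.ofReal |f s - f t| := by
      intro s t hs hst ht
      rw [abs_sub_comm, hsub s t hs hst ht, abs_of_nonneg ENNReal.toReal_nonneg,
        ENNReal.ofReal_toReal (hfin _ _ hs ht)]
      exact g.edistance_le_length hst (hγ.mono (Icc_subset_Icc hs ht))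
    intro s t hs ht
    rcases le_total s t with hle | hle
    · exact key s t hs.1 hle ht.2
    · rw [edistance_comm, abs_sub_comm]
      exact key t s ht.1 hle hs.2
  have hex : ∀ s, ∃ t ∈ Icc (0 : ℝ) 1, s ∈ Icc 0 L → f t = min s (f 1) := by
    intro s
    by_cases hs : s ∈ Icc 0 L
    · obtain ⟨t, ht, hft⟩ := intermediate_value_Icc zero_le_one hcont
        (show min s (f 1) ∈ Icc (f 0) (f 1) from ⟨by rw [hf0]; exact le_min hs.1 hf1',
          min_le_right _ _⟩)
      exact ⟨t, ht, fun _ ↦ hft⟩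
    · exact ⟨0, by simp, fun h ↦ absurd h hs⟩
  choose τ hτ hfτ using hex
  refine ⟨γ ∘ τ, ?_, ?_, fun s hs t ht ↦ ?_⟩
  · have h3 := hdist 0 (τ 0) (by simp) (hτ 0)
    rw [hf0, hfτ 0 ⟨le_rfl, hL.le⟩, min_eq_left hf1', h0] at h3
    simpa using h3
  · have h3 := hdist (τ L) 1 (hτ L) (by simp)
    rw [hfτ L ⟨hL.le, le_rfl⟩, min_eq_right hf1.le, h1] at h3
    simpa using h3
  · refine (hdist _ _ (hτ s) (hτ t)).trans (ENNReal.ofReal_le_ofReal ?_)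
    rw [hfτ s hs, hfτ t ht]
    exact (abs_min_sub_min_le_max _ _ _ _).trans (by simp)

end C1RiemannianMetric

/-! ### First variation and the du Bois-Reymond lemma. -/

section Variation

variable {n : ℕ}

local notation "𝔼" => EuclideanSpace ℝ (Fin n)

theorem intervalIntegrable_of_measurable_of_norm_le {V : Type*} [NormedAddCommGroup V]
    [MeasurableSpace V] [BorelSpace V] [SecondCountableTopology V] {a b C : ℝ} (hab : a ≤ b)
    {f : ℝ → V} (hf : Measurable f) (hC : ∀ t ∈ Icc a b, ‖f t‖ ≤ C) :
    IntervalIntegrable f volume a b := by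
  rw [intervalIntegrable_iff_integrableOn_Icc_of_le hab]
  refine Measure.integrableOn_of_bounded (by simp) hf.aestronglyMeasurable (M := C) ?_
  rw [ae_restrict_iff' measurableSet_Icc]
  exact Eventually.of_forall hC

/-- The velocities `u + ε • η • w` are admissible for small `ε`, since `∫ η = 0` keeps the end point
fixed. The action is differentiable in `ε` by dominated convergence, with a local minimum at `ε =
0`. Working with bounded measurable velocities covers exactly the Lipschitz curves. -/
theorem integral_fderiv_variation_eq_zero {U : Set 𝔼} (hU : IsOpen U) {L : 𝔼 × 𝔼 → ℝ}
    (hL : ContDiffOn ℝ 1 L (U ×ˢ univ)) {a b : ℝ} (hab : a ≤ b) {x₀ : 𝔼} {u : ℝ → 𝔼} {C : ℝ}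
    (hu : Measurable u) (huC : ∀ t, ‖u t‖ ≤ C) (hx : ∀ t ∈ Icc a b, x₀ + ∫ s in a..t, u s ∈ U)
    (hmin : ∀ u' : ℝ → 𝔼, Measurable u' → (∃ C', ∀ t, ‖u' t‖ ≤ C') →
      ∫ t in a..b, u' t = ∫ t in a..b, u t → (∀ t ∈ Icc a b, x₀ + ∫ s in a..t, u' s ∈ U) →
      ∫ t in a..b, L (x₀ + ∫ s in a..t, u s, u t) ≤ ∫ t in a..b, L (x₀ + ∫ s in a..t, u' s, u' t))
    (w : 𝔼) {η : ℝ → ℝ} {D : ℝ} (hη : Measurable η) (hηD : ∀ t, |η t| ≤ D)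
    (hη0 : ∫ t in a..b, η t = 0) :
    ∫ t in a..b, fderiv ℝ L (x₀ + ∫ s in a..t, u s, u t) ((∫ s in a..t, η s) • w, η t • w) = 0 := by
  have hui : ∀ c d, IntervalIntegrable u volume c d := fun c d ↦ by
    rcases le_total c d with h | h
    · exact intervalIntegrable_of_measurable_of_norm_le h hu fun t _ ↦ huC t
    · exact (intervalIntegrable_of_measurable_of_norm_le h hu fun t _ ↦ huC t).symm
  have hηi : ∀ c d, IntervalIntegrable η volume c d := fun c d ↦ by
    rcases le_total c d with h | h
    · exact intervalIntegrable_of_measurable_of_norm_le h hη fun t _ ↦ hηD t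
    · exact (intervalIntegrable_of_measurable_of_norm_le h hη fun t _ ↦ hηD t).symm
  set x : ℝ → 𝔼 := fun t ↦ x₀ + ∫ s in a..t, u s with hxdef
  set ψ : ℝ → ℝ := fun t ↦ ∫ s in a..t, η s with hψdef
  have hxc : Continuous x := continuous_const.add (intervalIntegral.continuous_primitive hui a)
  have hψc : Continuous ψ := intervalIntegral.continuous_primitive hηi a
  have hD : 0 ≤ D := (abs_nonneg _).trans (hηD 0)
  have hψD : ∀ t ∈ Icc a b, |ψ t| ≤ D * (b - a) := by
    intro t ht
    refine (intervalIntegral.norm_integral_le_of_norm_le_const (f := η) (C := D)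
      fun s _ ↦ hηD s).trans ?_
    rw [abs_of_nonneg (by linarith [ht.1])]
    gcongr
    exact ht.2
  set K₀ := x '' Icc a b
  have hK₀ : IsCompact K₀ := isCompact_Icc.image hxc
  have hK₀U : K₀ ⊆ U := by rintro _ ⟨t, ht, rfl⟩; exact hx t ht
  obtain ⟨ρ, hρ, hρU⟩ := hK₀.exists_cthickening_subset_open hU hK₀U
  -- A compact set containing all positions and velocities of the varied curves with `|ε| < ε₀ ≤ 1`;
  -- the bounds of `L` and of its derivative on it are the dominating constants.
  set K : Set (𝔼 × 𝔼) := cthickening ρ K₀ ×ˢ closedBall 0 (C + D * ‖w‖) with hKdef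
  have hK : IsCompact K := hK₀.cthickening.prod (isCompact_closedBall _ _)
  have hKU : K ⊆ U ×ˢ univ := fun z hz ↦ ⟨hρU hz.1, mem_univ _⟩
  have hO : IsOpen (U ×ˢ (univ : Set 𝔼)) := hU.prod isOpen_univ
  obtain ⟨B, hB⟩ := hK.exists_bound_of_continuousOn
    ((hL.continuousOn_fderiv_of_isOpen hO le_rfl).mono hKU)
  obtain ⟨B', hB'⟩ := hK.exists_bound_of_continuousOn (hL.continuousOn.mono hKU)
  set Z : ℝ → ℝ → 𝔼 × 𝔼 := fun ε t ↦ (x t + ε • ψ t • w, u t + ε • η t • w) with hZ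
  have hZm : ∀ ε, Measurable (Z ε) := fun ε ↦ by
    have h1 : Measurable fun t ↦ x t + ε • ψ t • w := by
      apply Continuous.measurable; fun_prop
    have h2 : Measurable fun t ↦ u t + ε • η t • w :=
      hu.add ((hη.smul_const w).const_smul ε)
    exact h1.prodMk h2
  -- The displacement is at most `ε * D * (b - a) * ‖w‖`; the `+ 1` in the denominator of the
  -- witness guards against division by zero.
  obtain ⟨ε₀, hε₀, hε₀1, hε₀ρ⟩ : ∃ ε₀ > 0, ε₀ ≤ 1 ∧ ε₀ * (D * (b - a) * ‖w‖) ≤ ρ := by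
    have hP : 0 ≤ D * (b - a) * ‖w‖ :=
      mul_nonneg (mul_nonneg hD (by linarith)) (norm_nonneg _)
    refine ⟨min 1 (ρ / (D * (b - a) * ‖w‖ + 1)), by positivity, min_le_left _ _, ?_⟩
    calc min 1 (ρ / (D * (b - a) * ‖w‖ + 1)) * (D * (b - a) * ‖w‖)
        ≤ ρ / (D * (b - a) * ‖w‖ + 1) * (D * (b - a) * ‖w‖ + 1) := by
          gcongr
          · exact min_le_right _ _
          · linarith
      _ = ρ := by field_simp
  have hZK : ∀ ε ∈ ball (0 : ℝ) ε₀, ∀ t ∈ Icc a b, Z ε t ∈ K := by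
    intro ε hε t ht
    rw [mem_ball_zero_iff, Real.norm_eq_abs] at hε
    refine ⟨mem_cthickening_of_dist_le _ (x t) _ _ (mem_image_of_mem _ ht) ?_, ?_⟩
    · simp only [hZ, dist_eq_norm, add_sub_cancel_left, norm_smul, Real.norm_eq_abs]
      calc |ε| * (|ψ t| * ‖w‖) ≤ ε₀ * (D * (b - a) * ‖w‖) := by
            gcongr
            exact hψD t ht
        _ ≤ ρ := hε₀ρ
    · rw [mem_closedBall_zero_iff]
      refine (norm_add_le _ _).trans ?_
      rw [norm_smul, norm_smul, Real.norm_eq_abs, Real.norm_eq_abs]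
      calc ‖u t‖ + |ε| * (|η t| * ‖w‖) ≤ C + 1 * (D * ‖w‖) := by
            gcongr
            · exact huC t
            · exact hε.le.trans hε₀1
            · exact hηD t
        _ = _ := by ring
  have h0 : (0 : ℝ) ∈ ball (0 : ℝ) ε₀ := mem_ball_self hε₀
  have hmeasL : ∀ ε ∈ ball (0 : ℝ) ε₀,
      AEStronglyMeasurable (fun t ↦ L (Z ε t)) (volume.restrict (uIoc a b)) := by
    classical
    intro ε hε
    -- `L` is only controlled on the open set, so it is replaced by zero outside to obtain a
    -- measurable function.
    have h1 : Measurable ((U ×ˢ (univ : Set 𝔼)).piecewise L 0) :=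
      hL.continuousOn.measurable_piecewise continuousOn_const hO.measurableSet
    refine (h1.comp (hZm ε)).aestronglyMeasurable.congr ?_
    rw [uIoc_of_le hab, EventuallyEq, ae_restrict_iff' measurableSet_Ioc]
    refine Eventually.of_forall fun t ht ↦ ?_
    exact piecewise_eq_of_mem _ _ _ (hKU (hZK ε hε t (Ioc_subset_Icc_self ht)))
  have hmain := intervalIntegral.hasDerivAt_integral_of_dominated_loc_of_deriv_le
    (μ := volume) (a := a) (b := b) (x₀ := (0 : ℝ)) (F := fun ε t ↦ L (Z ε t))
    (F' := fun ε t ↦ fderiv ℝ L (Z ε t) (ψ t • w, η t • w))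
    (bound := fun _ ↦ B * (D * (b - a) * ‖w‖ + D * ‖w‖)) (ball_mem_nhds 0 hε₀)
    (eventually_of_mem (ball_mem_nhds 0 hε₀) hmeasL) ?_ ?_ ?_ intervalIntegrable_const ?_
  rotate_left
  · rw [intervalIntegrable_iff, uIoc_of_le hab]
    have := hmeasL 0 h0
    rw [uIoc_of_le hab] at this
    refine ⟨this, HasFiniteIntegral.restrict_of_bounded (C := B') (by simp) ?_⟩
    rw [ae_restrict_iff' measurableSet_Ioc]
    exact Eventually.of_forall fun t ht ↦ hB' _ (hZK 0 h0 t (Ioc_subset_Icc_self ht))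
  · have h1 : (fun t ↦ fderiv ℝ L (Z 0 t) (ψ t • w, η t • w)) =
        fun t ↦ ψ t * fderiv ℝ L (Z 0 t) (w, 0) + η t * fderiv ℝ L (Z 0 t) (0, w) := by
      funext t
      rw [← smul_eq_mul, ← smul_eq_mul, ← map_smul, ← map_smul, ← map_add]
      simp
    rw [h1]
    exact ((hψc.measurable.mul ((measurable_fderiv_apply_const ℝ L _).comp (hZm 0))).add
      (hη.mul ((measurable_fderiv_apply_const ℝ L _).comp (hZm 0)))).aestronglyMeasurable
  · refine Eventually.of_forall fun t ht ε hε ↦ ?_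
    rw [uIoc_of_le hab] at ht
    have ht' := Ioc_subset_Icc_self ht
    refine (ContinuousLinearMap.le_opNorm _ _).trans ?_
    have h1 := hB _ (hZK ε hε t ht')
    have h2 : ‖((ψ t • w, η t • w) : 𝔼 × 𝔼)‖ ≤ D * (b - a) * ‖w‖ + D * ‖w‖ := by
      rw [Prod.norm_def]
      refine (max_le_add_of_nonneg (norm_nonneg _) (norm_nonneg _)).trans ?_
      rw [norm_smul, norm_smul]
      gcongr
      · exact hψD t ht'
      · exact hηD t
    exact mul_le_mul h1 h2 (norm_nonneg _) ((norm_nonneg _).trans h1)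
  · refine Eventually.of_forall fun t ht ε hε ↦ ?_
    rw [uIoc_of_le hab] at ht
    have h1 : HasFDerivAt L (fderiv ℝ L (Z ε t)) (Z ε t) :=
      ((hL.contDiffAt (hO.mem_nhds (hKU (hZK ε hε t (Ioc_subset_Icc_self ht))))).differentiableAt
        one_ne_zero).hasFDerivAt
    have h2 : HasDerivAt (fun ε ↦ Z ε t) (ψ t • w, η t • w) ε := by
      have h3 := ((hasDerivAt_id ε).smul_const (ψ t • w)).const_add (x t)
      have h4 := ((hasDerivAt_id ε).smul_const (η t • w)).const_add (u t)
      rw [one_smul] at h3 h4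
      exact h3.prodMk h4
    exact h1.comp_hasDerivAt ε h2
  have hprim : ∀ ε t : ℝ, x₀ + ∫ s in a..t, (u s + ε • η s • w) = x t + ε • ψ t • w := by
    intro ε t
    have h1 : IntervalIntegrable (fun s ↦ ε • η s • w) volume a t :=
      ⟨((hηi a t).1.smul_const w).smul ε, ((hηi a t).2.smul_const w).smul ε⟩
    rw [intervalIntegral.integral_add (hui _ _) h1,
      intervalIntegral.integral_smul, intervalIntegral.integral_smul_const, add_assoc]
  have hloc : IsLocalMin (fun ε ↦ ∫ t in a..b, L (Z ε t)) 0 := by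
    filter_upwards [ball_mem_nhds 0 hε₀] with ε hε
    have h1 := hmin (fun t ↦ u t + ε • η t • w) (hu.add ((hη.smul_const w).const_smul ε))
      ⟨C + |ε| * (D * ‖w‖), fun t ↦ by
        refine (norm_add_le _ _).trans ?_
        rw [norm_smul, norm_smul, Real.norm_eq_abs, Real.norm_eq_abs]
        gcongr
        · exact huC t
        · exact hηD t⟩ ?_ ?_
    · simp only [hprim] at h1
      simpa [hZ] using h1
    · have h2 := hprim ε b
      simp only [hxdef, hψdef, hη0, zero_smul, smul_zero, add_zero] at h2
      exact add_left_cancel h2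
    · intro t ht
      rw [hprim]
      exact (hKU (hZK ε hε t ht)).1
  have := hloc.hasDerivAt_eq_zero hmain.2
  simpa [hZ] using this

/-- The du Bois-Reymond lemma. -/
theorem exists_ae_eq_const_add_integral {a b C : ℝ} (hab : a < b) {p q : ℝ → ℝ}
    (hp : Measurable p) (hq : Measurable q) (hpC : ∀ t ∈ Icc a b, |p t| ≤ C)
    (hqC : ∀ t ∈ Icc a b, |q t| ≤ C)
    (h : ∀ (η : ℝ → ℝ) (D : ℝ), Measurable η → (∀ t, |η t| ≤ D) → ∫ t in a..b, η t = 0 →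
      ∫ t in a..b, ((∫ s in a..t, η s) * q t + η t * p t) = 0) :
    ∃ c, ∀ᵐ t, t ∈ Icc a b → p t = c + ∫ s in a..t, q s := by
  have hpi := intervalIntegrable_of_measurable_of_norm_le hab.le hp hpC
  have hqi := intervalIntegrable_of_measurable_of_norm_le hab.le hq hqC
  set Q : ℝ → ℝ := fun t ↦ ∫ s in a..t, q s with hQ
  have hQac : AbsolutelyContinuousOnInterval Q a b :=
    hqi.absolutelyContinuousOnInterval_intervalIntegral (by simp)
  have hQc : ContinuousOn Q (Icc a b) := by simpa [uIcc_of_le hab.le] using hQac.continuousOn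
  have hQi : IntervalIntegrable Q volume a b :=
    ContinuousOn.intervalIntegrable (by rwa [uIcc_of_le hab.le])
  -- The mean value of `p - Q`. It makes `η = p - Q - c` an admissible test function; integrating
  -- `(∫ η) * q` by parts turns the hypothesis into `∫ η * (p - Q) = 0`, so `∫ η ^ 2 = 0`.
  set c : ℝ := (b - a)⁻¹ * ∫ t in a..b, (p t - Q t) with hc
  classical
  set Q' : ℝ → ℝ := (Icc a b).piecewise Q 0 with hQ'
  have hQ'm : Measurable Q' := hQc.measurable_piecewise continuousOn_const measurableSet_Icc
  have hQQ' : ∀ t ∈ Icc a b, Q' t = Q t := fun t ht ↦ piecewise_eq_of_mem _ _ _ ht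
  set η : ℝ → ℝ := (Icc a b).indicator (fun t ↦ p t - Q' t - c) with hη
  have hηm : Measurable η := ((hp.sub hQ'm).sub measurable_const).indicator measurableSet_Icc
  have hηeq : ∀ t ∈ Icc a b, η t = p t - Q t - c := fun t ht ↦ by
    rw [hη, indicator_of_mem ht, hQQ' t ht]
  obtain ⟨C', hC'⟩ := isCompact_Icc.exists_bound_of_continuousOn hQc
  have hηD : ∀ t, |η t| ≤ C + C' + |c| := by
    intro t
    by_cases ht : t ∈ Icc a b
    · rw [hηeq t ht]
      calc |p t - Q t - c| ≤ |p t| + |Q t| + |c| :=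
            (abs_sub _ _).trans (add_le_add (abs_sub _ _) le_rfl)
        _ ≤ _ := by gcongr; exacts [hpC t ht, hC' t ht]
    · rw [hη, indicator_of_notMem ht, abs_zero]
      have ha : a ∈ Icc a b := ⟨le_rfl, hab.le⟩
      have h1 := (abs_nonneg _).trans (hpC a ha)
      have h2 := (norm_nonneg _).trans (hC' a ha)
      positivity
  have hηi := intervalIntegrable_of_measurable_of_norm_le hab.le hηm fun t _ ↦ hηD t
  have hcongr : ∀ f g : ℝ → ℝ, (∀ t ∈ Icc a b, f t = g t) →
      ∫ t in a..b, f t = ∫ t in a..b, g t := fun f g hfg ↦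
    intervalIntegral.integral_congr fun t ht ↦ hfg t (by rwa [uIcc_of_le hab.le] at ht)
  have hη0 : ∫ t in a..b, η t = 0 := by
    rw [hcongr _ _ hηeq, intervalIntegral.integral_sub (hpi.sub hQi) intervalIntegrable_const,
      intervalIntegral.integral_const, hc, smul_eq_mul,
      mul_inv_cancel_left₀ (sub_ne_zero.2 hab.ne'), sub_self]
  have hψac := hηi.absolutelyContinuousOnInterval_intervalIntegral (c := a) (by simp)
  have hparts := hψac.integral_mul_deriv_eq_deriv_mul hQac
  rw [hη0, intervalIntegral.integral_same, zero_mul, zero_mul, sub_zero, zero_sub] at hparts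
  have e1 : ∫ t in a..b, (∫ s in a..t, η s) * deriv Q t = ∫ t in a..b, (∫ s in a..t, η s) * q t := by
    refine intervalIntegral.integral_congr_ae ?_
    filter_upwards [hqi.ae_hasDerivAt_integral] with t ht htm
    rw [(ht (uIoc_subset_uIcc htm) a (by simp)).deriv]
  have e2 : ∫ t in a..b, deriv (fun t ↦ ∫ s in a..t, η s) t * Q t = ∫ t in a..b, η t * Q t := by
    refine intervalIntegral.integral_congr_ae ?_
    filter_upwards [hηi.ae_hasDerivAt_integral] with t ht htm
    rw [(ht (uIoc_subset_uIcc htm) a (by simp)).deriv]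
  rw [e1, e2] at hparts
  have hψc : ContinuousOn (fun t ↦ ∫ s in a..t, η s) (uIcc a b) := hψac.continuousOn
  have hηp : IntervalIntegrable (fun t ↦ η t * p t) volume a b :=
    intervalIntegrable_of_measurable_of_norm_le (C := (C + C' + |c|) * C) hab.le (hηm.mul hp)
      fun t ht ↦ by
        rw [norm_mul]
        exact mul_le_mul (hηD t) (hpC t ht) (norm_nonneg _) ((abs_nonneg _).trans (hηD t))
  have hηQ : IntervalIntegrable (fun t ↦ η t * Q t) volume a b :=
    hηi.mul_continuousOn (by rwa [uIcc_of_le hab.le])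
  have hmain := h η _ hηm hηD hη0
  rw [intervalIntegral.integral_add (hqi.continuousOn_mul hψc) hηp, hparts] at hmain
  have hsq : ∫ t in a..b, η t ^ 2 = 0 := by
    have e3 : ∀ t ∈ Icc a b, η t ^ 2 = η t * p t - η t * Q t - η t * c := fun t ht ↦ by
      rw [sq]; nth_rw 2 [hηeq t ht]; ring
    rw [hcongr _ _ e3, intervalIntegral.integral_sub (hηp.sub hηQ) (hηi.mul_const c),
      intervalIntegral.integral_sub hηp hηQ, intervalIntegral.integral_mul_const, hη0]
    linarith
  have hsqi : IntervalIntegrable (fun t ↦ η t ^ 2) volume a b :=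
    intervalIntegrable_of_measurable_of_norm_le (C := (C + C' + |c|) ^ 2) hab.le (hηm.pow_const 2)
      fun t _ ↦ by
        rw [norm_pow]
        exact pow_le_pow_left₀ (norm_nonneg _) (hηD t) 2
  rw [intervalIntegral.integral_eq_zero_iff_of_le_of_nonneg_ae hab.le
    (Eventually.of_forall fun t ↦ sq_nonneg _) hsqi, restrict_Ioc_eq_restrict_Icc,
    EventuallyEq, ae_restrict_iff' measurableSet_Icc] at hsq
  refine ⟨c, ?_⟩
  filter_upwards [hsq] with t h1 ht
  have h2 := h1 ht
  simp only [Pi.zero_apply, ne_eq, OfNat.ofNat_ne_zero, not_false_eq_true, pow_eq_zero_iff] at h2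
  rw [hηeq t ht] at h2
  linarith

end Variation

/-! ### Regularity of energy minimizers. -/

section Regularity

theorem contDiffOn_one_of_hasDerivAt {V : Type*} [NormedAddCommGroup V] [NormedSpace ℝ V]
    {f f' : ℝ → V} {s : Set ℝ} (hs : IsOpen s) (hf : ∀ t ∈ s, HasDerivAt f (f' t) t)
    {k : ℕ∞} (hf' : ContDiffOn ℝ k f' s) : ContDiffOn ℝ (k + 1) f s := by
  rw [contDiffOn_succ_iff_deriv_of_isOpen hs]
  refine ⟨fun t ht ↦ (hf t ht).differentiableAt.differentiableWithinAt, by simp, ?_⟩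
  exact hf'.congr fun t ht ↦ (hf t ht).deriv

theorem hasDerivAt_of_eq_add_integral {V : Type*} [NormedAddCommGroup V] [NormedSpace ℝ V]
    [CompleteSpace V] {F f : ℝ → V} {F₀ : V} {a b : ℝ} (hf : ContinuousOn f (Icc a b))
    (hF : ∀ t ∈ Icc a b, F t = F₀ + ∫ s in a..t, f s) {t : ℝ} (ht : t ∈ Ioo a b) :
    HasDerivAt F (f t) t := by
  have h1 : IntervalIntegrable f volume a t :=
    (hf.mono (by rw [uIcc_of_le ht.1.le]; exact Icc_subset_Icc_right ht.2.le)).intervalIntegrable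
  have h2 := (hf.mono Ioo_subset_Icc_self).stronglyMeasurableAtFilter (μ := volume) isOpen_Ioo t ht
  have h3 := intervalIntegral.integral_hasDerivAt_right h1 h2
    (hf.continuousAt (Icc_mem_nhds ht.1 ht.2))
  refine (h3.const_add F₀).congr_of_eventuallyEq ?_
  filter_upwards [Icc_mem_nhds ht.1 ht.2] with s hs using hF s hs

variable {n : ℕ}

local notation "𝔼" => EuclideanSpace ℝ (Fin n)

theorem isUnit_of_inner_pos {A : 𝔼 →L[ℝ] 𝔼} (hpos : ∀ v, v ≠ 0 → 0 < ⟪A v, v⟫) : IsUnit A := by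
  have hinj : Function.Injective A := by
    rw [injective_iff_map_eq_zero]
    intro v hv
    by_contra h
    have := hpos v h
    simp [hv] at this
  let e := (LinearEquiv.ofInjectiveEndo (A : 𝔼 →ₗ[ℝ] 𝔼) hinj).toContinuousLinearEquiv
  refine ⟨ContinuousLinearEquiv.toUnit e, ?_⟩
  ext v : 1
  rfl

theorem contDiffOn_lagrangian {U : Set 𝔼} {A : 𝔼 → (𝔼 →L[ℝ] 𝔼)} (hA : ContDiffOn ℝ 1 A U) :
    ContDiffOn ℝ 1 (fun z : 𝔼 × 𝔼 ↦ ⟪A z.1 z.2, z.2⟫) (U ×ˢ univ) := by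
  have h1 : ContDiffOn ℝ 1 (fun z : 𝔼 × 𝔼 ↦ A z.1) (U ×ˢ univ) :=
    hA.comp contDiffOn_fst fun z hz ↦ hz.1
  exact (h1.clm_apply contDiffOn_snd).inner ℝ contDiffOn_snd

theorem fderiv_lagrangian_snd {U : Set 𝔼} {A : 𝔼 → (𝔼 →L[ℝ] 𝔼)} (hU : IsOpen U) (hA : ContDiffOn ℝ 1 A U)
    (hsymm : ∀ y ∈ U, ∀ v w, ⟪A y v, w⟫ = ⟪A y w, v⟫) {y : 𝔼} (hy : y ∈ U) (v w : 𝔼) :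
    fderiv ℝ (fun z : 𝔼 × 𝔼 ↦ ⟪A z.1 z.2, z.2⟫) (y, v) (0, w) = 2 * ⟪A y v, w⟫ := by
  have h1 : HasFDerivAt (fun z : 𝔼 × 𝔼 ↦ ⟪A z.1 z.2, z.2⟫)
      (fderiv ℝ (fun z : 𝔼 × 𝔼 ↦ ⟪A z.1 z.2, z.2⟫) (y, v)) (y, v) :=
    (((contDiffOn_lagrangian hA).contDiffAt ((hU.prod isOpen_univ).mem_nhds
      ⟨hy, mem_univ _⟩)).differentiableAt one_ne_zero).hasFDerivAt
  have h2 : HasDerivAt (fun s : ℝ ↦ v + s • w) w 0 := by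
    have := ((hasDerivAt_id (0 : ℝ)).smul_const w).const_add v
    rwa [one_smul] at this
  have h3 : HasDerivAt (fun s : ℝ ↦ ((y, v + s • w) : 𝔼 × 𝔼)) (0, w) 0 :=
    (hasDerivAt_const _ _).prodMk h2
  have h4 := HasFDerivAt.comp_hasDerivAt_of_eq (0 : ℝ) h1 h3 (by simp)
  have h5 : HasDerivAt (fun s : ℝ ↦ ⟪A y (v + s • w), v + s • w⟫) (⟪A y v, w⟫ + ⟪A y w, v⟫) 0 := by
    have := ((A y).hasFDerivAt.comp_hasDerivAt (0 : ℝ) h2).inner ℝ h2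
    simpa using this
  rw [h4.unique h5, hsymm y hy w v]
  ring

/-- The integrated Euler–Lagrange equation: the du Bois-Reymond lemma with `p` the momentum and `q`
the force in the direction `w`. No derivative of the velocity is needed. -/
theorem exists_ae_fderiv_eq_const_add_integral {U : Set 𝔼} (hU : IsOpen U) {L : 𝔼 × 𝔼 → ℝ}
    (hL : ContDiffOn ℝ 1 L (U ×ˢ univ)) {a b : ℝ} (hab : a < b) {x₀ : 𝔼} {u : ℝ → 𝔼} {C : ℝ}
    (hu : Measurable u) (huC : ∀ t, ‖u t‖ ≤ C) (hx : ∀ t ∈ Icc a b, x₀ + ∫ s in a..t, u s ∈ U)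
    (hmin : ∀ u' : ℝ → 𝔼, Measurable u' → (∃ C', ∀ t, ‖u' t‖ ≤ C') →
      ∫ t in a..b, u' t = ∫ t in a..b, u t → (∀ t ∈ Icc a b, x₀ + ∫ s in a..t, u' s ∈ U) →
      ∫ t in a..b, L (x₀ + ∫ s in a..t, u s, u t) ≤ ∫ t in a..b, L (x₀ + ∫ s in a..t, u' s, u' t))
    (w : 𝔼) :
    ∃ c : ℝ, ∀ᵐ t, t ∈ Icc a b → fderiv ℝ L (x₀ + ∫ s in a..t, u s, u t) (0, w) =
      c + ∫ s in a..t, fderiv ℝ L (x₀ + ∫ r in a..s, u r, u s) (w, 0) := by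
  have hO : IsOpen (U ×ˢ (univ : Set 𝔼)) := hU.prod isOpen_univ
  have hui : ∀ c d, IntervalIntegrable u volume c d := fun c d ↦ by
    rcases le_total c d with h | h
    · exact intervalIntegrable_of_measurable_of_norm_le h hu fun t _ ↦ huC t
    · exact (intervalIntegrable_of_measurable_of_norm_le h hu fun t _ ↦ huC t).symm
  have hvar := fun (η : ℝ → ℝ) (D : ℝ) (h1 : Measurable η) (h2 : ∀ t, |η t| ≤ D) h3 ↦
    integral_fderiv_variation_eq_zero hU hL hab.le hu huC hx hmin w h1 h2 h3
  set x : ℝ → 𝔼 := fun t ↦ x₀ + ∫ s in a..t, u s with hxdef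
  have hxc : Continuous x := continuous_const.add (intervalIntegral.continuous_primitive hui a)
  have hz : Measurable fun t ↦ ((x t, u t) : 𝔼 × 𝔼) := hxc.measurable.prodMk hu
  obtain ⟨B, hB⟩ := ((isCompact_Icc.image hxc).prod
    (isCompact_closedBall (0 : 𝔼) C)).exists_bound_of_continuousOn
    ((hL.continuousOn_fderiv_of_isOpen hO le_rfl).mono (by
      rintro ⟨y, v⟩ ⟨⟨t, ht, rfl⟩, -⟩
      exact ⟨hx t ht, mem_univ _⟩))
  have hB' : ∀ t ∈ Icc a b, ∀ d : 𝔼 × 𝔼, |fderiv ℝ L (x t, u t) d| ≤ B * ‖d‖ := by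
    intro t ht d
    refine ((fderiv ℝ L (x t, u t)).le_opNorm d).trans ?_
    gcongr
    exact hB _ ⟨mem_image_of_mem _ ht, by simpa using huC t⟩
  have hm : ∀ d : 𝔼 × 𝔼, Measurable fun t ↦ fderiv ℝ L (x t, u t) d := fun d ↦
    (measurable_fderiv_apply_const ℝ L d).comp hz
  refine exists_ae_eq_const_add_integral hab (C := B * ‖w‖) (hm (0, w)) (hm (w, 0))
    (fun t ht ↦ (hB' t ht _).trans_eq (by simp [Prod.norm_def]))
    (fun t ht ↦ (hB' t ht _).trans_eq (by simp [Prod.norm_def])) ?_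
  intro η D hη hηD hη0
  rw [← hvar η D hη hηD hη0]
  refine intervalIntegral.integral_congr fun t ht ↦ ?_
  rw [← smul_eq_mul, ← smul_eq_mul, ← map_smul, ← map_smul, ← map_add]
  simp

end Regularity

section Regularity

variable {n : ℕ}

local notation "𝔼" => EuclideanSpace ℝ (Fin n)

/-- The momentum `2 A(x) u` agrees almost everywhere with an integral `Z`, and `A(x)` is invertible,
so `u` agrees almost everywhere with the continuous function `v = A(x)⁻¹ (Z / 2)`. Then `x` is
`C^1`, the force is continuous, `Z` is `C^1`, and therefore `v` is `C^1`. -/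
theorem exists_contDiffOn_of_isMinimizer {U : Set 𝔼} {A : 𝔼 → (𝔼 →L[ℝ] 𝔼)}
    (hU : IsOpen U) (hA : ContDiffOn ℝ 1 A U)
    (hsymm : ∀ y ∈ U, ∀ v w, ⟪A y v, w⟫ = ⟪A y w, v⟫)
    (hpos : ∀ y ∈ U, ∀ v, v ≠ 0 → 0 < ⟪A y v, v⟫) {a b : ℝ} (hab : a < b) {x u : ℝ → 𝔼} {C : ℝ}
    (hu : Measurable u) (huC : ∀ t, ‖u t‖ ≤ C) (hxu : ∀ t ∈ Icc a b, x t = x a + ∫ s in a..t, u s)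
    (hx : ∀ t ∈ Icc a b, x t ∈ U)
    (hmin : ∀ u' : ℝ → 𝔼, Measurable u' → (∃ C', ∀ t, ‖u' t‖ ≤ C') →
      ∫ t in a..b, u' t = ∫ t in a..b, u t → (∀ t ∈ Icc a b, x a + ∫ s in a..t, u' s ∈ U) →
      ∫ t in a..b, ⟪A (x t) (u t), u t⟫ ≤
        ∫ t in a..b, ⟪A (x a + ∫ s in a..t, u' s) (u' t), u' t⟫) :
    ∃ v : ℝ → 𝔼, ContDiffOn ℝ 1 v (Ioo a b) ∧ (∀ t ∈ Ioo a b, HasDerivAt x (v t) t) ∧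
      ∀ t ∈ Ioo a b, ∀ w, HasDerivAt (fun s ↦ 2 * ⟪A (x s) (v s), w⟫)
        (fderiv ℝ (fun z : 𝔼 × 𝔼 ↦ ⟪A z.1 z.2, z.2⟫) (x t, v t) (w, 0)) t := by
  have hL := contDiffOn_lagrangian hA
  have hLs := fun (y : 𝔼) (hy : y ∈ U) v w ↦ fderiv_lagrangian_snd hU hA hsymm hy v w
  have hO : IsOpen (U ×ˢ (univ : Set 𝔼)) := hU.prod isOpen_univ
  have hmom : ∀ w : 𝔼, ∃ c : ℝ, ∀ᵐ t, t ∈ Icc a b →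
      fderiv ℝ (fun z : 𝔼 × 𝔼 ↦ ⟪A z.1 z.2, z.2⟫) (x a + ∫ s in a..t, u s, u t) (0, w) =
      c + ∫ s in a..t, fderiv ℝ (fun z : 𝔼 × 𝔼 ↦ ⟪A z.1 z.2, z.2⟫)
        (x a + ∫ r in a..s, u r, u s) (w, 0) := by
    refine fun w ↦ exists_ae_fderiv_eq_const_add_integral hU hL hab hu huC
      (fun t ht ↦ hxu t ht ▸ hx t ht) (fun u' h1 h2 h3 h4 ↦ ?_) w
    refine le_trans (le_of_eq ?_) (hmin u' h1 h2 h3 h4)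
    refine intervalIntegral.integral_congr fun t ht ↦ ?_
    rw [uIcc_of_le hab.le] at ht
    simp only [← hxu t ht]
  generalize (fun z : 𝔼 × 𝔼 ↦ (⟪A z.1 z.2, z.2⟫ : ℝ)) = L at hL hLs hmom ⊢
  have hui : ∀ c d, IntervalIntegrable u volume c d := fun c d ↦ by
    rcases le_total c d with h | h
    · exact intervalIntegrable_of_measurable_of_norm_le h hu fun t _ ↦ huC t
    · exact (intervalIntegrable_of_measurable_of_norm_le h hu fun t _ ↦ huC t).symm
  have hx'c : Continuous fun t ↦ x a + ∫ s in a..t, u s :=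
    continuous_const.add (intervalIntegral.continuous_primitive hui a)
  have hxc : ContinuousOn x (Icc a b) := hx'c.continuousOn.congr hxu
  have hdL : ContinuousOn (fderiv ℝ L) (U ×ˢ univ) := hL.continuousOn_fderiv_of_isOpen hO le_rfl
  have hmom' : ∀ w : 𝔼, ∃ c : ℝ, ∀ᵐ t, t ∈ Icc a b → 2 * ⟪A (x t) (u t), w⟫ =
      c + ∫ s in a..t, fderiv ℝ L (x s, u s) (w, 0) := by
    intro w
    obtain ⟨c, hc⟩ := hmom w
    refine ⟨c, ?_⟩
    filter_upwards [hc] with t h1 ht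
    rw [← hLs _ (hx t ht), hxu t ht, h1 ht]
    congr 1
    refine intervalIntegral.integral_congr fun s hs ↦ ?_
    rw [uIcc_of_le ht.1] at hs
    simp only [← hxu s ⟨hs.1, hs.2.trans ht.2⟩]
  choose c hc using fun i : Fin n ↦ hmom' (EuclideanSpace.single i (1 : ℝ))
  have hunit : ∀ t ∈ Icc a b, IsUnit (A (x t)) := fun t ht ↦ isUnit_of_inner_pos (hpos _ (hx t ht))
  obtain ⟨Z, hZ⟩ : ∃ Z : ℝ → 𝔼, ∀ t, Z t = ∑ i, (c i + ∫ s in a..t,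
    fderiv ℝ L (x s, u s) (EuclideanSpace.single i (1 : ℝ), 0)) •
      EuclideanSpace.single i (1 : ℝ) := ⟨_, fun _ ↦ rfl⟩
  -- `Ring.inverse` is total and smooth at units, so the regularity of `v` follows from that of `A`,
  -- `x` and `Z`.
  obtain ⟨v, hv⟩ : ∃ v : ℝ → 𝔼, ∀ t, v t = Ring.inverse (A (x t)) ((1 / 2 : ℝ) • Z t) :=
    ⟨_, fun _ ↦ rfl⟩
  have hAv : ∀ t ∈ Icc a b, A (x t) (v t) = (1 / 2 : ℝ) • Z t := by
    intro t ht
    have := Ring.mul_inverse_cancel _ (hunit t ht)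
    rw [hv]
    exact congrArg (fun T : 𝔼 →L[ℝ] 𝔼 ↦ T ((1 / 2 : ℝ) • Z t)) this
  have huv : ∀ᵐ t, t ∈ Icc a b → u t = v t := by
    filter_upwards [ae_all_iff.2 hc] with t h1 ht
    have h2 : (2 : ℝ) • A (x t) (u t) = Z t := by
      rw [← (EuclideanSpace.basisFun (Fin n) ℝ).sum_repr (A (x t) (u t)), Finset.smul_sum, hZ]
      refine Finset.sum_congr rfl fun i _ ↦ ?_
      rw [← h1 i ht, smul_smul, EuclideanSpace.inner_single_right]
      simp
    have h3 : (1 / 2 : ℝ) • Z t = A (x t) (u t) := by rw [← h2, smul_smul]; norm_num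
    have := Ring.inverse_mul_cancel _ (hunit t ht)
    rw [hv, h3]
    exact (congrArg (fun T : 𝔼 →L[ℝ] 𝔼 ↦ T (u t)) this).symm
  -- replace `u` by `v` under the integral sign
  have hint : ∀ {V : Type} [NormedAddCommGroup V] [NormedSpace ℝ V] (F : ℝ → 𝔼 → V),
      ∀ t ∈ Icc a b, ∫ s in a..t, F s (u s) = ∫ s in a..t, F s (v s) := by
    intro V _ _ F t ht
    refine intervalIntegral.integral_congr_ae ?_
    filter_upwards [huv] with s h1 hs
    rw [uIoc_of_le ht.1] at hs
    rw [h1 ⟨hs.1.le, hs.2.trans ht.2⟩]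
  have hZbound : ∀ i : Fin n, IntervalIntegrable
      (fun s ↦ fderiv ℝ L (x s, u s) (EuclideanSpace.single i (1 : ℝ), 0)) volume a b := by
    intro i
    obtain ⟨B, hB⟩ := ((isCompact_Icc.image_of_continuousOn hxc).prod
      (isCompact_closedBall (0 : 𝔼) C)).exists_bound_of_continuousOn (hdL.mono (by
        rintro ⟨y, v⟩ ⟨⟨t, ht, rfl⟩, -⟩
        exact ⟨hx t ht, mem_univ _⟩))
    have h1 := intervalIntegrable_of_measurable_of_norm_le (C := B * 1) hab.le
      ((measurable_fderiv_apply_const ℝ L (EuclideanSpace.single i (1 : ℝ), 0)).comp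
        (hx'c.measurable.prodMk hu)) (by
        intro t ht
        refine ((fderiv ℝ L (x a + ∫ s in a..t, u s, u t)).le_opNorm _).trans ?_
        gcongr
        · exact (norm_nonneg _).trans (hB (x a, u a) ⟨mem_image_of_mem _ ⟨le_rfl, hab.le⟩,
            by simpa using huC a⟩)
        · rw [← hxu t ht]
          exact hB _ ⟨mem_image_of_mem _ ht, by simpa using huC t⟩
        · simp [Prod.norm_def])
    refine h1.congr ?_
    intro t ht
    rw [uIoc_of_le hab.le] at ht
    simp only [Function.comp_apply, ← hxu t (Ioc_subset_Icc_self ht)]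
  have hZc : ContinuousOn Z (Icc a b) := by
    rw [funext hZ]
    refine continuousOn_finsetSum _ fun i _ ↦ ContinuousOn.fun_smul ?_ continuousOn_const
    refine continuousOn_const.add ?_
    have := intervalIntegral.continuousOn_primitive_interval' (hZbound i) left_mem_uIcc
    rwa [uIcc_of_le hab.le] at this
  have hIc : ContinuousOn (fun t ↦ Ring.inverse (A (x t))) (Icc a b) := by
    intro t ht
    have h1 : ContinuousAt (Ring.inverse : (𝔼 →L[ℝ] 𝔼) → _) (A (x t)) :=
      (contDiffAt_ringInverse ℝ (hunit t ht).unit (n := 1)).continuousAt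
    exact h1.comp_continuousWithinAt (f := fun t ↦ A (x t)) (hA.continuousOn.comp hxc hx t ht)
  have hvc : ContinuousOn v (Icc a b) := by
    rw [funext hv]
    exact hIc.clm_apply (continuousOn_const.fun_smul hZc)
  -- With `u` replaced by its continuous representative under the integral, the fundamental theorem
  -- of calculus holds at every time and not only almost everywhere.
  have hxd : ∀ t ∈ Ioo a b, HasDerivAt x (v t) t := fun t ht ↦
    hasDerivAt_of_eq_add_integral (F₀ := x a) hvc
      (fun s hs ↦ by rw [hxu s hs, hint (fun _ y ↦ y) s hs]) ht
  have hrc : ∀ i : Fin n, ContinuousOn (fun s ↦ fderiv ℝ L (x s, v s)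
      (EuclideanSpace.single i (1 : ℝ), 0)) (Icc a b) := fun i ↦
    (hdL.comp (hxc.prodMk hvc) fun t ht ↦ ⟨hx t ht, mem_univ _⟩).clm_apply continuousOn_const
  have hZd : ∀ t ∈ Ioo a b, HasDerivAt Z (∑ i, fderiv ℝ L (x t, v t)
      (EuclideanSpace.single i (1 : ℝ), 0) • EuclideanSpace.single i (1 : ℝ)) t := by
    intro t ht
    rw [funext hZ]
    refine HasDerivAt.fun_sum fun i _ ↦ HasDerivAt.smul_const ?_ _
    exact hasDerivAt_of_eq_add_integral (F₀ := c i) (hrc i) (fun s hs ↦ by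
      rw [hint (fun s y ↦ fderiv ℝ L (x s, y) (EuclideanSpace.single i (1 : ℝ), 0)) s hs]) ht
  have hx1 : ContDiffOn ℝ 1 x (Ioo a b) :=
    contDiffOn_one_of_hasDerivAt (k := 0) isOpen_Ioo hxd
      (contDiffOn_zero.2 (hvc.mono Ioo_subset_Icc_self))
  have hZ1 : ContDiffOn ℝ 1 Z (Ioo a b) := by
    refine contDiffOn_one_of_hasDerivAt (k := 0) isOpen_Ioo hZd (contDiffOn_zero.2 ?_)
    exact continuousOn_finsetSum _ fun i _ ↦
      ((hrc i).mono Ioo_subset_Icc_self).smul continuousOn_const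
  refine ⟨v, ?_, hxd, ?_⟩
  · rw [funext hv]
    refine ContDiffOn.clm_apply ?_ (contDiffOn_const.fun_smul hZ1)
    intro t ht
    have h1 : ContDiffAt ℝ 1 (Ring.inverse : (𝔼 →L[ℝ] 𝔼) → _) (A (x t)) :=
      contDiffAt_ringInverse ℝ (hunit t (Ioo_subset_Icc_self ht)).unit
    exact h1.comp_contDiffWithinAt t
      (hA.comp hx1 (fun s hs ↦ hx s (Ioo_subset_Icc_self hs)) t ht)
  · intro t ht w
    have h1 : HasDerivAt (fun s ↦ (⟪Z s, w⟫ : ℝ)) _ t := (hZd t ht).inner ℝ (hasDerivAt_const t w)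
    have h2 : HasDerivAt (fun s ↦ 2 * (⟪A (x s) (v s), w⟫ : ℝ)) _ t :=
      h1.congr_of_eventuallyEq (by
        filter_upwards [Icc_mem_nhds ht.1 ht.2] with s hs
        rw [hAv s hs, inner_smul_left]
        simp)
    convert h2 using 1
    rw [inner_zero_right, zero_add, sum_inner]
    have h3 : (w, (0 : 𝔼)) = ∑ i, w i • ((EuclideanSpace.single i (1 : ℝ), 0) : 𝔼 × 𝔼) := by
      refine Prod.ext ?_ ?_
      · rw [Prod.fst_sum]
        conv_lhs => rw [← (EuclideanSpace.basisFun (Fin n) ℝ).sum_repr w]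
        simp
      · rw [Prod.snd_sum]; simp
    rw [h3, map_sum]
    refine Finset.sum_congr rfl fun i _ ↦ ?_
    rw [map_smul, inner_smul_left, EuclideanSpace.inner_single_left]
    simp [mul_comm]

end Regularity

/-! ### The geodesic equation with lowered index. -/

namespace C1RiemannianMetric

variable {n : ℕ} {M : Type*} [TopologicalSpace M] [ChartedSpace (EuclideanSpace ℝ (Fin n)) M]
  [IsManifold (𝓡 n) ∞ M]

local notation "𝔼" => EuclideanSpace ℝ (Fin n)

/-- The geodesic equation with lowered index, for a curve at `y` with velocity `v` and
acceleration `a`, tested against `w`. -/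
noncomputable def geodesicForm (g : C1RiemannianMetric n M) (e : OpenPartialHomeomorph M 𝔼)
    (y v a w : 𝔼) : ℝ :=
  g.chartForm e y a w + fderiv ℝ (fun z ↦ g.chartForm e z v w) y v -
    1 / 2 * fderiv ℝ (fun z ↦ g.chartForm e z v v) y w

theorem differentiableAt_chartForm (g : C1RiemannianMetric n M) {e : OpenPartialHomeomorph M 𝔼}
    (he : e ∈ IsManifold.maximalAtlas (𝓡 n) ∞ M) {y : 𝔼} (hy : y ∈ e.target) (v w : 𝔼) :
    DifferentiableAt ℝ (fun z ↦ g.chartForm e z v w) y :=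
  ((g.contDiffOn_chartForm he v w).contDiffAt (e.open_target.mem_nhds hy)).differentiableAt
    one_ne_zero

theorem fderiv_chartForm (g : C1RiemannianMetric n M) {e : OpenPartialHomeomorph M 𝔼}
    (he : e ∈ IsManifold.maximalAtlas (𝓡 n) ∞ M) {y : 𝔼} (hy : y ∈ e.target) (v w u : 𝔼) :
    fderiv ℝ (fun z ↦ g.chartForm e z v w) y u = ⟪fderiv ℝ (g.gram e) y u v, w⟫ := by
  have h1 : HasFDerivAt (g.gram e) (fderiv ℝ (g.gram e) y) y :=
    (((g.contDiffOn_gram he).contDiffAt (e.open_target.mem_nhds hy)).differentiableAt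
      one_ne_zero).hasFDerivAt
  have h2 : HasDerivAt (fun s : ℝ ↦ y + s • u) u 0 := by
    have := ((hasDerivAt_id (0 : ℝ)).smul_const u).const_add y
    rwa [one_smul] at this
  have h3 := HasFDerivAt.comp_hasDerivAt_of_eq (0 : ℝ) h1 h2 (by simp)
  have h4 := (h3.clm_apply (hasDerivAt_const (0 : ℝ) v)).inner ℝ (hasDerivAt_const (0 : ℝ) w)
  have h5 := HasFDerivAt.comp_hasDerivAt_of_eq (0 : ℝ)
    (g.differentiableAt_chartForm he hy v w).hasFDerivAt h2 (by simp)
  have h6 : (fun z ↦ g.chartForm e z v w) ∘ (fun s : ℝ ↦ y + s • u) =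
      fun s ↦ ⟪(g.gram e ∘ fun s : ℝ ↦ y + s • u) s v, w⟫ :=
    funext fun s ↦ g.chartForm_eq_inner e _ v w
  rw [h6] at h5
  rw [h5.unique h4]
  simp

theorem hasDerivAt_chartForm (g : C1RiemannianMetric n M) {e : OpenPartialHomeomorph M 𝔼}
    (he : e ∈ IsManifold.maximalAtlas (𝓡 n) ∞ M) {x p q : ℝ → 𝔼} {x' p' q' : 𝔼} {t : ℝ}
    (ht : x t ∈ e.target) (hx : HasDerivAt x x' t) (hp : HasDerivAt p p' t)
    (hq : HasDerivAt q q' t) :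
    HasDerivAt (fun s ↦ g.chartForm e (x s) (p s) (q s))
      (g.chartForm e (x t) p' (q t) + g.chartForm e (x t) (p t) q' +
        fderiv ℝ (fun z ↦ g.chartForm e z (p t) (q t)) (x t) x') t := by
  have h1 : HasFDerivAt (g.gram e) (fderiv ℝ (g.gram e) (x t)) (x t) :=
    (((g.contDiffOn_gram he).contDiffAt (e.open_target.mem_nhds ht)).differentiableAt
      one_ne_zero).hasFDerivAt
  have h4 := ((h1.comp_hasDerivAt t hx).clm_apply hp).inner ℝ hq
  rw [g.fderiv_chartForm he ht]
  simp only [chartForm_eq_inner]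
  refine h4.congr_deriv ?_
  simp only [Function.comp_apply]
  rw [inner_add_left]
  ring

theorem chartForm_smul_right (g : C1RiemannianMetric n M) (e : OpenPartialHomeomorph M 𝔼)
    (c : ℝ) (y v w : 𝔼) : g.chartForm e y v (c • w) = c * g.chartForm e y v w := by
  simp only [chartForm_eq_inner, real_inner_smul_right]

theorem chartForm_sum (g : C1RiemannianMetric n M) (e : OpenPartialHomeomorph M 𝔼) (y v w : 𝔼) :
    g.chartForm e y v w = ∑ i, ∑ j, v i * w j * g.coeff e i j y := by
  have h : ∀ u : 𝔼, u = ∑ i, u i • EuclideanSpace.single i (1 : ℝ) := fun u ↦ by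
    conv_lhs => rw [← (EuclideanSpace.basisFun (Fin n) ℝ).sum_repr u]
    simp
  conv_lhs => rw [chartForm_eq_inner, h v, h w]
  simp only [coeff_eq_chartForm, chartForm_eq_inner, map_sum, map_smul, sum_inner, inner_sum,
    real_inner_smul_left, real_inner_smul_right]
  rw [Finset.sum_comm]
  refine Finset.sum_congr rfl fun i _ ↦ Finset.sum_congr rfl fun j _ ↦ by ring

theorem fderiv_chartForm_sum (g : C1RiemannianMetric n M) {e : OpenPartialHomeomorph M 𝔼}
    (he : e ∈ IsManifold.maximalAtlas (𝓡 n) ∞ M) {y : 𝔼} (hy : y ∈ e.target) (v w u : 𝔼) :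
    fderiv ℝ (fun z ↦ g.chartForm e z v w) y u =
      ∑ j, ∑ i, ∑ l, u l * (v i * w j * g.partialCoeff e l i j y) := by
  have h : ∀ u : 𝔼, u = ∑ i, u i • EuclideanSpace.single i (1 : ℝ) := fun u ↦ by
    conv_lhs => rw [← (EuclideanSpace.basisFun (Fin n) ℝ).sum_repr u]
    simp
  have h1 : ∀ l i j, g.partialCoeff e l i j y = ⟪fderiv ℝ (g.gram e) y
      (EuclideanSpace.single l (1 : ℝ)) (EuclideanSpace.single i (1 : ℝ)),
      EuclideanSpace.single j (1 : ℝ)⟫ := fun l i j ↦ g.fderiv_chartForm he hy _ _ _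
  rw [g.fderiv_chartForm he hy]
  simp only [h1]
  conv_lhs => rw [h u, h v, h w]
  simp only [map_sum, map_smul, _root_.sum_apply, smul_apply, sum_inner, inner_sum,
    real_inner_smul_left, real_inner_smul_right, Finset.smul_sum]
  refine Finset.sum_congr rfl fun j _ ↦ Finset.sum_congr rfl fun i _ ↦
    Finset.sum_congr rfl fun l _ ↦ by ring

theorem isUnit_coeff (g : C1RiemannianMetric n M) {e : OpenPartialHomeomorph M 𝔼}
    (he : e ∈ IsManifold.maximalAtlas (𝓡 n) ∞ M) {y : 𝔼} (hy : y ∈ e.target) :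
    IsUnit (Matrix.of fun a b ↦ g.coeff e a b y) := by
  rw [← Matrix.mulVec_injective_iff_isUnit]
  rw [← Matrix.coe_mulVecLin, injective_iff_map_eq_zero]
  intro c hc
  by_contra h
  have h1 : WithLp.toLp 2 c ≠ (0 : 𝔼) := fun h' ↦ h (by simpa using h')
  have h2 := g.chartForm_pos he hy h1
  rw [chartForm_sum] at h2
  refine h2.ne' ?_
  refine Finset.sum_eq_zero fun i _ ↦ ?_
  have h3 := congrFun hc i
  simp only [Matrix.mulVecLin_apply, Matrix.mulVec, dotProduct, Matrix.of_apply,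
    Pi.zero_apply] at h3
  calc _ = c i * ∑ j, g.coeff e i j y * c j := by
        rw [Finset.mul_sum]; exact Finset.sum_congr rfl fun j _ ↦ by simp; ring
    _ = 0 := by rw [h3, mul_zero]

/-- Contraction with `v i * v j` sees only the part of `∂_j g_{il}` symmetric in `i` and `j`, which
is why one derivative along `v` splits into the first two halves of the Christoffel bracket. -/
theorem geodesicForm_single (g : C1RiemannianMetric n M) {e : OpenPartialHomeomorph M 𝔼}
    (he : e ∈ IsManifold.maximalAtlas (𝓡 n) ∞ M) {y : 𝔼} (hy : y ∈ e.target) (v a : 𝔼)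
    (l : Fin n) : g.geodesicForm e y v a (EuclideanSpace.single l (1 : ℝ)) =
      ∑ m, g.coeff e l m y * a m + ∑ i, ∑ j, 1 / 2 * (g.partialCoeff e i j l y +
        g.partialCoeff e j i l y - g.partialCoeff e l i j y) * v i * v j := by
  have h1 : ∑ i, ∑ j, v j * v i * g.partialCoeff e j i l y =
      ∑ i, ∑ j, v j * v i * g.partialCoeff e i j l y := by
    rw [Finset.sum_comm]
    exact Finset.sum_congr rfl fun i _ ↦ Finset.sum_congr rfl fun j _ ↦ by ring
  have h2 : ∑ i, ∑ j, 1 / 2 * (g.partialCoeff e i j l y +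
        g.partialCoeff e j i l y - g.partialCoeff e l i j y) * v i * v j =
      1 / 2 * ∑ i, ∑ j, v j * v i * g.partialCoeff e i j l y +
      1 / 2 * ∑ i, ∑ j, v j * v i * g.partialCoeff e j i l y -
      1 / 2 * ∑ i, ∑ j, v i * v j * g.partialCoeff e l i j y := by
    simp only [Finset.mul_sum, ← Finset.sum_add_distrib, ← Finset.sum_sub_distrib]
    exact Finset.sum_congr rfl fun i _ ↦ Finset.sum_congr rfl fun j _ ↦ by ring
  have h3 : fderiv ℝ (fun z ↦ g.chartForm e z v (EuclideanSpace.single l (1 : ℝ))) y v =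
      ∑ i, ∑ j, v j * v i * g.partialCoeff e j i l y := by
    rw [g.fderiv_chartForm_sum he hy, Finset.sum_eq_single l (by simp +contextual) (by simp)]
    simp [mul_assoc]
  have h4 : fderiv ℝ (fun z ↦ g.chartForm e z v v) y (EuclideanSpace.single l (1 : ℝ)) =
      ∑ i, ∑ j, v i * v j * g.partialCoeff e l i j y := by
    rw [g.fderiv_chartForm_sum he hy, Finset.sum_comm]
    simp
  have h5 : g.chartForm e y a (EuclideanSpace.single l (1 : ℝ)) =
      ∑ m, g.coeff e l m y * a m := by
    rw [g.chartForm_symm, g.chartForm_sum,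
      Finset.sum_eq_single l (by simp +contextual) (by simp)]
    simp [mul_comm]
  rw [geodesicForm, h3, h4, h5, h2, ← h1]
  ring

theorem geodesicForm_eq_inner (g : C1RiemannianMetric n M) {e : OpenPartialHomeomorph M 𝔼}
    (he : e ∈ IsManifold.maximalAtlas (𝓡 n) ∞ M) {y : 𝔼} (hy : y ∈ e.target) (v a w : 𝔼) :
    g.geodesicForm e y v a w = ⟪g.gram e y a, w⟫ + ⟪fderiv ℝ (g.gram e) y v v, w⟫ -
      1 / 2 * ⟪fderiv ℝ (g.gram e) y w v, v⟫ := by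
  rw [geodesicForm, g.fderiv_chartForm he hy, g.fderiv_chartForm he hy, chartForm_eq_inner]

theorem geodesicForm_add_right (g : C1RiemannianMetric n M) {e : OpenPartialHomeomorph M 𝔼}
    (he : e ∈ IsManifold.maximalAtlas (𝓡 n) ∞ M) {y : 𝔼} (hy : y ∈ e.target) (v a w w' : 𝔼) :
    g.geodesicForm e y v a (w + w') = g.geodesicForm e y v a w + g.geodesicForm e y v a w' := by
  simp only [g.geodesicForm_eq_inner he hy, map_add, inner_add_right]
  rw [add_apply, inner_add_left]
  ring

theorem geodesicForm_smul_right (g : C1RiemannianMetric n M) {e : OpenPartialHomeomorph M 𝔼}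
    (he : e ∈ IsManifold.maximalAtlas (𝓡 n) ∞ M) {y : 𝔼} (hy : y ∈ e.target) (v a w : 𝔼) (c : ℝ) :
    g.geodesicForm e y v a (c • w) = c * g.geodesicForm e y v a w := by
  simp only [g.geodesicForm_eq_inner he hy, map_smul, real_inner_smul_right]
  rw [smul_apply, real_inner_smul_left]
  ring

/-- The left side is the vector of values of `geodesicForm` on the basis multiplied by the inverse
Gram matrix; invertibility and linearity in `w` give both directions. -/
theorem forall_christoffel_iff (g : C1RiemannianMetric n M) {e : OpenPartialHomeomorph M 𝔼}
    (he : e ∈ IsManifold.maximalAtlas (𝓡 n) ∞ M) {y : 𝔼} (hy : y ∈ e.target) (v a : 𝔼) :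
    (∀ k, a k + ∑ i, ∑ j, g.christoffel e k i j y * v i * v j = 0) ↔
      ∀ w, g.geodesicForm e y v a w = 0 := by
  set G : Matrix (Fin n) (Fin n) ℝ := Matrix.of fun a b ↦ g.coeff e a b y with hG
  have hGu : IsUnit G := g.isUnit_coeff he hy
  set φ : Fin n → ℝ := fun l ↦ g.geodesicForm e y v a (EuclideanSpace.single l (1 : ℝ)) with hφ
  have key : ∀ k, a k + ∑ i, ∑ j, g.christoffel e k i j y * v i * v j = (G⁻¹.mulVec φ) k := by
    intro k
    have h1 : φ = G.mulVec a + fun l ↦ ∑ i, ∑ j, 1 / 2 * (g.partialCoeff e i j l y +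
        g.partialCoeff e j i l y - g.partialCoeff e l i j y) * v i * v j := by
      funext l
      exact g.geodesicForm_single he hy v a l
    rw [h1, Matrix.mulVec_add, Matrix.mulVec_mulVec,
      Matrix.nonsing_inv_mul _ ((Matrix.isUnit_iff_isUnit_det _).1 hGu), Matrix.one_mulVec]
    simp only [Pi.add_apply, Matrix.mulVec, dotProduct, christoffel, ← hG, Finset.mul_sum,
      Finset.sum_mul]
    congr 1
    rw [Finset.sum_comm]
    conv_rhs => rw [Finset.sum_comm]
    rw [Finset.sum_comm]
    refine Finset.sum_congr rfl fun i _ ↦ ?_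
    rw [Finset.sum_comm]
    exact Finset.sum_congr rfl fun l _ ↦ Finset.sum_congr rfl fun j _ ↦ by ring
  simp only [key]
  constructor
  · intro h
    have h1 : φ = 0 := by
      have h2 : G⁻¹.mulVec φ = 0 := funext h
      have h3 : G.mulVec (G⁻¹.mulVec φ) = φ := by
        rw [Matrix.mulVec_mulVec,
          Matrix.mul_nonsing_inv _ ((Matrix.isUnit_iff_isUnit_det _).1 hGu), Matrix.one_mulVec]
      rw [← h3, h2, Matrix.mulVec_zero]
    let f : 𝔼 →ₗ[ℝ] ℝ :=
      { toFun := g.geodesicForm e y v a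
        map_add' := fun w w' ↦ g.geodesicForm_add_right he hy v a w w'
        map_smul' := fun c w ↦ g.geodesicForm_smul_right he hy v a w c }
    intro w
    change f w = 0
    rw [← (EuclideanSpace.basisFun (Fin n) ℝ).sum_repr w, map_sum]
    refine Finset.sum_eq_zero fun i _ ↦ ?_
    rw [map_smul, EuclideanSpace.basisFun_apply]
    exact (congrArg (_ • ·) (congrFun h1 i)).trans (smul_zero _)
  · intro h k
    have : φ = 0 := funext fun l ↦ h _
    rw [this, Matrix.mulVec_zero, Pi.zero_apply]

end C1RiemannianMetric

/-! ### Invariance of the geodesic equation under changes of charts. -/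

section Transition

variable {V W : Type*} [NormedAddCommGroup V] [NormedSpace ℝ V] [NormedAddCommGroup W]
  [NormedSpace ℝ W]

theorem differentiableAt_fderiv_apply {τ : V → W} {p : V} (hτ : ContDiffAt ℝ ∞ τ p) (w : V) :
    DifferentiableAt ℝ (fun y ↦ fderiv ℝ τ y w) p :=
  ((hτ.fderiv_right (m := 1) (by norm_cast)).differentiableAt one_ne_zero).clm_apply
    (differentiableAt_const w)

theorem fderiv_fderiv_apply_comm {τ : V → W} {p : V} (hτ : ContDiffAt ℝ ∞ τ p) (u w : V) :
    fderiv ℝ (fun y ↦ fderiv ℝ τ y w) p u = fderiv ℝ (fun y ↦ fderiv ℝ τ y u) p w := by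
  have h1 : DifferentiableAt ℝ (fderiv ℝ τ) p :=
    (hτ.fderiv_right (m := 1) (by norm_cast)).differentiableAt one_ne_zero
  have h2 : ∀ u w, fderiv ℝ (fun y ↦ fderiv ℝ τ y w) p u = fderiv ℝ (fderiv ℝ τ) p u w := by
    intro u w
    rw [(h1.hasFDerivAt.clm_apply (hasFDerivAt_const w p)).fderiv]
    simp
  rw [h2, h2]
  exact hτ.isSymmSndFDerivAt (by
    rw [minSmoothness_of_isRCLikeNormedField]
    exact WithTop.coe_le_coe.2 (le_top : (2 : ℕ∞) ≤ ⊤)) u w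

end Transition

namespace C1RiemannianMetric

variable {n : ℕ} {M : Type*} [TopologicalSpace M] [ChartedSpace (EuclideanSpace ℝ (Fin n)) M]

local notation "𝔼" => EuclideanSpace ℝ (Fin n)

theorem contDiffAt_comp_of_contMDiffAt {e : OpenPartialHomeomorph M 𝔼}
    (he : e ∈ IsManifold.maximalAtlas (𝓡 n) ∞ M) {γ : ℝ → M} {t : ℝ} {k : ℕ∞}
    (hγ : ContMDiffAt 𝓘(ℝ, ℝ) (𝓡 n) k γ t) (ht : γ t ∈ e.source) : ContDiffAt ℝ k (e ∘ γ) t := by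
  rw [← contMDiffAt_iff_contDiffAt]
  exact (((contMDiffOn_of_mem_maximalAtlas he).contMDiffAt (e.open_source.mem_nhds ht)).of_le
    (mod_cast le_top)).comp t hγ

theorem contMDiffAt_symm_comp {e : OpenPartialHomeomorph M 𝔼}
    (he : e ∈ IsManifold.maximalAtlas (𝓡 n) ∞ M) {x : ℝ → 𝔼} {t : ℝ} {k : ℕ∞}
    (hx : ContDiffAt ℝ k x t) (ht : x t ∈ e.target) :
    ContMDiffAt 𝓘(ℝ, ℝ) (𝓡 n) k (e.symm ∘ x) t :=
  (((contMDiffOn_symm_of_mem_maximalAtlas he).contMDiffAt (e.open_target.mem_nhds ht)).of_le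
    (mod_cast le_top)).comp t hx.contMDiffAt

variable [IsManifold (𝓡 n) ∞ M]

theorem fderiv_chartForm_transition (g : C1RiemannianMetric n M) {e e' : OpenPartialHomeomorph M 𝔼}
    (he : e ∈ IsManifold.maximalAtlas (𝓡 n) ∞ M) (he' : e' ∈ IsManifold.maximalAtlas (𝓡 n) ∞ M)
    {p : 𝔼} (hp : p ∈ e.target) (hp' : e.symm p ∈ e'.source) (v w : 𝔼) :
    fderiv ℝ (fun z ↦ g.chartForm e z v v) p w =
      2 * g.chartForm e' (e' (e.symm p)) (fderiv ℝ (fun y ↦ fderiv ℝ (e' ∘ e.symm) y v) p w)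
        (fderiv ℝ (e' ∘ e.symm) p v) +
      fderiv ℝ (fun z ↦ g.chartForm e' z (fderiv ℝ (e' ∘ e.symm) p v)
        (fderiv ℝ (e' ∘ e.symm) p v)) (e' (e.symm p)) (fderiv ℝ (e' ∘ e.symm) p w) := by
  have hτ := contDiffAt_transition he he' hp hp'
  have hη : HasDerivAt (fun s : ℝ ↦ p + s • w) w 0 := by
    have := ((hasDerivAt_id (0 : ℝ)).smul_const w).const_add p
    rwa [one_smul] at this
  have h0 : p = p + (0 : ℝ) • w := by simp
  have h1 := HasFDerivAt.comp_hasDerivAt_of_eq (0 : ℝ)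
    (g.differentiableAt_chartForm he hp v v).hasFDerivAt hη h0
  have h2 : HasDerivAt (e' ∘ e.symm ∘ fun s : ℝ ↦ p + s • w) (fderiv ℝ (e' ∘ e.symm) p w) 0 :=
    HasFDerivAt.comp_hasDerivAt_of_eq (0 : ℝ)
      (hτ.differentiableAt (by simp)).hasFDerivAt hη h0
  have h3 : HasDerivAt ((fun y ↦ fderiv ℝ (e' ∘ e.symm) y v) ∘ fun s : ℝ ↦ p + s • w)
      (fderiv ℝ (fun y ↦ fderiv ℝ (e' ∘ e.symm) y v) p w) 0 :=
    HasFDerivAt.comp_hasDerivAt_of_eq (0 : ℝ)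
      (differentiableAt_fderiv_apply hτ v).hasFDerivAt hη h0
  have h4 := g.hasDerivAt_chartForm he' (t := (0 : ℝ)) (by simpa using e'.map_source hp') h2 h3 h3
  have h5 : (fun s : ℝ ↦ g.chartForm e (p + s • w) v v) =ᶠ[𝓝 0] fun s ↦
      g.chartForm e' ((e' ∘ e.symm ∘ fun s : ℝ ↦ p + s • w) s)
        (((fun y ↦ fderiv ℝ (e' ∘ e.symm) y v) ∘ fun s : ℝ ↦ p + s • w) s)
        (((fun y ↦ fderiv ℝ (e' ∘ e.symm) y v) ∘ fun s : ℝ ↦ p + s • w) s) := by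
    have h6 : (e.symm.trans e').source ∈ 𝓝 (p + (0 : ℝ) • w) :=
      (e.symm.trans e').open_source.mem_nhds (by simpa using ⟨hp, hp'⟩)
    filter_upwards [hη.continuousAt.preimage_mem_nhds h6] with s hs
    simp only [mem_preimage, OpenPartialHomeomorph.trans_source, mem_inter_iff,
      OpenPartialHomeomorph.symm_source] at hs
    exact g.chartForm_transition he he' hs.1 hs.2 v v
  have h7 := h1.unique (h4.congr_of_eventuallyEq h5)
  rw [h7]
  simp only [Function.comp_apply, zero_smul, add_zero]
  rw [g.chartForm_symm e' _ (fderiv ℝ (e' ∘ e.symm) p v)]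
  ring

/-- The first two terms of `geodesicForm` are the time derivative of `g(v, w)` for constant `w`. In
the other chart `w` becomes the moving vector `Dτ w`, which contributes a term in `D²τ(v, w)`; the
third term contributes `D²τ(w, v)` with the opposite sign, and the two cancel by symmetry. This
avoids the transformation law of the Christoffel symbols. -/
theorem geodesicForm_transition (g : C1RiemannianMetric n M) {e e' : OpenPartialHomeomorph M 𝔼}
    (he : e ∈ IsManifold.maximalAtlas (𝓡 n) ∞ M) (he' : e' ∈ IsManifold.maximalAtlas (𝓡 n) ∞ M)
    {x v : ℝ → 𝔼} {a a' : 𝔼} {t : ℝ} (hp : x t ∈ e.target) (hp' : e.symm (x t) ∈ e'.source)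
    (hx : HasDerivAt x (v t) t) (hv : HasDerivAt v a t)
    (hv' : HasDerivAt (fun s ↦ fderiv ℝ (e' ∘ e.symm) (x s) (v s)) a' t) (w : 𝔼) :
    g.geodesicForm e (x t) (v t) a w =
      g.geodesicForm e' (e' (e.symm (x t))) (fderiv ℝ (e' ∘ e.symm) (x t) (v t)) a'
        (fderiv ℝ (e' ∘ e.symm) (x t) w) := by
  have hτ := contDiffAt_transition he he' hp hp'
  have h2 : HasDerivAt (e' ∘ e.symm ∘ x) (fderiv ℝ (e' ∘ e.symm) (x t) (v t)) t :=
    (hτ.differentiableAt (by simp)).hasFDerivAt.comp_hasDerivAt t hx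
  have h3 : HasDerivAt (fun s ↦ fderiv ℝ (e' ∘ e.symm) (x s) w)
      (fderiv ℝ (fun y ↦ fderiv ℝ (e' ∘ e.symm) y w) (x t) (v t)) t :=
    (differentiableAt_fderiv_apply hτ w).hasFDerivAt.comp_hasDerivAt t hx
  have h4 := g.hasDerivAt_chartForm he' (by simpa using e'.map_source hp') h2 hv' h3
  have h5 := g.hasDerivAt_chartForm he hp hx hv (hasDerivAt_const t w)
  have h6 : (fun s ↦ g.chartForm e (x s) (v s) w) =ᶠ[𝓝 t] fun s ↦
      g.chartForm e' ((e' ∘ e.symm ∘ x) s) (fderiv ℝ (e' ∘ e.symm) (x s) (v s))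
        (fderiv ℝ (e' ∘ e.symm) (x s) w) := by
    have h6 : (e.symm.trans e').source ∈ 𝓝 (x t) :=
      (e.symm.trans e').open_source.mem_nhds (by simpa using ⟨hp, hp'⟩)
    filter_upwards [hx.continuousAt.preimage_mem_nhds h6] with s hs
    simp only [mem_preimage, OpenPartialHomeomorph.trans_source, mem_inter_iff,
      OpenPartialHomeomorph.symm_source] at hs
    exact g.chartForm_transition he he' hs.1 hs.2 (v s) w
  have h7 := h5.unique (h4.congr_of_eventuallyEq h6)
  have h8 : g.chartForm e (x t) (v t) 0 = 0 := by rw [chartForm_eq_inner, inner_zero_right]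
  rw [h8, add_zero] at h7
  rw [geodesicForm, h7, geodesicForm, g.fderiv_chartForm_transition he he' hp hp',
    fderiv_fderiv_apply_comm hτ w (v t),
    g.chartForm_symm e' _ (fderiv ℝ (fun y ↦ fderiv ℝ (e' ∘ e.symm) y w) (x t) (v t))]
  simp only [Function.comp_apply]
  ring

/-- The geodesic equation at the time `t`, in some chart. -/
def IsGeodesicAt (g : C1RiemannianMetric n M) (γ : ℝ → M) (t : ℝ) : Prop :=
  ContMDiffAt 𝓘(ℝ, ℝ) (𝓡 n) 2 γ t ∧ ∃ e ∈ IsManifold.maximalAtlas (𝓡 n) ∞ M, γ t ∈ e.source ∧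
    ∀ w, g.geodesicForm e (e (γ t)) (deriv (e ∘ γ) t) (deriv (deriv (e ∘ γ)) t) w = 0

theorem hasDerivAt_deriv_of_contDiffAt {V : Type*} [NormedAddCommGroup V] [NormedSpace ℝ V]
    {x : ℝ → V} {t : ℝ} (hx : ContDiffAt ℝ 2 x t) :
    (∀ᶠ s in 𝓝 t, HasDerivAt x (deriv x s) s) ∧ HasDerivAt (deriv x) (deriv (deriv x) t) t := by
  constructor
  · filter_upwards [hx.eventually (by simp)] with s hs
    exact (hs.differentiableAt (by simp)).hasDerivAt
  · have h1 : ContDiffAt ℝ 1 (deriv x) t := by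
      have := hx.fderiv_right (m := 1) (by norm_num)
      exact this.clm_apply contDiffAt_const
    exact (h1.differentiableAt (by simp)).hasDerivAt

theorem IsGeodesicAt.geodesicForm_eq_zero {g : C1RiemannianMetric n M} {γ : ℝ → M} {t : ℝ}
    (h : g.IsGeodesicAt γ t) {e' : OpenPartialHomeomorph M 𝔼}
    (he' : e' ∈ IsManifold.maximalAtlas (𝓡 n) ∞ M) (ht : γ t ∈ e'.source) (w : 𝔼) :
    g.geodesicForm e' (e' (γ t)) (deriv (e' ∘ γ) t) (deriv (deriv (e' ∘ γ)) t) w = 0 := by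
  obtain ⟨hγ, e, he, hte, h⟩ := h
  have hp : e' (γ t) ∈ e'.target := e'.map_source ht
  have hp' : e'.symm (e' (γ t)) ∈ e.source := by rwa [e'.left_inv ht]
  have hτ := contDiffAt_transition he' he hp hp'
  obtain ⟨h1, h2⟩ := hasDerivAt_deriv_of_contDiffAt (contDiffAt_comp_of_contMDiffAt he' hγ ht)
  obtain ⟨h3, h4⟩ := hasDerivAt_deriv_of_contDiffAt (contDiffAt_comp_of_contMDiffAt he hγ hte)
  have h5 : deriv (e ∘ γ) =ᶠ[𝓝 t]
      fun s ↦ fderiv ℝ (e ∘ e'.symm) (e' (γ s)) (deriv (e' ∘ γ) s) := by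
    have hc : ∀ᶠ s in 𝓝 t, γ s ∈ e.source ∩ e'.source := hγ.continuousAt.preimage_mem_nhds
      ((e.open_source.inter e'.open_source).mem_nhds ⟨hte, ht⟩)
    filter_upwards [hc.eventually_nhds, h1] with s hs hs1
    have hss := hs.self_of_nhds
    have h6 := ((contDiffAt_transition he' he (e'.map_source hss.2)
      (by rw [e'.left_inv hss.2]; exact hss.1)).differentiableAt
      (by simp)).hasFDerivAt.comp_hasDerivAt s hs1
    refine (h6.congr_of_eventuallyEq ?_).deriv
    filter_upwards [hs] with r hr
    simp [e'.left_inv hr.2]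
  have h6 := g.geodesicForm_transition he' he (x := e' ∘ γ) (v := deriv (e' ∘ γ)) hp hp'
    h1.self_of_nhds h2 (h4.congr_of_eventuallyEq h5.symm) w
  simp only [Function.comp_apply, e'.left_inv ht] at h6
  rw [h6]
  have h7 := h5.self_of_nhds
  simp only at h7
  rw [← h7]
  exact h _

/-- Reduces the equation in all charts to a pointwise condition in one chart, which depends only on
the germ of the curve and can be glued. -/
theorem isGeodesicOn_iff (g : C1RiemannianMetric n M) {γ : ℝ → M} {J : Set ℝ} (hJ : IsOpen J) :
    g.IsGeodesicOn γ J ↔ ∀ t ∈ J, g.IsGeodesicAt γ t := by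
  constructor
  · rintro ⟨h1, h2⟩ t ht
    have he : chartAt 𝔼 (γ t) ∈ IsManifold.maximalAtlas (𝓡 n) ∞ M :=
      IsManifold.chart_mem_maximalAtlas _
    refine ⟨h1.contMDiffAt (hJ.mem_nhds ht), _, he, mem_chart_source _ _, ?_⟩
    rw [← g.forall_christoffel_iff he (mem_chart_target _ _)]
    exact h2 _ he t ht (mem_chart_source _ _)
  · intro h
    refine ⟨fun t ht ↦ (h t ht).1.contMDiffWithinAt, fun e he t ht hte ↦ ?_⟩
    rw [g.forall_christoffel_iff he (e.map_source hte)]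
    exact (h t ht).geodesicForm_eq_zero he hte

theorem IsGeodesicAt.congr {g : C1RiemannianMetric n M} {γ γ' : ℝ → M} {t : ℝ}
    (h : g.IsGeodesicAt γ t) (hγ : γ' =ᶠ[𝓝 t] γ) : g.IsGeodesicAt γ' t := by
  obtain ⟨h1, e, he, hte, h⟩ := h
  have h2 : e ∘ γ' =ᶠ[𝓝 t] e ∘ γ := hγ.fun_comp e
  refine ⟨h1.congr_of_eventuallyEq hγ, e, he, by rwa [hγ.self_of_nhds], ?_⟩
  rwa [hγ.self_of_nhds, h2.deriv_eq, h2.deriv.deriv_eq]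

theorem isGeodesicAt_symm_comp (g : C1RiemannianMetric n M) {e : OpenPartialHomeomorph M 𝔼}
    (he : e ∈ IsManifold.maximalAtlas (𝓡 n) ∞ M) {x v : ℝ → 𝔼} {t : ℝ} (ht : x t ∈ e.target)
    (hx : ∀ᶠ s in 𝓝 t, HasDerivAt x (v s) s) (hv : ContDiffAt ℝ 1 v t)
    (h : ∀ w, g.geodesicForm e (x t) (v t) (deriv v t) w = 0) :
    g.IsGeodesicAt (e.symm ∘ x) t := by
  have hx2 : ContDiffAt ℝ 2 x t := by
    obtain ⟨s, hs, hs'⟩ := (hv.eventually (by simp)).and hx |>.exists_mem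
    obtain ⟨u, hu, huo, hut⟩ := _root_.mem_nhds_iff.1 hs
    have := contDiffOn_one_of_hasDerivAt (k := 1) huo (fun r hr ↦ (hs' r (hu hr)).2)
      (fun r hr ↦ (hs' r (hu hr)).1.contDiffWithinAt)
    exact (this.contDiffAt (huo.mem_nhds hut)).of_le (by norm_num)
  have hd : deriv x =ᶠ[𝓝 t] v := hx.mono fun s hs ↦ hs.deriv
  have hc : e ∘ e.symm ∘ x =ᶠ[𝓝 t] x := by
    filter_upwards [hx2.continuousAt.preimage_mem_nhds (e.open_target.mem_nhds ht)] with s hs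
    exact e.right_inv hs
  refine ⟨contMDiffAt_symm_comp he hx2 ht, e, he, e.map_target ht, ?_⟩
  rw [hc.deriv_eq, hc.deriv.deriv_eq, hd.deriv_eq, hd.self_of_nhds]
  simpa [e.right_inv ht] using h

theorem geodesicForm_neg (g : C1RiemannianMetric n M) (e : OpenPartialHomeomorph M 𝔼)
    (y v a w : 𝔼) : g.geodesicForm e y (-v) a w = g.geodesicForm e y v a w := by
  have h1 : ∀ z u, g.chartForm e z (-v) u = -g.chartForm e z v u := fun z u ↦ by
    rw [← neg_one_smul ℝ v, chartForm_smul_left, neg_one_mul]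
  have h2 : ∀ z, g.chartForm e z (-v) (-v) = g.chartForm e z v v := fun z ↦ by
    rw [h1, g.chartForm_symm, h1, neg_neg]
  simp only [geodesicForm, h2, h1]
  rw [fderiv_fun_neg, map_neg, neg_apply, neg_neg]

/-- Time reversal changes the sign of the velocity but not of the acceleration, and the equation is
quadratic in the velocity. -/
theorem IsGeodesicAt.comp_neg {g : C1RiemannianMetric n M} {γ : ℝ → M} {t : ℝ}
    (h : g.IsGeodesicAt γ (-t)) : g.IsGeodesicAt (fun s ↦ γ (-s)) t := by
  obtain ⟨h1, e, he, hte, h⟩ := h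
  refine ⟨ContMDiffAt.comp t (f := fun s : ℝ ↦ -s) h1 (contDiff_neg.contDiffAt.contMDiffAt),
    e, he, hte, ?_⟩
  have h2 : deriv (e ∘ fun s ↦ γ (-s)) = fun s ↦ -deriv (e ∘ γ) (-s) :=
    funext fun s ↦ deriv_comp_neg (f := e ∘ γ) s
  have h3 : deriv (deriv (e ∘ fun s ↦ γ (-s))) t = deriv (deriv (e ∘ γ)) (-t) := by
    rw [h2, deriv.fun_neg, deriv_comp_neg, neg_neg]
  intro w
  rw [h3, h2]
  rw [geodesicForm_neg]
  exact h w

/-- Geodesics have constant speed. -/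
theorem IsGeodesicAt.hasDerivAt_speedSq {g : C1RiemannianMetric n M} {γ : ℝ → M} {t : ℝ}
    (h : g.IsGeodesicAt γ t) : HasDerivAt (g.speedSq γ) 0 t := by
  obtain ⟨h1, e, he, hte, h⟩ := h
  have hx := contDiffAt_comp_of_contMDiffAt he h1 hte
  obtain ⟨h2, h3⟩ := hasDerivAt_deriv_of_contDiffAt hx
  have h4 := g.hasDerivAt_chartForm he (e.map_source hte) h2.self_of_nhds h3 h3
  have h5 : g.speedSq γ =ᶠ[𝓝 t] fun s ↦
      g.chartForm e ((e ∘ γ) s) (deriv (e ∘ γ) s) (deriv (e ∘ γ) s) := by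
    filter_upwards [h1.continuousAt.preimage_mem_nhds (e.open_source.mem_nhds hte),
      (contMDiffAt_iff_contMDiffAt_nhds (by simp)).1 h1] with s hs hs'
    exact g.speedSq_eq_chartForm he (hs'.mdifferentiableAt (by simp)) hs
  refine (h4.congr_of_eventuallyEq h5).congr_deriv ?_
  -- Tested against the velocity itself, the lowered equation is half the derivative of the squared
  -- speed.
  have h6 := h (deriv (e ∘ γ) t)
  rw [geodesicForm] at h6
  rw [g.chartForm_symm e _ (deriv (e ∘ γ) t)]
  simp only [Function.comp_apply] at h6 ⊢
  linarith

end C1RiemannianMetric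

/-! ### Lipschitz curves as integrals of their velocity. -/

section Lipschitz

variable {V : Type*} [NormedAddCommGroup V] [NormedSpace ℝ V] [FiniteDimensional ℝ V]

variable [MeasurableSpace V] [BorelSpace V]

theorem lipschitzWith_integral {a : ℝ} {u : ℝ → V} {C : ℝ≥0} (hu : Measurable u)
    (hC : ∀ t, ‖u t‖ ≤ C) (x₀ : V) : LipschitzWith C fun t ↦ x₀ + ∫ s in a..t, u s := by
  have : ProperSpace V := FiniteDimensional.proper ℝ V
  have hui : ∀ c d, IntervalIntegrable u volume c d := fun c d ↦ by
    rcases le_total c d with h | h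
    · exact intervalIntegrable_of_measurable_of_norm_le h hu fun t _ ↦ hC t
    · exact (intervalIntegrable_of_measurable_of_norm_le h hu fun t _ ↦ hC t).symm
  refine LipschitzWith.of_dist_le_mul fun s t ↦ ?_
  rw [dist_add_left, dist_eq_norm, intervalIntegral.integral_interval_sub_left (hui _ _) (hui _ _),
    Real.dist_eq]
  exact intervalIntegral.norm_integral_le_of_norm_le_const fun r _ ↦ hC r

/-- The difference of `x` and the integral of `u` is absolutely continuous with zero derivative
almost everywhere, hence constant. -/
theorem LipschitzOnWith.eq_add_integral {a b : ℝ} (hab : a ≤ b) {x u : ℝ → V} {K : ℝ≥0}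
    (hx : LipschitzOnWith K x (Icc a b)) (hu : Measurable u) (hK : ∀ t, ‖u t‖ ≤ K)
    (hd : ∀ᵐ t, t ∈ Ioo a b → HasDerivAt x (u t) t) :
    ∀ t ∈ Icc a b, x t = x a + ∫ s in a..t, u s := by
  have : CompleteSpace V := FiniteDimensional.complete ℝ V
  have : ProperSpace V := FiniteDimensional.proper ℝ V
  have hui := intervalIntegrable_of_measurable_of_norm_le hab hu fun t _ ↦ hK t
  have h1 : AbsolutelyContinuousOnInterval x a b :=
    LipschitzOnWith.absolutelyContinuousOnInterval (by rwa [uIcc_of_le hab])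
  have h2 : AbsolutelyContinuousOnInterval (fun t ↦ ∫ s in a..t, u s) a b := by
    have := (lipschitzWith_integral (a := a) hu hK 0).lipschitzOnWith (s := uIcc a b)
    simp only [zero_add] at this
    exact this.absolutelyContinuousOnInterval
  have h3 : ∀ᵐ t, t ∈ uIcc a b → HasDerivAt (x - fun t ↦ ∫ s in a..t, u s) 0 t := by
    have ha : ∀ᵐ t : ℝ, t ≠ a := Measure.ae_ne volume a
    have hb : ∀ᵐ t : ℝ, t ≠ b := Measure.ae_ne volume b
    filter_upwards [hd, hui.ae_hasDerivAt_integral, ha, hb] with t h1 h2 hta htb ht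
    have ht' := ht
    rw [uIcc_of_le hab] at ht'
    have := (h1 ⟨lt_of_le_of_ne ht'.1 hta.symm, lt_of_le_of_ne ht'.2 htb⟩).sub
      (h2 ht a (by simp))
    rwa [sub_self] at this
  obtain ⟨C, hC⟩ := (h1.sub h2).const_of_ae_hasDerivAt_zero h3
  rw [uIcc_of_le hab] at hC
  intro t ht
  have h1 := hC t ht
  have h2 := hC a ⟨le_rfl, hab⟩
  simp only [Pi.sub_apply, intervalIntegral.integral_same, sub_zero] at h1 h2
  rw [h2, ← h1]
  abel

/-- A Lipschitz curve is the integral of a bounded measurable velocity. -/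
theorem LipschitzOnWith.exists_eq_add_integral {a b : ℝ} (hab : a ≤ b) {x : ℝ → V} {K : ℝ≥0}
    (hx : LipschitzOnWith K x (Icc a b)) : ∃ u : ℝ → V, Measurable u ∧ (∀ t, ‖u t‖ ≤ K) ∧
      (∀ᵐ t, t ∈ Ioo a b → HasDerivAt x (u t) t) ∧
      ∀ t ∈ Icc a b, x t = x a + ∫ s in a..t, u s := by
  have : ProperSpace V := FiniteDimensional.proper ℝ V
  have : CompleteSpace V := FiniteDimensional.complete ℝ V
  have hm : Measurable ((Ioo a b).indicator (deriv x)) :=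
    (measurable_deriv x).indicator measurableSet_Ioo
  have hK : ∀ t, ‖(Ioo a b).indicator (deriv x) t‖ ≤ K := by
    intro t
    by_cases ht : t ∈ Ioo a b
    · rw [indicator_of_mem ht]
      exact norm_deriv_le_of_lipschitzOn (Icc_mem_nhds ht.1 ht.2) hx
    · rw [indicator_of_notMem ht, norm_zero]
      exact K.2
  have hd : ∀ᵐ t, t ∈ Ioo a b → HasDerivAt x ((Ioo a b).indicator (deriv x) t) t := by
    filter_upwards [hx.ae_differentiableWithinAt_of_mem_real] with t h ht
    rw [indicator_of_mem ht]
    exact ((h (Ioo_subset_Icc_self ht)).differentiableAt (Icc_mem_nhds ht.1 ht.2)).hasDerivAt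
  exact ⟨_, hm, hK, hd, hx.eq_add_integral hab hm hK hd⟩

end Lipschitz

section Quadratic

variable {n : ℕ}

local notation "𝔼" => EuclideanSpace ℝ (Fin n)

theorem intervalIntegrable_inner_apply {U : Set 𝔼} {A : 𝔼 → (𝔼 →L[ℝ] 𝔼)} (hA : ContinuousOn A U)
    {a b : ℝ} (hab : a ≤ b) {y u : ℝ → 𝔼} {C : ℝ} (hy : ContinuousOn y (Icc a b))
    (hyU : ∀ t ∈ Icc a b, y t ∈ U) (hu : Measurable u) (hC : ∀ t, ‖u t‖ ≤ C) :
    IntervalIntegrable (fun t ↦ ⟪A (y t) (u t), u t⟫) volume a b := by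
  have hAy : ContinuousOn (fun t ↦ A (y t)) (Icc a b) := hA.comp hy hyU
  obtain ⟨B, hB⟩ := isCompact_Icc.exists_bound_of_continuousOn hAy
  rw [intervalIntegrable_iff_integrableOn_Icc_of_le hab]
  have h1 : AEStronglyMeasurable (fun t ↦ A (y t)) (volume.restrict (Icc a b)) :=
    hAy.aestronglyMeasurable measurableSet_Icc
  have h2 : AEStronglyMeasurable (fun t ↦ A (y t) (u t)) (volume.restrict (Icc a b)) :=
    (isBoundedBilinearMap_apply (𝕜 := ℝ) (E := 𝔼) (F := 𝔼)).continuous.comp_aestronglyMeasurable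
      (h1.prodMk hu.aestronglyMeasurable)
  refine ⟨h2.inner hu.aestronglyMeasurable,
    HasFiniteIntegral.restrict_of_bounded (C := B * C * C) (by simp) ?_⟩
  rw [ae_restrict_iff' measurableSet_Icc]
  refine Eventually.of_forall fun t ht ↦ ?_
  have hB0 : 0 ≤ B := (norm_nonneg _).trans (hB t ht)
  have hC0 : 0 ≤ C := (norm_nonneg _).trans (hC t)
  refine (norm_inner_le_norm _ _).trans ?_
  exact mul_le_mul (((A (y t)).le_opNorm _).trans
    (mul_le_mul (hB t ht) (hC t) (norm_nonneg _) hB0)) (hC t) (norm_nonneg _) (by positivity)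

end Quadratic

/-! ### Minimizing curves are geodesics. -/

namespace C1RiemannianMetric

variable {n : ℕ} {M : Type*} [TopologicalSpace M] [ChartedSpace (EuclideanSpace ℝ (Fin n)) M]
  [IsManifold (𝓡 n) ∞ M] [ConnectedSpace M] [T2Space M]

local notation "𝔼" => EuclideanSpace ℝ (Fin n)

theorem tendsto_of_tendsto_rdist (g : C1RiemannianMetric n M) {ι : Type*} {l : Filter ι}
    {f : ι → M} {x : M} (h : Tendsto (fun i ↦ g.rdist x (f i)) l (𝓝 0)) : Tendsto f l (𝓝 x) := by
  refine tendsto_def.2 fun s hs ↦ ?_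
  obtain ⟨c, hc, hcs⟩ := g.exists_edistance_lt_subset hs
  have h1 : Tendsto (fun i ↦ ENNReal.ofReal (g.rdist x (f i))) l (𝓝 0) := by
    simpa using ENNReal.tendsto_ofReal h
  filter_upwards [h1.eventually (gt_mem_nhds hc)] with i hi
  exact hcs _ (by rwa [edistance_eq_ofReal_rdist])

/-- Coercivity of the metric at `y₀` together with the local lower bound of the distance. It makes
the coordinates of a unit speed curve Lipschitz. -/
theorem exists_ball_norm_sub_le_rdist (g : C1RiemannianMetric n M)
    {e : OpenPartialHomeomorph M 𝔼} (he : e ∈ IsManifold.maximalAtlas (𝓡 n) ∞ M) {y₀ : 𝔼}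
    (hy₀ : y₀ ∈ e.target) : ∃ K : ℝ≥0, ∃ r > 0, ∀ y ∈ ball y₀ r, ∀ z ∈ ball y₀ r,
      ‖z - y‖ ≤ K * g.rdist (e.symm y) (e.symm z) := by
  obtain ⟨r, hr, h⟩ := g.exists_ball_le_rdist he hy₀ one_lt_two
  obtain ⟨c, hc, hcoer⟩ := exists_pos_mul_norm_sq_le (A := g.gram e y₀) fun v hv ↦ by
    rw [← chartForm_eq_inner]; exact g.chartForm_pos he hy₀ hv
  refine ⟨(2 / √c).toNNReal, r, hr, fun y hy z hz ↦ ?_⟩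
  have h1 := h y hy z hz
  have h2 : √c * ‖z - y‖ ≤ √(g.chartForm e y₀ (z - y) (z - y)) := by
    rw [← Real.sqrt_sq (norm_nonneg (z - y)), ← Real.sqrt_mul hc.le, chartForm_eq_inner]
    exact Real.sqrt_le_sqrt (hcoer _)
  have hc' := Real.sqrt_pos.2 hc
  rw [Real.coe_toNNReal _ (by positivity), div_mul_eq_mul_div, le_div_iff₀ hc', mul_comm]
  exact h2.trans h1

/-- A differentiable point of a unit speed curve has velocity at most one. -/
theorem chartForm_deriv_le_one (g : C1RiemannianMetric n M) {e : OpenPartialHomeomorph M 𝔼}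
    (he : e ∈ IsManifold.maximalAtlas (𝓡 n) ∞ M) {x : ℝ → 𝔼} {u : 𝔼} {t : ℝ}
    (hx : HasDerivAt x u t) (ht : x t ∈ e.target)
    (h : ∀ᶠ s in 𝓝 t, g.rdist (e.symm (x t)) (e.symm (x s)) ≤ |s - t|) :
    g.chartForm e (x t) u u ≤ 1 := by
  have key : ∀ δ : ℝ, 1 < δ → √(g.chartForm e (x t) u u) ≤ δ := by
    intro δ hδ
    obtain ⟨r, hr, hball⟩ := g.exists_ball_le_rdist he ht hδ
    have h1 := hasDerivAt_iff_tendsto_slope.1 hx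
    have h2 : Continuous fun v ↦ √(g.chartForm e (x t) v v) := by
      simp only [chartForm_eq_inner]
      fun_prop
    refine le_of_tendsto ((h2.tendsto u).comp h1) ?_
    have h3 := (h.and (hx.continuousAt.preimage_mem_nhds (ball_mem_nhds _ hr)))
    filter_upwards [nhdsWithin_le_nhds h3, self_mem_nhdsWithin] with s hs hst
    have hst' : 0 < |s - t| := abs_pos.2 (sub_ne_zero.2 hst)
    have h4 := (hball _ (mem_ball_self hr) _ hs.2).trans
      (mul_le_mul_of_nonneg_left hs.1 (by linarith))
    simp only [Function.comp_apply, slope, vsub_eq_sub]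
    rw [chartForm_smul_left, chartForm_smul_right, ← mul_assoc, ← sq,
      Real.sqrt_mul (sq_nonneg _), Real.sqrt_sq_eq_abs, abs_inv, inv_mul_le_iff₀ hst', mul_comm]
    exact h4
  have h1 : √(g.chartForm e (x t) u u) ≤ 1 := le_of_forall_gt_imp_ge_of_dense key
  rwa [Real.sqrt_le_one] at h1

end C1RiemannianMetric

namespace C1RiemannianMetric

variable {n : ℕ} {M : Type*} [TopologicalSpace M] [ChartedSpace (EuclideanSpace ℝ (Fin n)) M]
  [IsManifold (𝓡 n) ∞ M]

local notation "𝔼" => EuclideanSpace ℝ (Fin n)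

/-- The Euler–Lagrange equation of the energy, tested against `w`, is twice `geodesicForm`. -/
theorem geodesicForm_eq_zero_of_hasDerivAt (g : C1RiemannianMetric n M)
    {e : OpenPartialHomeomorph M 𝔼} (he : e ∈ IsManifold.maximalAtlas (𝓡 n) ∞ M) {x v : ℝ → 𝔼}
    {a : 𝔼} {t : ℝ} (ht : x t ∈ e.target) (hx : HasDerivAt x (v t) t) (hv : HasDerivAt v a t)
    (w : 𝔼) (h : HasDerivAt (fun s ↦ 2 * ⟪g.gram e (x s) (v s), w⟫)
      (fderiv ℝ (fun z : 𝔼 × 𝔼 ↦ ⟪g.gram e z.1 z.2, z.2⟫) (x t, v t) (w, 0)) t) :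
    g.geodesicForm e (x t) (v t) a w = 0 := by
  have h1 := (g.hasDerivAt_chartForm he ht hx hv (hasDerivAt_const t w)).const_mul 2
  simp only [chartForm_eq_inner g e (x _)] at h1
  have h2 := h.unique h1
  have hO : e.target ×ˢ (univ : Set 𝔼) ∈ 𝓝 (x t, v t) :=
    (e.open_target.prod isOpen_univ).mem_nhds ⟨ht, mem_univ _⟩
  have h3 : HasFDerivAt (fun z : 𝔼 × 𝔼 ↦ ⟪g.gram e z.1 z.2, z.2⟫)
      (fderiv ℝ (fun z : 𝔼 × 𝔼 ↦ ⟪g.gram e z.1 z.2, z.2⟫) (x t, v t)) (x t, v t) :=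
    (((contDiffOn_lagrangian (g.contDiffOn_gram he)).contDiffAt hO).differentiableAt
      one_ne_zero).hasFDerivAt
  have h4 : HasDerivAt (fun s : ℝ ↦ x t + s • w) w 0 := by
    have := ((hasDerivAt_id (0 : ℝ)).smul_const w).const_add (x t)
    rwa [one_smul] at this
  have h5 := HasFDerivAt.comp_hasDerivAt_of_eq (0 : ℝ) h3
    (h4.prodMk (hasDerivAt_const (0 : ℝ) (v t))) (by simp)
  have h6 := HasFDerivAt.comp_hasDerivAt_of_eq (0 : ℝ)
    (g.differentiableAt_chartForm he ht (v t) (v t)).hasFDerivAt h4 (by simp)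
  have h7 : (fun z ↦ g.chartForm e z (v t) (v t)) ∘ (fun s : ℝ ↦ x t + s • w) =
      (fun z : 𝔼 × 𝔼 ↦ ⟪g.gram e z.1 z.2, z.2⟫) ∘ fun s : ℝ ↦ (x t + s • w, v t) :=
    funext fun s ↦ g.chartForm_eq_inner e _ _ _
  rw [h7] at h6
  rw [h5.unique h6] at h2
  rw [geodesicForm, h2, chartForm_eq_inner]
  simp only [inner_zero_right]
  ring

variable [ConnectedSpace M] [T2Space M]

/-- On a short interval inside one chart the curve has energy at most `b - a`, while every
competitor with the same end points has energy at least `b - a`. Regularity of minimizers then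
applies. Energy is used instead of length because it is `C^1` and nondegenerate in the velocity. -/
theorem isGeodesicAt_of_isometric (g : C1RiemannianMetric n M) {σ : ℝ → M} {J : Set ℝ} {t₀ : ℝ}
    (hJ : J ∈ 𝓝 t₀) (hσ : ∀ s ∈ J, ∀ t ∈ J, g.rdist (σ s) (σ t) = |s - t|) :
    g.IsGeodesicAt σ t₀ := by
  have ht₀ : t₀ ∈ J := mem_of_mem_nhds hJ
  set e := chartAt 𝔼 (σ t₀)
  have he : e ∈ IsManifold.maximalAtlas (𝓡 n) ∞ M := IsManifold.chart_mem_maximalAtlas _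
  have hs₀ : σ t₀ ∈ e.source := mem_chart_source _ _
  have hy₀ : e (σ t₀) ∈ e.target := e.map_source hs₀
  have hcont : Tendsto σ (𝓝 t₀) (𝓝 (σ t₀)) := by
    refine g.tendsto_of_tendsto_rdist ?_
    have h1 : Tendsto (fun s ↦ |t₀ - s|) (𝓝 t₀) (𝓝 0) := by
      have : Continuous fun s ↦ |t₀ - s| := by fun_prop
      simpa using this.tendsto t₀
    refine h1.congr' ?_
    filter_upwards [hJ] with s hs using (hσ _ ht₀ _ hs).symm
  obtain ⟨K, r, hr, hK⟩ := g.exists_ball_norm_sub_le_rdist he hy₀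
  have hxcont : Tendsto (e ∘ σ) (𝓝 t₀) (𝓝 (e (σ t₀))) :=
    (e.continuousAt hs₀).tendsto.comp hcont
  have hev : ∀ᶠ t in 𝓝 t₀, t ∈ J ∧ (e ∘ σ) t ∈ ball (e (σ t₀)) r ∧ σ t ∈ e.source := by
    filter_upwards [hJ, hxcont (ball_mem_nhds _ hr), hcont (e.open_source.mem_nhds hs₀)]
      with t h1 h2 h3 using ⟨h1, h2, h3⟩
  obtain ⟨ε, hε, hball⟩ := Metric.eventually_nhds_iff_ball.1 hev
  obtain ⟨a, ha⟩ : ∃ a, a = t₀ - ε / 2 := ⟨_, rfl⟩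
  obtain ⟨b, hb⟩ : ∃ b, b = t₀ + ε / 2 := ⟨_, rfl⟩
  have hab : a < b := by linarith
  have hI : ∀ t ∈ Icc a b, t ∈ ball t₀ ε := fun t ht ↦ by
    rw [Real.ball_eq_Ioo]
    exact ⟨by linarith [ht.1], by linarith [ht.2]⟩
  have ht₀I : t₀ ∈ Ioo a b := ⟨by linarith, by linarith⟩
  set x : ℝ → 𝔼 := e ∘ σ with hx
  have hxs : ∀ t ∈ Icc a b, e.symm (x t) = σ t := fun t ht ↦ e.left_inv (hball t (hI t ht)).2.2
  have hxU : ∀ t ∈ Icc a b, x t ∈ e.target := fun t ht ↦ e.map_source (hball t (hI t ht)).2.2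
  have hd : ∀ s ∈ Icc a b, ∀ t ∈ Icc a b,
      g.rdist (e.symm (x s)) (e.symm (x t)) = |s - t| := fun s hs t ht ↦ by
    rw [hxs s hs, hxs t ht]
    exact hσ s (hball s (hI s hs)).1 t (hball t (hI t ht)).1
  have hlip : LipschitzOnWith K x (Icc a b) := by
    refine LipschitzOnWith.of_dist_le_mul fun s hs t ht ↦ ?_
    have := hK _ (hball t (hI t ht)).2.1 _ (hball s (hI s hs)).2.1
    rw [dist_eq_norm, Real.dist_eq, abs_sub_comm, ← hd t ht s hs]
    exact this
  obtain ⟨u, hu, huK, hud, hxu⟩ := hlip.exists_eq_add_integral hab.le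
  have hgram := (g.contDiffOn_gram he)
  have hle : ∀ᵐ t, t ∈ Ioo a b → ⟪g.gram e (x t) (u t), u t⟫ ≤ 1 := by
    filter_upwards [hud] with t h1 ht
    rw [← chartForm_eq_inner]
    refine g.chartForm_deriv_le_one he (h1 ht) (hxU t (Ioo_subset_Icc_self ht)) ?_
    filter_upwards [Icc_mem_nhds ht.1 ht.2] with s hs
    rw [hd t (Ioo_subset_Icc_self ht) s hs, abs_sub_comm]
  have hxle : ∫ t in a..b, ⟪g.gram e (x t) (u t), u t⟫ ≤ b - a := by
    calc _ ≤ ∫ t in a..b, (1 : ℝ) := by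
          refine intervalIntegral.integral_mono_ae_restrict hab.le
            (intervalIntegrable_inner_apply hgram.continuousOn hab.le hlip.continuousOn hxU hu huK)
            intervalIntegrable_const ?_
          rw [← restrict_Ioo_eq_restrict_Icc, EventuallyLE, ae_restrict_iff' measurableSet_Ioo]
          exact hle
      _ = b - a := by simp
  obtain ⟨v, hv, hxv, hEL⟩ := exists_contDiffOn_of_isMinimizer e.open_target hgram
    (fun y _ v w ↦ by rw [← chartForm_eq_inner, ← chartForm_eq_inner, g.chartForm_symm])
    (fun y hy v hv ↦ by rw [← chartForm_eq_inner]; exact g.chartForm_pos he hy hv)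
    hab hu huK hxu hxU (by
      rintro u' hu' ⟨C', hC'⟩ h0 hU'
      refine hxle.trans ?_
      have hC0 : 0 ≤ C' := (norm_nonneg _).trans (hC' 0)
      lift C' to ℝ≥0 using hC0
      set y : ℝ → 𝔼 := fun t ↦ x a + ∫ s in a..t, u' s with hy
      have hylip : LipschitzWith C' y := lipschitzWith_integral hu' hC' _
      have hui : IntervalIntegrable u' volume a b :=
        intervalIntegrable_of_measurable_of_norm_le hab.le hu' fun t _ ↦ hC' t
      have hquad := intervalIntegrable_inner_apply hgram.continuousOn hab.le
        hylip.continuous.continuousOn hU' hu' hC'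
      -- The inequality `√q ≤ (1 + q) / 2` bounds length by `(b - a) / 2` plus half the energy. The
      -- absolute value makes the bound valid at all times, also where positivity of the form is
      -- unknown.
      have hsqle : ∀ t, √⟪g.gram e (y t) (u' t), u' t⟫ ≤
          1 / 2 + 1 / 2 * |⟪g.gram e (y t) (u' t), u' t⟫| := fun t ↦ by
        have h1 := Real.sqrt_le_sqrt (le_abs_self ⟪g.gram e (y t) (u' t), u' t⟫)
        have h2 := Real.sq_sqrt (abs_nonneg ⟪g.gram e (y t) (u' t), u' t⟫)
        nlinarith [sq_nonneg (√|⟪g.gram e (y t) (u' t), u' t⟫| - 1)]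
      have hsq : IntervalIntegrable (fun t ↦ √⟪g.gram e (y t) (u' t), u' t⟫) volume a b := by
        refine (intervalIntegrable_const.add (hquad.abs.const_mul (1 / 2))).mono_fun ?_ ?_
          (f := fun t ↦ 1 / 2 + 1 / 2 * |⟪g.gram e (y t) (u' t), u' t⟫|)
        · exact Real.continuous_sqrt.comp_aestronglyMeasurable hquad.aestronglyMeasurable_restrict_uIoc
        · refine Eventually.of_forall fun t ↦ ?_
          simp only [Real.norm_eq_abs]
          rw [abs_of_nonneg (Real.sqrt_nonneg _)]
          exact (hsqle t).trans (le_abs_self _)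
      have h1 := g.rdist_le_integral he hab.le (u := u') (hylip.lipschitzOnWith (s := Icc a b)) hU' (by
        filter_upwards [hui.ae_hasDerivAt_integral] with t h1 ht
        exact (h1 (by rw [uIcc_of_le hab.le]; exact Ioo_subset_Icc_self ht) a
          (by simp)).const_add _) (by simpa only [chartForm_eq_inner] using hsq)
      have hya : y a = x a := by simp [hy]
      have hyb : y b = x b := by
        rw [hxu b ⟨hab.le, le_rfl⟩, ← h0]
      rw [hya, hyb, hd a ⟨le_rfl, hab.le⟩ b ⟨hab.le, le_rfl⟩, abs_sub_comm,
        abs_of_pos (sub_pos.2 hab)] at h1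
      simp only [chartForm_eq_inner] at h1
      have h2 : ∫ t in a..b, √⟪g.gram e (y t) (u' t), u' t⟫ ≤
          ∫ t in a..b, (1 / 2 + 1 / 2 * ⟪g.gram e (y t) (u' t), u' t⟫) := by
        refine intervalIntegral.integral_mono_on hab.le hsq
          (intervalIntegrable_const.add (hquad.const_mul (1 / 2))) fun t ht ↦ ?_
        have h3 := hsqle t
        rwa [abs_of_nonneg] at h3
        rw [← chartForm_eq_inner]
        exact g.chartForm_nonneg he (hU' t ht) _
      rw [intervalIntegral.integral_add intervalIntegrable_const (hquad.const_mul (1 / 2)),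
        intervalIntegral.integral_const_mul, intervalIntegral.integral_const, smul_eq_mul] at h2
      linarith)
  have hIo : Ioo a b ∈ 𝓝 t₀ := isOpen_Ioo.mem_nhds ht₀I
  have hgeo := g.isGeodesicAt_symm_comp he (hxU t₀ (Ioo_subset_Icc_self ht₀I))
    (by filter_upwards [hIo] with s hs using hxv s hs) (hv.contDiffAt hIo) fun w ↦
      g.geodesicForm_eq_zero_of_hasDerivAt he (hxU t₀ (Ioo_subset_Icc_self ht₀I)) (hxv t₀ ht₀I)
        ((hv.contDiffAt hIo).differentiableAt one_ne_zero).hasDerivAt w (hEL t₀ ht₀I w)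
  refine hgeo.congr ?_
  filter_upwards [hIo] with s hs using (hxs s (Ioo_subset_Icc_self hs)).symm

end C1RiemannianMetric

/-! ### Peano's existence theorem by Euler polygons. -/

section Peano

variable {V : Type*} [NormedAddCommGroup V] [NormedSpace ℝ V]

/-- The Euler polygon with step `h`. -/
noncomputable def eulerPolygon (f : V → V) (z₀ : V) (h : ℝ) : ℕ → V
  | 0 => z₀
  | j + 1 => eulerPolygon f z₀ h j + h • f (eulerPolygon f z₀ h j)

theorem norm_eulerPolygon_sub_le {f : V → V} {C : ℝ} (hC : ∀ z, ‖f z‖ ≤ C) (z₀ : V) {h : ℝ}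
    (hh : 0 ≤ h) (j i : ℕ) :
    ‖eulerPolygon f z₀ h (j + i) - eulerPolygon f z₀ h j‖ ≤ C * (i * h) := by
  induction i with
  | zero => simp
  | succ i ih =>
    have h1 : eulerPolygon f z₀ h (j + (i + 1)) - eulerPolygon f z₀ h j =
        (eulerPolygon f z₀ h (j + i) - eulerPolygon f z₀ h j) +
          h • f (eulerPolygon f z₀ h (j + i)) := by
      rw [← add_assoc, eulerPolygon]; abel
    rw [h1]
    refine (norm_add_le _ _).trans ?_
    rw [norm_smul, Real.norm_of_nonneg hh]
    calc _ ≤ C * (i * h) + h * C := by gcongr; exact hC _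
      _ = _ := by push_cast; ring

/-- As long as the polygon stays within `δ` of its `j`-th vertex, each step deviates from the
tangent step there by at most `η * h`. In the limit this becomes differentiability. -/
theorem norm_eulerPolygon_sub_sub_le {f : V → V} {C : ℝ} (hC : ∀ z, ‖f z‖ ≤ C) (z₀ : V) {h : ℝ}
    (hh : 0 ≤ h) {δ η : ℝ} (hδ : ∀ z z', ‖z - z'‖ ≤ δ → ‖f z - f z'‖ ≤ η) (j i : ℕ)
    (hi : C * (i * h) ≤ δ) :
    ‖eulerPolygon f z₀ h (j + i) - eulerPolygon f z₀ h j -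
      (i * h) • f (eulerPolygon f z₀ h j)‖ ≤ η * (i * h) := by
  have hC0 : 0 ≤ C := (norm_nonneg _).trans (hC z₀)
  induction i with
  | zero => simp
  | succ i ih =>
    have h0 : C * (i * h) ≤ δ := le_trans (by gcongr; simp) hi
    have h1 : eulerPolygon f z₀ h (j + (i + 1)) - eulerPolygon f z₀ h j -
        ((i + 1 : ℕ) * h) • f (eulerPolygon f z₀ h j) =
        (eulerPolygon f z₀ h (j + i) - eulerPolygon f z₀ h j -
          (i * h) • f (eulerPolygon f z₀ h j)) +
          h • (f (eulerPolygon f z₀ h (j + i)) - f (eulerPolygon f z₀ h j)) := by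
      rw [← add_assoc, eulerPolygon]; push_cast; module
    rw [h1]
    refine (norm_add_le _ _).trans ?_
    rw [norm_smul, Real.norm_of_nonneg hh]
    have h2 := hδ _ _ ((norm_eulerPolygon_sub_le hC z₀ hh j i).trans h0)
    calc _ ≤ η * (i * h) + h * η := by gcongr; exact ih h0
      _ = _ := by push_cast; ring

/-- Peano's theorem for a bounded uniformly continuous vector field. -/
theorem exists_hasDerivAt_of_uniformContinuous [ProperSpace V] {f : V → V}
    (hf : UniformContinuous f) {C : ℝ} (hC : ∀ z, ‖f z‖ ≤ C) (z₀ : V) :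
    ∃ z : ℝ → V, z 0 = z₀ ∧ ContinuousOn z (Ici 0) ∧ ∀ t > 0, HasDerivAt z (f (z t)) t := by
  have hC0 : 0 ≤ C := (norm_nonneg _).trans (hC z₀)
  -- Step `1 / k`, read off at the last vertex before time `t` without interpolation. The jumps
  -- disappear in the limit, and an ultrafilter limit at each time replaces Arzelà–Ascoli.
  let Z : ℕ → ℝ → V := fun k t ↦ eulerPolygon f z₀ ((k : ℝ)⁻¹) ⌊t * k⌋₊
  let 𝓕 : Filter ℕ := (hyperfilter ℕ : Ultrafilter ℕ)
  have h𝓕 : 𝓕 ≤ atTop := by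
    rw [← Nat.cofinite_eq_atTop]; exact hyperfilter_le_cofinite
  have hfloor : ∀ t : ℝ, 0 ≤ t → Tendsto (fun k : ℕ ↦ (⌊t * k⌋₊ : ℝ) * (k : ℝ)⁻¹) 𝓕 (𝓝 t) := by
    intro t ht
    have := (tendsto_nat_floor_mul_div_atTop ht).comp (tendsto_natCast_atTop_atTop (R := ℝ))
    simpa only [div_eq_mul_inv, Function.comp_def] using this.mono_left h𝓕
  have hstep : ∀ s t : ℝ, s ≤ t → ∀ k : ℕ,
      ⌊s * k⌋₊ + (⌊t * k⌋₊ - ⌊s * k⌋₊) = ⌊t * k⌋₊ := fun s t hst k ↦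
    Nat.add_sub_cancel' (Nat.floor_mono (by gcongr))
  have hstep' : ∀ s t : ℝ, 0 ≤ s → s ≤ t → Tendsto
      (fun k : ℕ ↦ ((⌊t * k⌋₊ - ⌊s * k⌋₊ : ℕ) : ℝ) * (k : ℝ)⁻¹) 𝓕 (𝓝 (t - s)) := by
    intro s t hs hst
    refine ((hfloor t (hs.trans hst)).sub (hfloor s hs)).congr fun k ↦ ?_
    rw [Nat.cast_sub (Nat.floor_mono (by gcongr))]
    ring
  have hex : ∀ t : ℝ, 0 ≤ t → ∃ p, Tendsto (fun k ↦ Z k t) 𝓕 (𝓝 p) := by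
    intro t ht
    have h1 : ∀ᶠ k in 𝓕, Z k t ∈ closedBall z₀ (C * (t + 1)) := by
      filter_upwards [(hfloor t ht).eventually (gt_mem_nhds (lt_add_one t))] with k hk
      have h2 := norm_eulerPolygon_sub_le hC z₀ (h := (k : ℝ)⁻¹) (by positivity) 0 ⌊t * k⌋₊
      rw [zero_add] at h2
      rw [mem_closedBall, dist_eq_norm]
      refine h2.trans ?_
      gcongr
    obtain ⟨p, -, hp⟩ := (isCompact_closedBall z₀ (C * (t + 1))).ultrafilter_le_nhds
      ((hyperfilter ℕ).map fun k ↦ Z k t) (le_principal_iff.2 (Ultrafilter.mem_map.2 h1))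
    exact ⟨p, hp⟩
  choose! z hz using hex
  have hlip : ∀ s t : ℝ, 0 ≤ s → s ≤ t → ‖z t - z s‖ ≤ C * (t - s) := by
    intro s t hs hst
    refine le_of_tendsto_of_tendsto' ((hz t (hs.trans hst)).sub (hz s hs)).norm
      ((hstep' s t hs hst).const_mul C) fun k ↦ ?_
    have := norm_eulerPolygon_sub_le hC z₀ (h := (k : ℝ)⁻¹) (by positivity) ⌊s * k⌋₊
      (⌊t * k⌋₊ - ⌊s * k⌋₊)
    rwa [hstep s t hst k] at this
  have happrox : ∀ δ η : ℝ, (∀ z z', ‖z - z'‖ ≤ δ → ‖f z - f z'‖ ≤ η) → ∀ s t : ℝ, 0 ≤ s → s ≤ t →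
      C * (t - s) < δ → ‖z t - z s - (t - s) • f (z s)‖ ≤ η * (t - s) := by
    intro δ η hδ s t hs hst hlt
    have h1 := hstep' s t hs hst
    refine le_of_tendsto_of_tendsto (((hz t (hs.trans hst)).sub (hz s hs)).sub
      (h1.smul ((hf.continuous.tendsto _).comp (hz s hs)))).norm (h1.const_mul η) ?_
    filter_upwards [(h1.const_mul C).eventually (gt_mem_nhds hlt)] with k hk
    have := norm_eulerPolygon_sub_sub_le hC z₀ (h := (k : ℝ)⁻¹) (by positivity) hδ ⌊s * k⌋₊
      (⌊t * k⌋₊ - ⌊s * k⌋₊) hk.le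
    rwa [hstep s t hst k] at this
  refine ⟨z, ?_, ?_, ?_⟩
  · refine tendsto_nhds_unique (hz 0 le_rfl) (tendsto_const_nhds.congr fun k ↦ ?_)
    simp [Z, eulerPolygon]
  · refine LipschitzOnWith.continuousOn (K := C.toNNReal) (LipschitzOnWith.of_dist_le_mul ?_)
    intro s hs t ht
    rw [Real.coe_toNNReal _ hC0, Real.dist_eq, dist_eq_norm]
    rcases le_total s t with h | h
    · rw [norm_sub_rev, abs_sub_comm, abs_of_nonneg (sub_nonneg.2 h)]
      exact hlip s t hs h
    · rw [abs_of_nonneg (sub_nonneg.2 h)]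
      exact hlip t s ht h
  · intro t ht
    rw [hasDerivAt_iff_isLittleO, Asymptotics.isLittleO_iff]
    intro c hc
    obtain ⟨δ, hδ, hδf⟩ := Metric.uniformContinuous_iff.1 hf (c / 2) (by positivity)
    have hδ' : ∀ z z', ‖z - z'‖ ≤ δ / 2 → ‖f z - f z'‖ ≤ c / 2 := fun z z' h ↦ by
      rw [← dist_eq_norm] at h ⊢
      exact (hδf (by linarith)).le
    have h1 : ∀ᶠ s in 𝓝 t, C * |s - t| < δ / 2 := by
      have : Continuous fun s ↦ C * |s - t| := by fun_prop
      refine (this.tendsto t).eventually (gt_mem_nhds ?_)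
      simpa using hδ
    filter_upwards [h1, lt_mem_nhds ht] with s hs hs0
    rcases le_total t s with h | h
    · rw [abs_of_nonneg (sub_nonneg.2 h)] at hs
      rw [Real.norm_of_nonneg (sub_nonneg.2 h)]
      refine (happrox _ _ hδ' t s ht.le h hs).trans ?_
      have := sub_nonneg.2 h
      nlinarith
    · rw [abs_sub_comm, abs_of_nonneg (sub_nonneg.2 h)] at hs
      rw [norm_sub_rev s t, Real.norm_of_nonneg (sub_nonneg.2 h)]
      have h2 := happrox _ _ hδ' s t hs0.le h hs
      have h3 := hδ' (z s) (z t) (by rw [norm_sub_rev]; exact (hlip s t hs0.le h).trans hs.le)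
      -- The estimate is forward in time, based at the earlier point `s`; moving the base point to
      -- `t` costs another `c / 2`.
      have h4 : z s - z t - (s - t) • f (z t) =
          -(z t - z s - (t - s) • f (z s)) - (t - s) • (f (z s) - f (z t)) := by module
      rw [h4]
      refine (norm_sub_le _ _).trans ?_
      rw [norm_neg, norm_smul, Real.norm_of_nonneg (sub_nonneg.2 h)]
      have := mul_le_mul_of_nonneg_left h3 (sub_nonneg.2 h)
      linarith

/-- Peano's theorem. -/
theorem exists_hasDerivAt_of_continuousOn [ProperSpace V] {f : V → V} {U : Set V} (hU : IsOpen U)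
    (hf : ContinuousOn f U) {z₀ : V} (hz₀ : z₀ ∈ U) :
    ∃ ε > 0, ∃ z : ℝ → V, z 0 = z₀ ∧ ContinuousOn z (Ici 0) ∧
      ∀ t ∈ Ioo 0 ε, z t ∈ U ∧ HasDerivAt z (f (z t)) t := by
  obtain ⟨r, hr, hrU⟩ := Metric.nhds_basis_closedBall.mem_iff.1 (hU.mem_nhds hz₀)
  -- A cutoff equal to `1` on the half ball and `0` outside the ball: it makes the field compactly
  -- supported, hence bounded and uniformly continuous, without changing solutions for a short time.
  set φ : V → ℝ := fun z ↦ max 0 (min 1 (2 - 2 * dist z z₀ / r)) with hφ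
  have hφc : Continuous φ := by fun_prop
  have hφ0 : ∀ z, z ∉ closedBall z₀ r → φ z = 0 := by
    intro z hz
    rw [mem_closedBall, not_le] at hz
    have : 1 ≤ dist z z₀ / r := by rw [le_div_iff₀ hr]; linarith
    refine max_eq_left ((min_le_right _ _).trans ?_)
    rw [mul_div_assoc]; linarith
  have hφ1 : ∀ z ∈ ball z₀ (r / 2), φ z = 1 := by
    intro z hz
    rw [mem_ball] at hz
    have : dist z z₀ / r ≤ 1 / 2 := by rw [div_le_iff₀ hr]; linarith
    rw [hφ]
    simp only
    rw [min_eq_left (by rw [mul_div_assoc]; linarith), max_eq_right zero_le_one]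
  have hsupp : HasCompactSupport fun z ↦ φ z • f z :=
    HasCompactSupport.intro (isCompact_closedBall z₀ r) fun z hz ↦ by rw [hφ0 z hz, zero_smul]
  have hcont : Continuous fun z ↦ φ z • f z := by
    rw [continuous_iff_continuousAt]
    intro z
    by_cases hz : z ∈ U
    · exact hφc.continuousAt.smul (hf.continuousAt (hU.mem_nhds hz))
    · have h1 : (closedBall z₀ r)ᶜ ∈ 𝓝 z :=
        isClosed_closedBall.isOpen_compl.mem_nhds fun h ↦ hz (hrU h)
      refine (continuousAt_const (y := (0 : V))).congr ?_
      filter_upwards [h1] with y hy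
      rw [hφ0 y hy, zero_smul]
  obtain ⟨C, hC⟩ := hsupp.exists_bound_of_continuous hcont
  obtain ⟨z, h0, hzc, hz⟩ := exists_hasDerivAt_of_uniformContinuous
    (hsupp.uniformContinuous_of_continuous hcont) hC z₀
  have h1 : ∀ᶠ t in 𝓝[≥] (0 : ℝ), z t ∈ ball z₀ (r / 2) :=
    (hzc 0 (mem_Ici.2 le_rfl)) (by rw [h0]; exact ball_mem_nhds _ (half_pos hr))
  obtain ⟨ε, hε, hball⟩ := (mem_nhdsGE_iff_exists_Ico_subset).1 h1
  refine ⟨ε, hε, z, h0, hzc, fun t ht ↦ ?_⟩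
  have h2 : z t ∈ ball z₀ (r / 2) := hball ⟨ht.1.le, ht.2⟩
  refine ⟨hrU (ball_subset_closedBall (ball_subset_ball (by linarith) h2)), ?_⟩
  have := hz t ht.1
  rwa [hφ1 _ h2, one_smul] at this

end Peano

/-! ### Gluing solutions and limits at an end point. -/

section Glue

/-- Two curves which fit together to first order at `b` have a differentiable concatenation. -/
theorem hasDerivAt_ite_lt {V : Type*} [NormedAddCommGroup V] [NormedSpace ℝ V] {f f' g g' : ℝ → V}
    {a b c : ℝ} (hab : a < b) (hbc : b < c) (hf : ∀ t ∈ Ioo a b, HasDerivAt f (f' t) t)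
    (hg : ∀ t ∈ Ioo b c, HasDerivAt g (g' t) t) (hfb : Tendsto f (𝓝[<] b) (𝓝 (g b)))
    (hgb : Tendsto g (𝓝[>] b) (𝓝 (g b))) (hfb' : Tendsto f' (𝓝[<] b) (𝓝 (g' b)))
    (hgb' : Tendsto g' (𝓝[>] b) (𝓝 (g' b))) :
    ∀ t ∈ Ioo a c, HasDerivAt (fun s ↦ if s < b then f s else g s)
      (if t < b then f' t else g' t) t := by
  have hl : ∀ t ∈ Ioo a b, HasDerivAt (fun s ↦ if s < b then f s else g s) (f' t) t := by
    intro t ht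
    refine (hf t ht).congr_of_eventuallyEq ?_
    filter_upwards [gt_mem_nhds ht.2] with s hs using if_pos hs
  have hr : ∀ t ∈ Ioo b c, HasDerivAt (fun s ↦ if s < b then f s else g s) (g' t) t := by
    intro t ht
    refine (hg t ht).congr_of_eventuallyEq ?_
    filter_upwards [lt_mem_nhds ht.1] with s hs using if_neg hs.not_gt
  intro t ht
  rcases lt_trichotomy t b with h | rfl | h
  · rw [if_pos h]
    exact hl t ⟨ht.1, h⟩
  · rw [if_neg (lt_irrefl _)]
    -- A continuous function whose derivative has a one-sided limit has that limit as one-sided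
    -- derivative.
    have hl' : HasDerivWithinAt (fun s ↦ if s < t then f s else g s) (g' t) (Iic t) t := by
      refine hasDerivWithinAt_Iic_of_tendsto_deriv (s := Ioo a t)
        (fun s hs ↦ (hl s hs).differentiableAt.differentiableWithinAt) ?_
        (Ioo_mem_nhdsLT hab) ?_
      · rw [ContinuousWithinAt, if_neg (lt_irrefl _), nhdsWithin_Ioo_eq_nhdsLT hab]
        refine hfb.congr' ?_
        filter_upwards [self_mem_nhdsWithin] with s hs using (if_pos hs).symm
      · refine hfb'.congr' ?_
        filter_upwards [Ioo_mem_nhdsLT hab] with s hs using (hl s hs).deriv.symm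
    have hr' : HasDerivWithinAt (fun s ↦ if s < t then f s else g s) (g' t) (Ici t) t := by
      refine hasDerivWithinAt_Ici_of_tendsto_deriv (s := Ioo t c)
        (fun s hs ↦ (hr s hs).differentiableAt.differentiableWithinAt) ?_
        (Ioo_mem_nhdsGT hbc) ?_
      · rw [ContinuousWithinAt, if_neg (lt_irrefl _), nhdsWithin_Ioo_eq_nhdsGT hbc]
        refine hgb.congr' ?_
        filter_upwards [self_mem_nhdsWithin] with s hs using (if_neg (not_lt.2 (le_of_lt hs))).symm
      · refine hgb'.congr' ?_
        filter_upwards [Ioo_mem_nhdsGT hbc] with s hs using (hr s hs).deriv.symm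
    simpa using hl'.union hr'
  · rw [if_neg h.not_gt]
    exact hr t ⟨h, ht.2⟩

theorem exists_tendsto_nhdsLT_of_dist_le {X : Type*} [PseudoMetricSpace X] [CompleteSpace X]
    {f : ℝ → X} {a b K : ℝ} (hab : a < b)
    (hf : ∀ s ∈ Ioo a b, ∀ t ∈ Ioo a b, s ≤ t → dist (f s) (f t) ≤ K * (t - s)) :
    ∃ p, Tendsto f (𝓝[<] b) (𝓝 p) := by
  have hlip : LipschitzOnWith K.toNNReal f (Ioo a b) := by
    refine LipschitzOnWith.of_dist_le_mul fun s hs t ht ↦ ?_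
    rw [Real.dist_eq]
    rcases le_total s t with h | h
    · rw [abs_sub_comm, abs_of_nonneg (sub_nonneg.2 h)]
      exact (hf s hs t ht h).trans
        (mul_le_mul_of_nonneg_right (Real.le_coe_toNNReal K) (sub_nonneg.2 h))
    · rw [abs_of_nonneg (sub_nonneg.2 h), dist_comm]
      exact (hf t ht s hs h).trans
        (mul_le_mul_of_nonneg_right (Real.le_coe_toNNReal K) (sub_nonneg.2 h))
  have h1 : Cauchy (map f (𝓝[Ioo a b] b)) := by
    have : (𝓝[Ioo a b] b).NeBot := by
      rw [nhdsWithin_Ioo_eq_nhdsLT hab]; infer_instance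
    exact (cauchy_nhds.mono nhdsWithin_le_nhds).map_of_le hlip.uniformContinuousOn inf_le_right
  rw [nhdsWithin_Ioo_eq_nhdsLT hab] at h1
  exact CompleteSpace.complete h1

end Glue

/-! ### Continuing geodesics past a finite limit. -/

namespace C1RiemannianMetric

variable {n : ℕ} {M : Type*} [TopologicalSpace M] [ChartedSpace (EuclideanSpace ℝ (Fin n)) M]
  [IsManifold (𝓡 n) ∞ M]

local notation "𝔼" => EuclideanSpace ℝ (Fin n)

/-- The acceleration of a geodesic in the chart `e`. -/
noncomputable def accel (g : C1RiemannianMetric n M) (e : OpenPartialHomeomorph M 𝔼)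
    (y v : 𝔼) : 𝔼 :=
  WithLp.toLp 2 fun k ↦ -∑ i, ∑ j, g.christoffel e k i j y * v i * v j

theorem forall_geodesicForm_eq_zero_iff (g : C1RiemannianMetric n M)
    {e : OpenPartialHomeomorph M 𝔼} (he : e ∈ IsManifold.maximalAtlas (𝓡 n) ∞ M) {y : 𝔼}
    (hy : y ∈ e.target) (v a : 𝔼) :
    (∀ w, g.geodesicForm e y v a w = 0) ↔ a = g.accel e y v := by
  rw [← g.forall_christoffel_iff he hy, PiLp.ext_iff]
  exact forall_congr' fun k ↦ add_eq_zero_iff_eq_neg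

theorem continuousOn_christoffel (g : C1RiemannianMetric n M) {e : OpenPartialHomeomorph M 𝔼}
    (he : e ∈ IsManifold.maximalAtlas (𝓡 n) ∞ M) (k i j : Fin n) :
    ContinuousOn (g.christoffel e k i j) e.target := by
  have hcoeff : ∀ i j, ContDiffOn ℝ 1 (g.coeff e i j) e.target := fun i j ↦
    g.contDiffOn_chartForm he _ _
  have hpartial : ∀ l i j, ContinuousOn (g.partialCoeff e l i j) e.target := fun l i j ↦
    ((hcoeff i j).continuousOn_fderiv_of_isOpen e.open_target le_rfl).clm_apply continuousOn_const
  have hmat : ContinuousOn (fun y ↦ Matrix.of fun a b ↦ g.coeff e a b y) e.target :=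
    continuousOn_pi.2 fun a ↦ continuousOn_pi.2 fun b ↦ (hcoeff a b).continuousOn
  have hinv : ∀ l, ContinuousOn (fun y ↦ (Matrix.of fun a b ↦ g.coeff e a b y)⁻¹ k l) e.target := by
    intro l
    have h1 : ContinuousOn (fun y ↦ (Matrix.of fun a b ↦ g.coeff e a b y).det) e.target :=
      (continuous_id.matrix_det).comp_continuousOn hmat
    have h2 : ContinuousOn (fun y ↦ (Matrix.of fun a b ↦ g.coeff e a b y).adjugate k l) e.target :=
      ((continuous_id.matrix_adjugate).matrix_elem k l).comp_continuousOn hmat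
    refine ((h1.inv₀ fun y hy ↦ ?_).mul h2).congr fun y hy ↦ ?_
    · exact ((Matrix.isUnit_iff_isUnit_det _).1 (g.isUnit_coeff he hy)).ne_zero
    · simp [Matrix.inv_def, Ring.inverse_eq_inv']
  unfold christoffel
  exact continuousOn_const.mul (continuousOn_finsetSum _ fun l _ ↦ (hinv l).mul
    (((hpartial i j l).add (hpartial j i l)).sub (hpartial l i j)))

theorem continuousOn_accel (g : C1RiemannianMetric n M) {e : OpenPartialHomeomorph M 𝔼}
    (he : e ∈ IsManifold.maximalAtlas (𝓡 n) ∞ M) :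
    ContinuousOn (fun z : 𝔼 × 𝔼 ↦ g.accel e z.1 z.2) (e.target ×ˢ univ) := by
  refine (PiLp.continuous_toLp 2 _).comp_continuousOn (continuousOn_pi.2 fun k ↦ ?_)
  refine (continuousOn_finsetSum _ fun i _ ↦ continuousOn_finsetSum _ fun j _ ↦ ?_).neg
  have h1 : ContinuousOn (fun z : 𝔼 × 𝔼 ↦ g.christoffel e k i j z.1) (e.target ×ˢ univ) :=
    (g.continuousOn_christoffel he k i j).comp continuousOn_fst fun z hz ↦ hz.1
  have h2 : ∀ i, ContinuousOn (fun z : 𝔼 × 𝔼 ↦ z.2 i) (e.target ×ˢ univ) := fun i ↦ by fun_prop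
  exact (h1.mul (h2 i)).mul (h2 j)

/-- A solution of the first order system is automatically `C^2`, since its acceleration is a
continuous function of position and velocity. -/
theorem isGeodesicAt_of_hasDerivAt (g : C1RiemannianMetric n M) {e : OpenPartialHomeomorph M 𝔼}
    (he : e ∈ IsManifold.maximalAtlas (𝓡 n) ∞ M) {x v : ℝ → 𝔼} {I : Set ℝ} (hI : IsOpen I)
    (hxe : ∀ t ∈ I, x t ∈ e.target) (hx : ∀ t ∈ I, HasDerivAt x (v t) t)
    (hv : ∀ t ∈ I, HasDerivAt v (g.accel e (x t) (v t)) t) {t : ℝ} (ht : t ∈ I) :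
    g.IsGeodesicAt (e.symm ∘ x) t := by
  have hxc : ContinuousOn x I := fun s hs ↦ (hx s hs).continuousAt.continuousWithinAt
  have hvc : ContinuousOn v I := fun s hs ↦ (hv s hs).continuousAt.continuousWithinAt
  have hm : MapsTo (fun s ↦ (x s, v s)) I (e.target ×ˢ univ) := fun s hs ↦ ⟨hxe s hs, mem_univ _⟩
  have hac : ContinuousOn (fun s ↦ g.accel e (x s) (v s)) I := by
    have := g.continuousOn_accel he
    generalize g.accel e = A at this ⊢
    exact this.comp (hxc.prodMk hvc) hm
  have hv1 : ContDiffOn ℝ 1 v I :=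
    contDiffOn_one_of_hasDerivAt (k := 0) hI hv (contDiffOn_zero.2 hac)
  refine g.isGeodesicAt_symm_comp he (hxe t ht) ?_ (hv1.contDiffAt (hI.mem_nhds ht)) ?_
  · filter_upwards [hI.mem_nhds ht] with s hs using hx s hs
  · rw [g.forall_geodesicForm_eq_zero_iff he (hxe t ht), (hv t ht).deriv]

theorem IsGeodesicAt.hasDerivAt_deriv {g : C1RiemannianMetric n M} {γ : ℝ → M} {t : ℝ}
    (h : g.IsGeodesicAt γ t) {e : OpenPartialHomeomorph M 𝔼}
    (he : e ∈ IsManifold.maximalAtlas (𝓡 n) ∞ M) (ht : γ t ∈ e.source) :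
    HasDerivAt (e ∘ γ) (deriv (e ∘ γ) t) t ∧
      HasDerivAt (deriv (e ∘ γ)) (g.accel e ((e ∘ γ) t) (deriv (e ∘ γ) t)) t := by
  obtain ⟨h1, h2⟩ := hasDerivAt_deriv_of_contDiffAt (contDiffAt_comp_of_contMDiffAt he h.1 ht)
  refine ⟨h1.self_of_nhds, ?_⟩
  rwa [(g.forall_geodesicForm_eq_zero_iff he (e.map_source ht) _ _).1
    (h.geodesicForm_eq_zero he ht)] at h2

/-- A geodesic is Lipschitz for the distance. -/
theorem exists_rdist_le_of_isGeodesicAt (g : C1RiemannianMetric n M) {γ : ℝ → M} {a b : ℝ}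
    (hγ : ∀ t ∈ Ioo a b, g.IsGeodesicAt γ t) :
    ∃ c, (∀ t ∈ Ioo a b, g.speedSq γ t = c) ∧
      ∀ s ∈ Ioo a b, ∀ t ∈ Ioo a b, s ≤ t → g.rdist (γ s) (γ t) ≤ √c * (t - s) := by
  obtain ⟨c, hc⟩ := isOpen_Ioo.exists_is_const_of_deriv_eq_zero isPreconnected_Ioo
    (f := g.speedSq γ) (s := Ioo a b)
    (fun t ht ↦ (hγ t ht).hasDerivAt_speedSq.differentiableAt.differentiableWithinAt)
    (fun t ht ↦ (hγ t ht).hasDerivAt_speedSq.deriv)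
  refine ⟨c, hc, fun s hs t ht hst ↦ ?_⟩
  have hI : Icc s t ⊆ Ioo a b := fun r hr ↦ ⟨hs.1.trans_le hr.1, hr.2.trans_lt ht.2⟩
  refine g.rdist_le_of_edistance_le (mul_nonneg (Real.sqrt_nonneg _) (sub_nonneg.2 hst)) ?_
  refine (g.edistance_le_length hst fun r hr ↦
    ((hγ r (hI hr)).1.of_le (by norm_num)).contMDiffWithinAt).trans (le_of_eq ?_)
  rw [length, setLIntegral_congr_fun measurableSet_Icc
    (g := fun _ ↦ ENNReal.ofReal √c) fun r hr ↦ by simp only; rw [hc r (hI hr)]]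
  rw [setLIntegral_const, Real.volume_Icc, ← ENNReal.ofReal_mul (Real.sqrt_nonneg _)]

end C1RiemannianMetric

section Continuation

/-- A solution of a second order equation which converges, together with its velocity, continues. -/
theorem exists_continuation {V : Type*} [NormedAddCommGroup V] [NormedSpace ℝ V] [ProperSpace V]
    {A : V → V → V} {U : Set V} (hU : IsOpen U)
    (hA : ContinuousOn (fun z : V × V ↦ A z.1 z.2) (U ×ˢ univ)) {x v : ℝ → V} {a b : ℝ}
    (hab : a < b) (hxU : ∀ t ∈ Ioo a b, x t ∈ U) (hx : ∀ t ∈ Ioo a b, HasDerivAt x (v t) t)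
    (hv : ∀ t ∈ Ioo a b, HasDerivAt v (A (x t) (v t)) t) {y₀ v₀ : V} (hy₀ : y₀ ∈ U)
    (hlim : Tendsto x (𝓝[<] b) (𝓝 y₀)) (hlim' : Tendsto v (𝓝[<] b) (𝓝 v₀)) :
    ∃ ε > 0, ∃ X W : ℝ → V, (∀ t < b, X t = x t) ∧ ∀ t ∈ Ioo a (b + ε),
      X t ∈ U ∧ HasDerivAt X (W t) t ∧ HasDerivAt W (A (X t) (W t)) t := by
  have hO : IsOpen (U ×ˢ (univ : Set V)) := hU.prod isOpen_univ
  -- Peano's theorem in phase space, started at the limits of position and velocity. Gluing `x` and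
  -- then `v` matches first and second derivatives at `b`, so the concatenation solves the equation
  -- there too.
  obtain ⟨ε, hε, z, hz0, hzc, hz⟩ := exists_hasDerivAt_of_continuousOn
    (f := fun z : V × V ↦ (z.2, A z.1 z.2)) hO (continuousOn_snd.prodMk hA)
    (z₀ := (y₀, v₀)) ⟨hy₀, mem_univ _⟩
  have hshift : ∀ t ∈ Ioo b (b + ε), z (t - b) ∈ U ×ˢ (univ : Set V) ∧
      HasDerivAt (fun s ↦ z (s - b)) ((z (t - b)).2, A (z (t - b)).1 (z (t - b)).2) t := by
    intro t ht
    obtain ⟨h1, h2⟩ := hz (t - b) ⟨by linarith [ht.1], by linarith [ht.2]⟩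
    exact ⟨h1, h2.comp_sub_const t b⟩
  have hzb : Tendsto (fun t ↦ z (t - b)) (𝓝[>] b) (𝓝 (y₀, v₀)) := by
    have h1 : Tendsto (fun t ↦ t - b) (𝓝[>] b) (𝓝[≥] 0) := by
      refine tendsto_nhdsWithin_iff.2 ⟨?_, ?_⟩
      · have : Continuous fun t ↦ t - b := by fun_prop
        have h2 := this.tendsto b
        rw [sub_self] at h2
        exact h2.mono_left nhdsWithin_le_nhds
      · filter_upwards [self_mem_nhdsWithin] with t ht
        exact sub_nonneg.2 (mem_Ioi.1 ht).le
    have h2 := (hzc 0 (mem_Ici.2 le_rfl)).tendsto.comp h1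
    rwa [hz0] at h2
  have hbb : z (b - b) = (y₀, v₀) := by rw [sub_self, hz0]
  have hA0 : Tendsto (fun z : V × V ↦ A z.1 z.2) (𝓝 (y₀, v₀)) (𝓝 (A y₀ v₀)) :=
    hA.continuousAt (hO.mem_nhds ⟨hy₀, mem_univ _⟩)
  have hbε : b < b + ε := by linarith
  have hz1 : Tendsto (fun t ↦ (z (t - b)).1) (𝓝[>] b) (𝓝 (z (b - b)).1) := by
    rw [hbb]; exact (continuous_fst.tendsto _).comp hzb
  have hz2 : Tendsto (fun t ↦ (z (t - b)).2) (𝓝[>] b) (𝓝 (z (b - b)).2) := by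
    rw [hbb]; exact (continuous_snd.tendsto _).comp hzb
  have hz3 : Tendsto (fun t ↦ A (z (t - b)).1 (z (t - b)).2) (𝓝[>] b)
      (𝓝 (A (z (b - b)).1 (z (b - b)).2)) := by
    rw [hbb]; exact hA0.comp hzb
  have hx3 : Tendsto (fun t ↦ A (x t) (v t)) (𝓝[<] b) (𝓝 (A (z (b - b)).1 (z (b - b)).2)) := by
    rw [hbb]; exact hA0.comp (hlim.prodMk_nhds hlim')
  have hxz : Tendsto x (𝓝[<] b) (𝓝 (z (b - b)).1) := by rwa [hbb]
  have hvz : Tendsto v (𝓝[<] b) (𝓝 (z (b - b)).2) := by rwa [hbb]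
  have hX := hasDerivAt_ite_lt (g := fun t ↦ (z (t - b)).1) (g' := fun t ↦ (z (t - b)).2) hab hbε
    hx (fun t ht ↦ (hshift t ht).2.fst) hxz hz1 hvz hz2
  have hW := hasDerivAt_ite_lt (g := fun t ↦ (z (t - b)).2)
    (g' := fun t ↦ A (z (t - b)).1 (z (t - b)).2) hab hbε
    hv (fun t ht ↦ (hshift t ht).2.snd) hvz hz2 hx3 hz3
  refine ⟨ε, hε, _, _, fun t ht ↦ if_pos ht, fun t ht ↦ ⟨?_, hX t ht, ?_⟩⟩
  · rcases lt_trichotomy t b with h | rfl | h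
    · rw [if_pos h]
      exact hxU t ⟨ht.1, h⟩
    · rw [if_neg (lt_irrefl _), hbb]
      exact hy₀
    · rw [if_neg h.not_gt]
      exact (hshift t ⟨h, ht.2⟩).1.1
  · refine (hW t ht).congr_deriv ?_
    split_ifs <;> rfl

end Continuation

namespace C1RiemannianMetric

variable {n : ℕ} {M : Type*} [TopologicalSpace M] [ChartedSpace (EuclideanSpace ℝ (Fin n)) M]
  [IsManifold (𝓡 n) ∞ M]

local notation "𝔼" => EuclideanSpace ℝ (Fin n)

/-- Constant speed bounds the coordinate velocity near `p`; the equation then bounds the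
acceleration, so the velocity is Lipschitz up to `b`. -/
theorem exists_tendsto_deriv_nhdsLT (g : C1RiemannianMetric n M)
    {e : OpenPartialHomeomorph M 𝔼} (he : e ∈ IsManifold.maximalAtlas (𝓡 n) ∞ M) {γ : ℝ → M}
    {a b c : ℝ} {p : M} (hab : a < b) (hγ : ∀ t ∈ Ioo a b, g.IsGeodesicAt γ t)
    (hc : ∀ t ∈ Ioo a b, g.speedSq γ t = c) (hp : Tendsto γ (𝓝[<] b) (𝓝 p)) (hpe : p ∈ e.source) :
    ∃ v₀, Tendsto (deriv (e ∘ γ)) (𝓝[<] b) (𝓝 v₀) := by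
  have hy₀ : e p ∈ e.target := e.map_source hpe
  have hlim : Tendsto (e ∘ γ) (𝓝[<] b) (𝓝 (e p)) := (e.continuousAt hpe).tendsto.comp hp
  obtain ⟨k, hk, hcoer⟩ := exists_pos_mul_norm_sq_le (A := g.gram e (e p)) fun v hv ↦ by
    rw [← chartForm_eq_inner]; exact g.chartForm_pos he hy₀ hv
  obtain ⟨r, hr, hball⟩ := Metric.nhds_basis_closedBall.mem_iff.1
    (inter_mem (g.eventually_chartForm_le_mul he hy₀ one_lt_two) (e.open_target.mem_nhds hy₀))
  have hev : ∀ᶠ t in 𝓝[<] b, t ∈ Ioo a b ∧ γ t ∈ e.source ∧ (e ∘ γ) t ∈ closedBall (e p) r := by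
    filter_upwards [Ioo_mem_nhdsLT hab, hp (e.open_source.mem_nhds hpe),
      hlim (closedBall_mem_nhds _ hr)] with t h1 h2 h3 using ⟨h1, h2, h3⟩
  obtain ⟨a', ha', hI⟩ := (mem_nhdsLT_iff_exists_Ioo_subset).1 hev
  have hder : ∀ t ∈ Ioo a' b, HasDerivAt (deriv (e ∘ γ))
      (g.accel e ((e ∘ γ) t) (deriv (e ∘ γ) t)) t := fun t ht ↦
    ((hγ t (hI ht).1).hasDerivAt_deriv he (hI ht).2.1).2
  -- With coercivity constant `k` at `p` and comparison factor `2`, one has `k ‖v‖² ≤ g_p(v, v) ≤ 2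
  -- g_γ(v, v) = 2 c`.
  have hbound : ∀ t ∈ Ioo a' b, ‖deriv (e ∘ γ) t‖ ≤ √(2 * c / k) := by
    intro t ht
    obtain ⟨h1, h2, h3⟩ := hI ht
    have h4 := ((hball h3).1 (deriv (e ∘ γ) t)).2
    rw [Function.comp_apply, ← g.speedSq_eq_chartForm he
      ((hγ t h1).1.mdifferentiableAt (by simp)) h2, hc t h1, chartForm_eq_inner] at h4
    refine Real.le_sqrt_of_sq_le ?_
    rw [le_div_iff₀ hk, mul_comm]
    exact (hcoer _).trans h4
  have hKU : closedBall (e p) r ×ˢ closedBall (0 : 𝔼) √(2 * c / k) ⊆ e.target ×ˢ univ :=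
    prod_mono (fun y hy ↦ (hball hy).2) (subset_univ _)
  obtain ⟨B, hB⟩ := ((isCompact_closedBall (e p) r).prod
    (isCompact_closedBall (0 : 𝔼) √(2 * c / k))).exists_bound_of_continuousOn
    ((g.continuousOn_accel he).mono hKU)
  refine exists_tendsto_nhdsLT_of_dist_le (K := B) ha' fun s hs t ht hst ↦ ?_
  rw [dist_comm, dist_eq_norm]
  refine ((convex_Ioo a' b).norm_image_sub_le_of_norm_hasDerivWithin_le (C := B)
    (fun r hr ↦ (hder r hr).hasDerivWithinAt) (fun r hr ↦ ?_) hs ht).trans_eq ?_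
  · exact hB ((e ∘ γ) r, deriv (e ∘ γ) r)
      ⟨(hI hr).2.2, mem_closedBall_zero_iff.2 (hbound r hr)⟩
  · rw [Real.norm_of_nonneg (sub_nonneg.2 hst)]

theorem exists_extension_of_tendsto (g : C1RiemannianMetric n M) {γ : ℝ → M}
    {a b c : ℝ} {p : M} (hab : a < b) (hγ : ∀ t ∈ Ioo a b, g.IsGeodesicAt γ t)
    (hc : ∀ t ∈ Ioo a b, g.speedSq γ t = c) (hp : Tendsto γ (𝓝[<] b) (𝓝 p)) :
    ∃ ε > 0, ∃ γ' : ℝ → M, (∀ t < b, γ' t = γ t) ∧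
      ∀ t ∈ Ioo a (b + ε), g.IsGeodesicAt γ' t := by
  obtain ⟨e, he, hpe⟩ : ∃ e ∈ IsManifold.maximalAtlas (𝓡 n) ∞ M, p ∈ e.source :=
    ⟨chartAt 𝔼 p, IsManifold.chart_mem_maximalAtlas _, mem_chart_source _ _⟩
  have hlim : Tendsto (e ∘ γ) (𝓝[<] b) (𝓝 (e p)) := (e.continuousAt hpe).tendsto.comp hp
  obtain ⟨v₀, hv₀⟩ := g.exists_tendsto_deriv_nhdsLT he hab hγ hc hp hpe
  have hev : ∀ᶠ t in 𝓝[<] b, t ∈ Ioo a b ∧ γ t ∈ e.source := by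
    filter_upwards [Ioo_mem_nhdsLT hab, hp (e.open_source.mem_nhds hpe)] with t h1 h2
      using ⟨h1, h2⟩
  obtain ⟨a', ha', hI⟩ := (mem_nhdsLT_iff_exists_Ioo_subset).1 hev
  have hder : ∀ t ∈ Ioo a' b, HasDerivAt (e ∘ γ) (deriv (e ∘ γ) t) t ∧
      HasDerivAt (deriv (e ∘ γ)) (g.accel e ((e ∘ γ) t) (deriv (e ∘ γ) t)) t := fun t ht ↦
    (hγ t (hI ht).1).hasDerivAt_deriv he (hI ht).2
  obtain ⟨ε, hε, X, W, hXγ, hXW⟩ := exists_continuation e.open_target (g.continuousOn_accel he)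
    ha' (fun t ht ↦ e.map_source (hI ht).2) (fun t ht ↦ (hder t ht).1) (fun t ht ↦ (hder t ht).2)
    (e.map_source hpe) hlim hv₀
  have hgeo : ∀ t ∈ Ioo a' (b + ε), g.IsGeodesicAt (e.symm ∘ X) t := fun t ht ↦
    g.isGeodesicAt_of_hasDerivAt he isOpen_Ioo (fun s hs ↦ (hXW s hs).1)
      (fun s hs ↦ (hXW s hs).2.1) (fun s hs ↦ (hXW s hs).2.2) ht
  refine ⟨ε, hε, fun t ↦ if t < b then γ t else e.symm (X t), fun t ht ↦ if_pos ht, ?_⟩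
  intro t ht
  rcases lt_or_ge t b with h | h
  · refine (hγ t ⟨ht.1, h⟩).congr ?_
    filter_upwards [gt_mem_nhds h] with s hs using if_pos hs
  · have ht' : t ∈ Ioo a' (b + ε) := ⟨lt_of_lt_of_le ha' h, ht.2⟩
    refine (hgeo t ht').congr ?_
    filter_upwards [isOpen_Ioo.mem_nhds ht'] with s hs
    split_ifs with hsb
    · rw [Function.comp_apply, hXγ s hsb]
      exact (e.left_inv (hI ⟨hs.1, hsb⟩).2).symm
    · rfl

variable [ConnectedSpace M] [T2Space M]

theorem exists_extension_of_complete (g : C1RiemannianMetric n M)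
    (hcomplete : letI : MetricSpace M := g.metricSpace; CompleteSpace M) {γ : ℝ → M} {a b : ℝ}
    (hab : a < b) (hγ : ∀ t ∈ Ioo a b, g.IsGeodesicAt γ t) :
    ∃ ε > 0, ∃ γ' : ℝ → M, (∀ t < b, γ' t = γ t) ∧
      ∀ t ∈ Ioo a (b + ε), g.IsGeodesicAt γ' t := by
  obtain ⟨c, hc, hd⟩ := g.exists_rdist_le_of_isGeodesicAt hγ
  obtain ⟨p, hp⟩ := @exists_tendsto_nhdsLT_of_dist_le M g.metricSpace.toPseudoMetricSpace
    hcomplete γ a b √c hab hd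
  exact g.exists_extension_of_tendsto hab hγ hc hp

end C1RiemannianMetric

/-! ### Maximal extensions and the equivalence. -/

namespace C1RiemannianMetric

variable {n : ℕ} {M : Type*} [TopologicalSpace M] [ChartedSpace (EuclideanSpace ℝ (Fin n)) M]
  [IsManifold (𝓡 n) ∞ M] [ConnectedSpace M] [T2Space M]

/-- Extensions are not unique, so they cannot simply be united; Zorn's lemma selects a maximal one.
A finite right end would contradict maximality, because completeness allows one more extension. -/
theorem exists_right_extension (g : C1RiemannianMetric n M)
    (hcomplete : letI : MetricSpace M := g.metricSpace; CompleteSpace M) {a b : EReal}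
    (hab : a < b) {γ : ℝ → M} (hγ : ∀ t : ℝ, a < t → t < b → g.IsGeodesicAt γ t) :
    ∃ γ' : ℝ → M, (∀ t : ℝ, a < t → g.IsGeodesicAt γ' t) ∧
      ∀ t : ℝ, a < t → t < b → γ' t = γ t := by
  classical
  let S := {q : EReal × (ℝ → M) // b ≤ q.1 ∧
    (∀ t : ℝ, a < t → t < q.1 → g.IsGeodesicAt q.2 t) ∧ ∀ t : ℝ, a < t → t < b → q.2 t = γ t}
  -- Only values inside the domains are compared, so this is a preorder and not a partial order;
  -- transitivity is all that the version of Zorn's lemma used here needs.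
  let r : S → S → Prop := fun p q ↦ p.1.1 ≤ q.1.1 ∧ ∀ t : ℝ, a < t → t < p.1.1 → q.1.2 t = p.1.2 t
  have hS : Nonempty S := ⟨⟨(b, γ), le_rfl, hγ, fun _ _ _ ↦ rfl⟩⟩
  have htrans : ∀ {p q s : S}, r p q → r q s → r p s := fun {p q s} h1 h2 ↦
    ⟨h1.1.trans h2.1, fun t hat htp ↦ (h2.2 t hat (htp.trans_le h1.1)).trans (h1.2 t hat htp)⟩
  have hchain : ∀ c : Set S, IsChain r c → c.Nonempty → ∃ ub, ∀ p ∈ c, r p ub := by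
    intro c hc hne
    have hagree : ∀ p ∈ c, ∀ q ∈ c, ∀ t : ℝ, a < t → t < p.1.1 → t < q.1.1 →
        p.1.2 t = q.1.2 t := by
      intro p hp q hq t hat htp htq
      rcases eq_or_ne p q with rfl | hpq
      · rfl
      · rcases hc hp hq hpq with h | h
        · exact (h.2 t hat htp).symm
        · exact h.2 t hat htq
    obtain ⟨δ, hδ⟩ : ∃ δ : ℝ → M, ∀ p ∈ c, ∀ t : ℝ, a < t → t < p.1.1 → δ t = p.1.2 t := by
      -- Members of a chain agree on common domains, so the choice of the member defining the value
      -- at `t` does not matter.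
      refine ⟨fun t ↦ if h : ∃ p ∈ c, (t : EReal) < p.1.1 then h.choose.1.2 t else γ t, ?_⟩
      intro p hp t hat htp
      have h : ∃ p ∈ c, (t : EReal) < p.1.1 := ⟨p, hp, htp⟩
      simp only [dif_pos h]
      exact hagree _ h.choose_spec.1 _ hp t hat h.choose_spec.2 htp
    have hle : ∀ p ∈ c, p.1.1 ≤ ⨆ q ∈ c, q.1.1 := fun p hp ↦ le_iSup₂ (f := fun q _ ↦ q.1.1) p hp
    obtain ⟨p₀, hp₀⟩ := hne
    refine ⟨⟨(⨆ q ∈ c, q.1.1, δ), p₀.2.1.trans (hle p₀ hp₀), ?_, ?_⟩, fun p hp ↦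
      ⟨hle p hp, hδ p hp⟩⟩
    · intro t hat ht
      obtain ⟨p, htp⟩ := lt_iSup_iff.1 ht
      obtain ⟨hp, htp⟩ := lt_iSup_iff.1 htp
      refine (p.2.2.1 t hat htp).congr ?_
      have h1 : ∀ᶠ s : ℝ in 𝓝 t, a < s := continuous_coe_real_ereal.continuousAt.eventually
        (lt_mem_nhds hat)
      have h2 : ∀ᶠ s : ℝ in 𝓝 t, s < p.1.1 := continuous_coe_real_ereal.continuousAt.eventually
        (gt_mem_nhds htp)
      filter_upwards [h1, h2] with s hs1 hs2 using hδ p hp s hs1 hs2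
    · intro t hat htb
      exact (hδ p₀ hp₀ t hat (htb.trans_le p₀.2.1)).trans (p₀.2.2.2 t hat htb)
  obtain ⟨m, hm⟩ := exists_maximal_of_nonempty_chains_bounded hchain htrans
  have htop : m.1.1 = ⊤ := by
    by_contra hne
    have ham : a < m.1.1 := hab.trans_le m.2.1
    obtain ⟨T, hT⟩ : ∃ T : ℝ, (T : EReal) = m.1.1 :=
      ⟨m.1.1.toReal, EReal.coe_toReal hne (bot_le.trans_lt ham).ne'⟩
    obtain ⟨a', haa', ha'T⟩ := EReal.lt_iff_exists_real_btwn.1 ham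
    rw [← hT, EReal.coe_lt_coe_iff] at ha'T
    obtain ⟨ε, hε, γ', hγ', hgeo⟩ := g.exists_extension_of_complete hcomplete ha'T
      (γ := m.1.2) fun t ht ↦ m.2.2.1 t (haa'.trans (EReal.coe_lt_coe_iff.2 ht.1))
        (by rw [← hT]; exact EReal.coe_lt_coe_iff.2 ht.2)
    have hlt : m.1.1 < ((T + ε : ℝ) : EReal) := by
      rw [← hT]; exact EReal.coe_lt_coe_iff.2 (by linarith)
    have hγ'' : ∀ t : ℝ, t < m.1.1 → γ' t = m.1.2 t := fun t ht ↦
      hγ' t (by rwa [← hT, EReal.coe_lt_coe_iff] at ht)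
    have h1 := hm ⟨(((T + ε : ℝ) : EReal), γ'), m.2.1.trans hlt.le, ?_, ?_⟩
      ⟨hlt.le, fun t _ ht ↦ hγ'' t ht⟩
    · exact hlt.not_ge h1.1
    · intro t hat ht
      rcases lt_or_ge t T with h | h
      · refine (m.2.2.1 t hat (by rw [← hT]; exact EReal.coe_lt_coe_iff.2 h)).congr ?_
        filter_upwards [gt_mem_nhds h] with s hs using hγ' s hs
      · exact hgeo t ⟨ha'T.trans_le h, EReal.coe_lt_coe_iff.1 ht⟩
    · intro t hat htb
      exact (hγ'' t (htb.trans_le m.2.1)).trans (m.2.2.2 t hat htb)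
  exact ⟨m.1.2, fun t hat ↦ m.2.2.1 t hat (by rw [htop]; exact EReal.coe_lt_top t), m.2.2.2⟩

theorem isOpen_setOf_ereal_lt (a b : EReal) : IsOpen {t : ℝ | a < (t : EReal) ∧ (t : EReal) < b} :=
  (isOpen_Ioo (a := a) (b := b)).preimage continuous_coe_real_ereal

theorem geodesicallyComplete_of_completeSpace (g : C1RiemannianMetric n M)
    (hcomplete : letI : MetricSpace M := g.metricSpace; CompleteSpace M) :
    g.GeodesicallyComplete := by
  intro a b hab γ hγ
  rw [g.isGeodesicOn_iff (isOpen_setOf_ereal_lt a b)] at hγ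
  obtain ⟨γ₁, h1, h1'⟩ := g.exists_right_extension hcomplete hab fun t hat htb ↦ hγ t ⟨hat, htb⟩
  have ha : ⊥ < -a := by
    rw [bot_lt_iff_ne_bot, ne_eq, EReal.neg_eq_bot_iff]
    exact (hab.trans_le le_top).ne
  -- The reversed curve is a geodesic on `(-∞, -a)`; extending it to the right and reversing once
  -- more fills the left end.
  obtain ⟨γ₂, h2, h2'⟩ := g.exists_right_extension hcomplete ha (γ := fun t ↦ γ₁ (-t))
    fun t _ ht ↦ IsGeodesicAt.comp_neg (h1 (-t) (by
      rw [EReal.coe_neg]; exact EReal.lt_neg_comm.1 ht))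
  refine ⟨fun t ↦ γ₂ (-t), ?_, fun t hat htb ↦ ?_⟩
  · rw [g.isGeodesicOn_iff isOpen_univ]
    exact fun t _ ↦ IsGeodesicAt.comp_neg (h2 (-t) (EReal.bot_lt_coe _))
  · simp only
    rw [h2' (-t) (EReal.bot_lt_coe _) (by rw [EReal.coe_neg]; exact EReal.neg_lt_neg_iff.2 hat),
      neg_neg, h1' t hat htb]

theorem properSpace_of_geodesicallyComplete (g : C1RiemannianMetric n M)
    (hg : g.GeodesicallyComplete) : letI : MetricSpace M := g.metricSpace; ProperSpace M := by
  have hlc : LocallyCompactSpace M := Manifold.locallyCompact_of_finiteDimensional (𝓡 n)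
  refine @properSpace_of_length_of_tendsto M g.metricSpace hlc ?_ ?_
  · intro x y L h
    have h' : g.edistance x y < ENNReal.ofReal L := by
      rw [edistance_eq_ofReal_rdist]
      exact (ENNReal.ofReal_lt_ofReal_iff ((g.rdist_nonneg x y).trans_lt h)).2 h
    obtain ⟨σ, h0, hL, hσ⟩ := g.exists_unitSpeed_of_edistance_lt h'
    refine ⟨σ, (@edist_eq_zero M g.metricSpace.toEMetricSpace _ _).1 ?_,
      (@edist_eq_zero M g.metricSpace.toEMetricSpace _ _).1 hL, fun s hs t ht ↦
      g.rdist_le_of_edistance_le (abs_nonneg _) (hσ s hs t ht)⟩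
    exact (g.edistance_comm _ _).trans h0
  · intro R hR σ hσ
    have hgeo : g.IsGeodesicOn σ {t : ℝ | ((0 : ℝ) : EReal) < (t : EReal) ∧ (t : EReal) < R} := by
      rw [g.isGeodesicOn_iff (isOpen_setOf_ereal_lt _ _)]
      rintro t ⟨h0, h1⟩
      rw [EReal.coe_lt_coe_iff] at h0 h1
      exact g.isGeodesicAt_of_isometric (Ioo_mem_nhds h0 h1) fun s hs t ht ↦
        hσ s ⟨hs.1.le, hs.2⟩ t ⟨ht.1.le, ht.2⟩
    obtain ⟨γ, hγ, hγσ⟩ := hg _ _ (EReal.coe_lt_coe_iff.2 hR) σ hgeo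
    -- The extension through `R` is continuous there, so its value at `R` is the missing end point
    -- of the minimizing curve.
    have hc : ContinuousAt γ R := (hγ.1.contMDiffAt univ_mem).continuousAt
    refine ⟨γ R, (hc.tendsto.mono_left nhdsWithin_le_nhds).congr' ?_⟩
    filter_upwards [Ioo_mem_nhdsLT hR] with t ht
    exact hγσ t (EReal.coe_lt_coe_iff.2 ht.1) (EReal.coe_lt_coe_iff.2 ht.2)

end C1RiemannianMetric

theorem mainTheorem8 (n : ℕ) (M : Type*) [TopologicalSpace M] [T2Space M] [ConnectedSpace M]
    [ChartedSpace (EuclideanSpace ℝ (Fin n)) M] [IsManifold (𝓡 n) ∞ M]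
    (g : C1RiemannianMetric n M) :
    List.TFAE [
      letI : MetricSpace M := g.metricSpace; CompleteSpace M,
      letI : MetricSpace M := g.metricSpace; ProperSpace M,
      g.GeodesicallyComplete] := by
  tfae_have 2 → 1 := fun h ↦
    @complete_of_proper M g.metricSpace.toPseudoMetricSpace h
  tfae_have 1 → 3 := fun h ↦ g.geodesicallyComplete_of_completeSpace h
  tfae_have 3 → 2 := fun h ↦ g.properSpace_of_geodesicallyComplete h
  tfae_finish
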